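/- Let $M$ be an $n$-dimensional smooth manifold without boundary, $g$ a smooth Riemannian metric, $T$ a smooth totally symmetric covariant tensor field of order three (the skewness tensor), $C$ a smooth covariant tensor field of order four (possibly zero), and $\alpha\in\mathbb R$. Consider the Lagrangian on $TM$ $$L(q,v)=\tfrac12 g_{ij}(q)v^iv^j+\tfrac{\alpha}{6}T_{ijk}(q)v^iv^jv^k+\tfrac1{24}C_{ijkl}(q)v^iv^jv^kv^l .$$ Assume that its dynamics is solvable near the diagonal: there are an open neighbourhood $U\subseteq M\times M$ of the diagonal and a smooth map $\Gamma:[0,1]\times U\to M$ such that for every $(x,y)\in U$ the curve $\gamma_{x,y}=\Gamma(\cdot,(x,y))$ solves the Euler–Lagrange equations of $L$ on $[0,1]$ with $\gamma_{x,y}(0)=x$ and $\gamma_{x,y}(1)=y$, and such that $\gamma_{q,q}$ is the constant solution $q$ for every $q\in M$. Let $$S(x,y)=\int_0^1 L(\gamma_{x,y}(t),\dot\gamma_{x,y}(t))\,dt$$ be Hamilton's principal function. For a vector field $X$ on $M$ let $X_L=(X,0)$ and $X_R=(0,X)$ be its lifts to $M\times M$, let $D(q)=(q,q)$ be the diagonal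 embedding, and write $LRR(X,Y,Z)=D^*(\mathcal L_{X_L}\mathcal L_{Y_R}\mathcal L_{Z_R}S)$, and similarly for the other words in $L$ and $R$. Then, for all smooth vector fields $X,Y,Z,W$ on $M$: 1. $S$ is smooth on $U$ and is a potential function: $D^*(\mathcal L_VS)=0$ for every smooth vector field $V$ on $M\times M$. 2. $S$ generates $g$: $LL(X,Y)=RR(X,Y)=-RL(X,Y)=-LR(X,Y)=g(X,Y)$. 3. In every chart of $M$, used on both factors, and at every point $q$ of it, $$\frac{\partial^2S}{\partial x^i\partial x^j}\Big|_{x=y=q}=\frac{\partial^2S}{\partial y^i\partial y^j}\Big|_{x=y=q}=g_{ij}(q),\qquad \frac{\partial^2S}{\partial y^i\partial x^j}\Big|_{x=y=q}=\frac{\partial^2S}{\partial x^i\partial y^j}\Big|_{x=y=q}=-g_{ij}(q),$$ $$\frac{\partial^3S}{\partial x^l\partial x^k\partial y^j}\Big|_{x=y=q}=-\Gamma_{jkl}(q)+\alpha T_{jkl}(q),\qquad \frac{\partial^3S}{\partial y^l\partial y^k\partial x^j}\Big|_{x=y=q}=-\Gamma_{jkl}(q)-\alpha T_{jkl}(q),$$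 where $\Gamma_{jkl}=\frac12(\partial_kg_{jl}+\partial_lg_{jk}-\partial_jg_{kl})$ are the Christoffel symbols of the first kind of the Levi-Civita connection. 4. If $\alpha=\frac12$, then $S$ generates $T$: $$(LLR-RRL)(X,Y,Z)=(LRL-RLR)(X,Y,Z)=T(X,Y,Z),\qquad (LRR-RLL)(X,Y,Z)=(LLL-RRR)(X,Y,Z)=-T(X,Y,Z).$$ 5. The fourth-order combinations vanish identically, $Q_1(X,Y,Z,W)=Q_2(X,Y,Z,W)=0$, where $$Q_1=(LRRL-RLLR)+(LRRR-RLLL)+(LRLL-RLRR)+(LRLR-RLRL),$$ $$Q_2=(LLLL-RRRR)+(LLLR-RRRL)+(LLRL-RRLR)+(LLRR-RRLL).$$ -/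

import Mathlib

open Set
open scoped Manifold ContDiff

noncomputable section

namespace HamiltonPotential

/-- The model space `ℝⁿ`; all manifolds below are `n`-dimensional, without boundary. -/
abbrev Euc (n : ℕ) : Type := EuclideanSpace ℝ (Fin n)

/-- The `i`-th standard basis vector of `ℝⁿ`. -/
def basisVec {n : ℕ} (i : Fin n) : Euc n := EuclideanSpace.single i (1 : ℝ)

section Tensors

variable {n : ℕ} {M : Type*} [TopologicalSpace M] [ChartedSpace (Euc n) M]

/-- The tangent vector of `M` at the point with coordinates `x` in the chart `φ` whose coordinate
expression is `w`. -/
def chartVec (φ : OpenPartialHomeomorph M (Euc n)) (x w : Euc n) :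
    TangentSpace 𝓘(ℝ, Euc n) (φ.symm x) :=
  mfderiv 𝓘(ℝ, Euc n) 𝓘(ℝ, Euc n) φ.symm x w

/-- A smooth covariant tensor field of order `k`: a multilinear form on every tangent space, whose
components in every chart of the smooth structure are smooth functions. -/
structure CovTensorField (k n : ℕ) (M : Type*) [TopologicalSpace M]
    [ChartedSpace (Euc n) M] where
  toFun : ∀ p : M, MultilinearMap ℝ (fun _ : Fin k => TangentSpace 𝓘(ℝ, Euc n) p) ℝ
  smooth : ∀ φ ∈ IsManifold.maximalAtlas 𝓘(ℝ, Euc n) ∞ M, ∀ idx : Fin k → Fin n,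
    ContDiffOn ℝ ∞
      (fun x => toFun (φ.symm x) (fun a => chartVec φ x (basisVec (idx a)))) φ.target

/-- Total symmetry of a covariant tensor field. -/
def CovTensorField.IsSymmetric {k : ℕ} (T : CovTensorField k n M) : Prop :=
  ∀ (p : M) (σ : Equiv.Perm (Fin k)) (v : Fin k → TangentSpace 𝓘(ℝ, Euc n) p),
    T.toFun p (fun a => v (σ a)) = T.toFun p v

/-- Smooth Riemannian metrics on `M`. -/
abbrev RiemMetric (n : ℕ) (M : Type*) [TopologicalSpace M] [ChartedSpace (Euc n) M]
    [IsManifold 𝓘(ℝ, Euc n) ∞ M] :=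
  Bundle.ContMDiffRiemannianMetric 𝓘(ℝ, Euc n) ∞ (Euc n)
    (TangentSpace 𝓘(ℝ, Euc n) : M → Type)

/-- The components `T_{i₁ … i_k}` of a tensor field at the point with coordinates `x` in `φ`. -/
def tensorCoord {k : ℕ} (T : CovTensorField k n M) (φ : OpenPartialHomeomorph M (Euc n))
    (idx : Fin k → Fin n) (x : Euc n) : ℝ :=
  T.toFun (φ.symm x) (fun a => chartVec φ x (basisVec (idx a)))

variable [IsManifold 𝓘(ℝ, Euc n) ∞ M]

/-- The components `g_{ij}` of the metric at the point with coordinates `x` in the chart `φ`. -/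
def metricCoord (g : RiemMetric n M) (φ : OpenPartialHomeomorph M (Euc n))
    (i j : Fin n) (x : Euc n) : ℝ :=
  g.inner (φ.symm x) (chartVec φ x (basisVec i)) (chartVec φ x (basisVec j))

/-- The Christoffel symbols of the first kind of the Levi-Civita connection,
`Γ_{jkl} = (∂_k g_{jl} + ∂_l g_{jk} - ∂_j g_{kl}) / 2`. -/
def christoffel (g : RiemMetric n M) (φ : OpenPartialHomeomorph M (Euc n))
    (j k l : Fin n) (x : Euc n) : ℝ :=
  (fderiv ℝ (metricCoord g φ j l) x (basisVec k) + fderiv ℝ (metricCoord g φ j k) x (basisVec l)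
    - fderiv ℝ (metricCoord g φ k l) x (basisVec j)) / 2

end Tensors

section Mechanics

variable {n : ℕ} {M : Type*} [TopologicalSpace M] [ChartedSpace (Euc n) M]

variable (n M) in
/-- Lagrangians, i.e. real functions on the tangent bundle. -/
abbrev Lagrangian := ∀ q : M, TangentSpace 𝓘(ℝ, Euc n) q → ℝ

/-- The Lagrangian
`L = (1/2) g_{ij} vⁱvʲ + (α/6) T_{ijk} vⁱvʲvᵏ + (1/24) C_{ijkl} vⁱvʲvᵏvˡ`. -/
def lagrangian [IsManifold 𝓘(ℝ, Euc n) ∞ M] (g : RiemMetric n M) (α : ℝ)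
    (T : CovTensorField 3 n M) (C : CovTensorField 4 n M) : Lagrangian n M :=
  fun q v => 1 / 2 * g.inner q v v + α / 6 * T.toFun q (fun _ => v)
    + 1 / 24 * C.toFun q (fun _ => v)

/-- The velocity of a curve `γ : [0, 1] → M` (one-sided at the end points). -/
def velocity (γ : ℝ → M) (t : ℝ) : TangentSpace 𝓘(ℝ, Euc n) (γ t) :=
  mfderivWithin 𝓘(ℝ, ℝ) 𝓘(ℝ, Euc n) γ (Icc (0 : ℝ) 1) t (1 : ℝ)

/-- The action of a curve `γ : [0, 1] → M`. -/
def action (L : Lagrangian n M) (γ : ℝ → M) : ℝ :=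
  ∫ t in (0 : ℝ)..1, L (γ t) (velocity γ t)

/-- The Lagrangian in the coordinates `(x, v)` induced by the chart `φ`. -/
def lagrangianCoord (L : Lagrangian n M) (φ : OpenPartialHomeomorph M (Euc n))
    (x v : Euc n) : ℝ :=
  L (φ.symm x) (chartVec φ x v)

/-- The Euler-Lagrange equations `d/dt (∂L/∂vⁱ) = ∂L/∂qⁱ` on the time interval `[0, 1]`, in every
chart of the smooth structure. -/
def SolvesEulerLagrange (L : Lagrangian n M) (γ : ℝ → M) : Prop :=
  ∀ φ ∈ IsManifold.maximalAtlas 𝓘(ℝ, Euc n) ∞ M, ∀ t ∈ Icc (0 : ℝ) 1, γ t ∈ φ.source →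
    ∀ i : Fin n,
      HasDerivWithinAt
        (fun s => fderiv ℝ (fun v => lagrangianCoord L φ (φ (γ s)) v)
          (derivWithin (fun r => φ (γ r)) (Icc (0 : ℝ) 1) s) (basisVec i))
        (fderiv ℝ (fun x => lagrangianCoord L φ x
          (derivWithin (fun r => φ (γ r)) (Icc (0 : ℝ) 1) t)) (φ (γ t)) (basisVec i))
        (Icc (0 : ℝ) 1) t

/-- The dynamics of `L` is solved near the diagonal by `Γ`: on an open neighbourhood `U` of the
diagonal, `Γ (·, (x, y))` is a solution of the equations of motion on `[0, 1]` that goes from `x`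
to `y`, depends smoothly on all its arguments, and is the solution at rest if `x = y`. -/
structure SolvesNearDiagonal (L : Lagrangian n M) (U : Set (M × M)) (Γ : ℝ × (M × M) → M) :
    Prop where
  isOpen : IsOpen U
  diagonal_mem : ∀ q : M, (q, q) ∈ U
  smooth : ContMDiffOn (𝓘(ℝ, ℝ).prod (𝓘(ℝ, Euc n).prod 𝓘(ℝ, Euc n))) 𝓘(ℝ, Euc n) ∞ Γ
    (Icc (0 : ℝ) 1 ×ˢ U)
  start : ∀ z ∈ U, Γ (0, z) = z.1
  finish : ∀ z ∈ U, Γ (1, z) = z.2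
  motion : ∀ z ∈ U, SolvesEulerLagrange L (fun t => Γ (t, z))
  rest : ∀ q : M, ∀ t ∈ Icc (0 : ℝ) 1, Γ (t, (q, q)) = q

/-- Hamilton's principal function: the action of the solution from `x` at time `0` to `y` at
time `1`. -/
def principalFunction (L : Lagrangian n M) (Γ : ℝ × (M × M) → M) : M × M → ℝ :=
  fun z => action L (fun t => Γ (t, z))

end Mechanics

section TwoPointFunctions

variable {n : ℕ} {M : Type*} [TopologicalSpace M] [ChartedSpace (Euc n) M]

/-- The Lie derivative `V(F)` of a function along a vector field on `M × M`. -/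
def lieD (V : ∀ z : M × M, TangentSpace (𝓘(ℝ, Euc n).prod 𝓘(ℝ, Euc n)) z) (F : M × M → ℝ) :
    M × M → ℝ :=
  fun z => mfderiv (𝓘(ℝ, Euc n).prod 𝓘(ℝ, Euc n)) 𝓘(ℝ, ℝ) F z (V z)

/-- A two-point function is a potential function if all its Lie derivatives along smooth vector
fields on `M × M` vanish on the diagonal. -/
def IsPotentialFunction [IsManifold 𝓘(ℝ, Euc n) ∞ M] (S : M × M → ℝ) : Prop :=
  ∀ V : ∀ z : M × M, TangentSpace (𝓘(ℝ, Euc n).prod 𝓘(ℝ, Euc n)) z,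
    ContMDiff (𝓘(ℝ, Euc n).prod 𝓘(ℝ, Euc n)) (𝓘(ℝ, Euc n).prod 𝓘(ℝ, Euc n)).tangent ∞
      (fun z => (⟨z, V z⟩ : TangentBundle (𝓘(ℝ, Euc n).prod 𝓘(ℝ, Euc n)) (M × M))) →
    ∀ p : M, lieD V S (p, p) = 0

/-- Smoothness of a vector field on `M`. -/
def IsSmoothField [IsManifold 𝓘(ℝ, Euc n) ∞ M] (X : ∀ p : M, TangentSpace 𝓘(ℝ, Euc n) p) : Prop :=
  ContMDiff 𝓘(ℝ, Euc n) 𝓘(ℝ, Euc n).tangent ∞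
    (fun p => (⟨p, X p⟩ : TangentBundle 𝓘(ℝ, Euc n) M))

/-- Left or right factor of `M × M`. -/
inductive Side
  | L
  | R

/-- The left lift `X_L = (X, 0)` and the right lift `X_R = (0, X)` of a vector field. -/
def lift (s : Side) (X : ∀ p : M, TangentSpace 𝓘(ℝ, Euc n) p) :
    ∀ z : M × M, TangentSpace (𝓘(ℝ, Euc n).prod 𝓘(ℝ, Euc n)) z :=
  fun z => match s with
    | Side.L => ((X z.1, 0) : TangentSpace 𝓘(ℝ, Euc n) z.1 × TangentSpace 𝓘(ℝ, Euc n) z.2)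
    | Side.R => ((0, X z.2) : TangentSpace 𝓘(ℝ, Euc n) z.1 × TangentSpace 𝓘(ℝ, Euc n) z.2)

/-- `D^*(𝓛_{X_a} 𝓛_{Y_b} S)` at `p`. -/
def diag2 (S : M × M → ℝ) (a b : Side) (X Y : ∀ p : M, TangentSpace 𝓘(ℝ, Euc n) p) (p : M) : ℝ :=
  lieD (lift a X) (lieD (lift b Y) S) (p, p)

/-- `D^*(𝓛_{X_a} 𝓛_{Y_b} 𝓛_{Z_c} S)` at `p`. -/
def diag3 (S : M × M → ℝ) (a b c : Side) (X Y Z : ∀ p : M, TangentSpace 𝓘(ℝ, Euc n) p)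
    (p : M) : ℝ :=
  lieD (lift a X) (lieD (lift b Y) (lieD (lift c Z) S)) (p, p)

/-- `D^*(𝓛_{X_a} 𝓛_{Y_b} 𝓛_{Z_c} 𝓛_{W_d} S)` at `p`. -/
def diag4 (S : M × M → ℝ) (a b c d : Side) (X Y Z W : ∀ p : M, TangentSpace 𝓘(ℝ, Euc n) p)
    (p : M) : ℝ :=
  lieD (lift a X) (lieD (lift b Y) (lieD (lift c Z) (lieD (lift d W) S))) (p, p)

open Side in
/-- `Q₁ = (LRRL - RLLR) + (LRRR - RLLL) + (LRLL - RLRR) + (LRLR - RLRL)`. -/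
def Q1 (S : M × M → ℝ) (X Y Z W : ∀ p : M, TangentSpace 𝓘(ℝ, Euc n) p) (p : M) : ℝ :=
  (diag4 S L R R L X Y Z W p - diag4 S R L L R X Y Z W p)
    + (diag4 S L R R R X Y Z W p - diag4 S R L L L X Y Z W p)
    + (diag4 S L R L L X Y Z W p - diag4 S R L R R X Y Z W p)
    + (diag4 S L R L R X Y Z W p - diag4 S R L R L X Y Z W p)

open Side in
/-- `Q₂ = (LLLL - RRRR) + (LLLR - RRRL) + (LLRL - RRLR) + (LLRR - RRLL)`. -/
def Q2 (S : M × M → ℝ) (X Y Z W : ∀ p : M, TangentSpace 𝓘(ℝ, Euc n) p) (p : M) : ℝ :=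
  (diag4 S L L L L X Y Z W p - diag4 S R R R R X Y Z W p)
    + (diag4 S L L L R X Y Z W p - diag4 S R R R L X Y Z W p)
    + (diag4 S L L R L X Y Z W p - diag4 S R R L R X Y Z W p)
    + (diag4 S L L R R X Y Z W p - diag4 S R R L L X Y Z W p)

/-- A two-point function in the coordinates `(x, y)` given by the chart `φ` on both factors. -/
def twoPointCoord (S : M × M → ℝ) (φ : OpenPartialHomeomorph M (Euc n)) : Euc n × Euc n → ℝ :=
  fun z => S (φ.symm z.1, φ.symm z.2)

/-- The partial derivative `∂F/∂xⁱ` of a function of `(x, y)`. -/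
def partialX (i : Fin n) (F : Euc n × Euc n → ℝ) : Euc n × Euc n → ℝ :=
  fun z => fderiv ℝ F z (basisVec i, 0)

/-- The partial derivative `∂F/∂yⁱ` of a function of `(x, y)`. -/
def partialY (i : Fin n) (F : Euc n × Euc n → ℝ) : Euc n × Euc n → ℝ :=
  fun z => fderiv ℝ F z (0, basisVec i)

end TwoPointFunctions

end HamiltonPotential

end

open HamiltonPotential

namespace HamiltonPotential

set_option maxSynthPendingDepth 3

open Filter Topology MeasureTheory Asymptotics

/-! Everything is a statement about the jet of `S` on the diagonal, so it can be checked in one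
chart. At rest the velocity is zero, and `L` is at least quadratic in the velocity, so `dS` vanishes
on the diagonal. Hence the Hessian there annihilates the diagonal vectors `(k, k)`; the third
derivative vanishes on two diagonal vectors, and with one of them it is the derivative of the
Hessian along the diagonal. What is left to find is the expansion of `s ↦ S (q, q + s h)` to order
three.

This expansion is that of the action of the straight line. By the Euler-Lagrange equations the
velocity of the motion is constant up to `O(s²)` (`IsMotionFamily.velocity_bound`), so motion and
line are `O(s²)` apart in `C¹`. They have the same end points, so the first variation drops out, and
the quadratic Taylor remainder of `L` makes the two actions differ by `O(s⁴)` only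
(`IsMotionFamily.action_expansion`). The tensor `C` enters at order `s⁴`. The line contributes `½
g(h,h) s² + (¼ ∂_h g(h,h) + (α/6) T(h,h,h)) s³`, and polarization turns this into all second and
third derivatives (`HasPotentialJet`).

For the words in `L` and `R`, let `K(x, y) = S(x, y) - S(y, x)`. A word minus the word with all
sides exchanged, both applied to `S`, is the word applied to `K`. The metric parts cancel in `K`:
its derivatives up to order two vanish on the diagonal, and its third derivative is `2 α T` in the
displacements `y - x` (`antisymm_flat`, `antisymm_third`). A word of three letters on `K` therefore
gives `2 α T` with one factor `-1` for each `L`. In fourth order, summing over the sides of the last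
two letters replaces the lifts by fields tangent to the diagonal. Such fields preserve vanishing of
the 2-jet (`IsFlatOnDiagonal.dirD`), so the two remaining derivatives give zero (`lift₄`). -/

theorem ofNat_le_infty (n : ℕ) [n.AtLeastTwo] : (OfNat.ofNat n : ℕ∞ω) ≤ ∞ :=
  WithTop.coe_le_coe.2 (le_top : ((OfNat.ofNat n : ℕ) : ℕ∞) ≤ ⊤)

/-! ### Taylor coefficients in one variable -/

section OneVariable

/-- The lowest coefficient of a remainder that vanishes to positive order is zero, and the rest
vanishes to one order less. -/
theorem coeff_eq_zero_of_isLittleO {c : ℝ} {q : ℝ → ℝ} (hq : ContinuousAt q 0) {k : ℕ}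
    (h : (fun s => c + s * q s) =o[𝓝[≠] (0 : ℝ)] fun s => s ^ k) :
    c = 0 ∧ (0 < k → q =o[𝓝[≠] (0 : ℝ)] fun s => s ^ (k - 1)) := by
  have hc : c = 0 := by
    have h1 : Tendsto (fun s : ℝ => c + s * q s) (𝓝[≠] 0) (𝓝 (c + 0 * q 0)) :=
      (tendsto_const_nhds.add (continuousAt_id.tendsto.mul hq.tendsto)).mono_left nhdsWithin_le_nhds
    have h2 : (fun s => c + s * q s) =o[𝓝[≠] (0 : ℝ)] fun _ => (1 : ℝ) := by
      refine h.trans_isBigO ?_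
      refine (IsBigO.of_bound 1 ?_)
      filter_upwards [nhdsWithin_le_nhds (Metric.ball_mem_nhds (0 : ℝ) one_pos)] with s hs
      have : |s| < 1 := by simpa using hs
      simpa using pow_le_one₀ (abs_nonneg s) this.le
    have h3 := (isLittleO_one_iff ℝ).1 h2
    simpa using tendsto_nhds_unique h1 h3
  refine ⟨hc, fun hk => ?_⟩
  subst hc
  rw [isLittleO_iff] at h ⊢
  intro ε hε
  filter_upwards [h hε, self_mem_nhdsWithin] with s hs hs0
  have hs0' : 0 < |s| := abs_pos.2 hs0
  obtain ⟨m, rfl⟩ := Nat.exists_eq_succ_of_ne_zero hk.ne'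
  simp only [zero_add, norm_mul, Real.norm_eq_abs, abs_pow, pow_succ] at hs
  simp only [Nat.succ_sub_one, Real.norm_eq_abs, abs_pow]
  have : |s| * |q s| ≤ |s| * (ε * |s| ^ m) := by linarith
  exact le_of_mul_le_mul_left this hs0'

/-- The derivatives up to order three of a function are determined by its expansion up to fourth
order errors. -/
theorem deriv_eq_of_expansion {f₀ f₁ f₂ f₃ : ℝ → ℝ}
    (h₀ : ∀ᶠ s in 𝓝 (0 : ℝ), HasDerivAt f₀ (f₁ s) s)
    (h₁ : ∀ᶠ s in 𝓝 (0 : ℝ), HasDerivAt f₁ (f₂ s) s)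
    (h₂ : ∀ᶠ s in 𝓝 (0 : ℝ), HasDerivAt f₂ (f₃ s) s) (h₃ : ContinuousAt f₃ 0) {a b K : ℝ}
    (h : ∀ᶠ s in 𝓝 (0 : ℝ), |f₀ s - (a * s ^ 2 + b * s ^ 3)| ≤ K * |s| ^ 4) :
    f₁ 0 = 0 ∧ f₂ 0 = 2 * a ∧ f₃ 0 = 6 * b := by
  obtain ⟨r, hr, hr'⟩ := Metric.eventually_nhds_iff_ball.1 (h₀.and (h₁.and h₂))
  set B : Set ℝ := Metric.ball 0 r
  have hB : Convex ℝ B := convex_ball _ _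
  have h0B : (0 : ℝ) ∈ B := Metric.mem_ball_self hr
  have hN : 𝓝[B] (0 : ℝ) = 𝓝 0 := nhdsWithin_eq_nhds.2 (Metric.ball_mem_nhds _ hr)
  -- Taylor's formula with Peano remainder: continuity of `f₃` gives a remainder `o(1)`, and each
  -- passage to a primitive on the convex ball raises the order by one.
  have e3 : (fun s => f₃ s - f₃ 0) =o[𝓝[B] 0] fun s : ℝ => (s - 0) ^ 0 := by
    simp only [pow_zero, isLittleO_one_iff]
    rw [tendsto_sub_nhds_zero_iff, hN]
    exact h₃
  have e2 := Convex.isLittleO_pow_succ_real (f := fun s => f₂ s - (f₂ 0 + s * f₃ 0)) hB h0B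
    (fun s hs => by
      have := ((hr' s hs).2.2.sub ((hasDerivAt_const s (f₂ 0)).add
        ((hasDerivAt_id s).mul_const (f₃ 0)))).hasDerivWithinAt (s := B)
      simpa [Pi.sub_def] using this) e3
  simp only [zero_mul, add_zero, sub_self, sub_zero, zero_add] at e2
  have e1 := Convex.isLittleO_pow_succ_real
    (f := fun s => f₁ s - (f₁ 0 + s * f₂ 0 + s ^ 2 * (f₃ 0 / 2))) hB h0B
    (fun s hs => by
      have := ((hr' s hs).2.1.sub (((hasDerivAt_const s (f₁ 0)).add
        ((hasDerivAt_id s).mul_const (f₂ 0))).add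
        ((hasDerivAt_pow 2 s).mul_const (f₃ 0 / 2)))).hasDerivWithinAt (s := B)
      refine this.congr_deriv (g' := f₂ s - (f₂ 0 + s * f₃ 0)) ?_
      simp; ring) (n := 1) (by simpa using e2)
  simp only [zero_mul, add_zero, sub_self, sub_zero, ne_eq, OfNat.ofNat_ne_zero, not_false_eq_true,
    zero_pow] at e1
  have e0 := Convex.isLittleO_pow_succ_real
    (f := fun s => f₀ s - (f₀ 0 + s * f₁ 0 + s ^ 2 * (f₂ 0 / 2) + s ^ 3 * (f₃ 0 / 6))) hB h0B
    (fun s hs => by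
      have := ((hr' s hs).1.sub ((((hasDerivAt_const s (f₀ 0)).add
        ((hasDerivAt_id s).mul_const (f₁ 0))).add
        ((hasDerivAt_pow 2 s).mul_const (f₂ 0 / 2))).add
        ((hasDerivAt_pow 3 s).mul_const (f₃ 0 / 6)))).hasDerivWithinAt (s := B)
      refine this.congr_deriv (g' := f₁ s - (f₁ 0 + s * f₂ 0 + s ^ 2 * (f₃ 0 / 2))) ?_
      simp; ring) (n := 2) (by simpa using e1)
  simp only [zero_mul, add_zero, sub_self, sub_zero, ne_eq, OfNat.ofNat_ne_zero, not_false_eq_true,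
    zero_pow, hN] at e0
  have hO : (fun s => f₀ s - (a * s ^ 2 + b * s ^ 3)) =o[𝓝 0] fun s : ℝ => s ^ 3 := by
    refine (IsBigO.of_bound K ?_ : _ =O[𝓝 0] fun s : ℝ => s ^ 4).trans_isLittleO
      (isLittleO_pow_pow (by norm_num))
    filter_upwards [h] with s hs
    simpa using hs
  -- The difference of the two remainders is a cubic polynomial that is `o(s³)`. Its coefficients
  -- are peeled off from the lowest one, dividing by `s` on the punctured neighbourhood.
  have key := (hO.sub e0).mono (nhdsWithin_le_nhds (s := {0}ᶜ))
  have key' : (fun s : ℝ => f₀ 0 + s * (f₁ 0 + s * ((f₂ 0 / 2 - a) + s * (f₃ 0 / 6 - b))))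
      =o[𝓝[≠] (0 : ℝ)] fun s => s ^ 3 := by
    refine key.congr_left fun s => ?_
    ring
  obtain ⟨-, k1⟩ := coeff_eq_zero_of_isLittleO (by fun_prop) key'
  obtain ⟨c1, k2⟩ := coeff_eq_zero_of_isLittleO (by fun_prop) (k1 (by norm_num))
  obtain ⟨c2, k3⟩ := coeff_eq_zero_of_isLittleO (by fun_prop) (k2 (by norm_num))
  have k3' := k3 (by norm_num)
  simp only [Nat.reduceSub, pow_zero] at k3'
  have c3 := tendsto_nhds_unique tendsto_const_nhds ((isLittleO_one_iff ℝ).1 k3')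
  refine ⟨c1, ?_, ?_⟩ <;> linarith

end OneVariable

/-! ### Uniform Taylor bounds and integrals with parameters -/

section Calculus

variable {H E : Type} [NormedAddCommGroup H] [NormedSpace ℝ H]
  [NormedAddCommGroup E] [NormedSpace ℝ E]

/-- The quadratic error bound of the first order Taylor expansion of a `C²` function, uniformly in
the base point. -/
theorem exists_taylor_bound {f : H → E} {a : H} (hf : ContDiffAt ℝ 2 f a) :
    ∃ K, 0 ≤ K ∧ ∀ᶠ p in 𝓝 (a, a),
      ‖f p.2 - f p.1 - fderiv ℝ f p.1 (p.2 - p.1)‖ ≤ K * ‖p.2 - p.1‖ ^ 2 := by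
  have h1 : ContDiffAt ℝ 1 (fderiv ℝ f) a := hf.fderiv_right (by norm_num)
  obtain ⟨K, t, ht, hK⟩ := h1.exists_lipschitzOnWith
  have hd : ∀ᶠ x in 𝓝 a, DifferentiableAt ℝ f x := by
    filter_upwards [hf.eventually (by simp)] with x hx
    exact hx.differentiableAt (by simp)
  obtain ⟨r, hr, hrt⟩ := Metric.mem_nhds_iff.1 (Filter.inter_mem ht hd)
  refine ⟨K, K.2, ?_⟩
  have : Metric.ball a r ×ˢ Metric.ball a r ∈ 𝓝 (a, a) :=
    prod_mem_nhds (Metric.ball_mem_nhds _ hr) (Metric.ball_mem_nhds _ hr)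
  filter_upwards [this] with ⟨x, y⟩ ⟨hx, hy⟩
  have hseg : segment ℝ x y ⊆ Metric.ball a r := (convex_ball a r).segment_subset hx hy
  -- On the segment the derivative differs from its value at `x` by at most `K * ‖y - x‖`, where `K`
  -- is a local Lipschitz constant of `fderiv ℝ f`. This is why one constant serves all base points
  -- near `a`.
  have := (convex_segment x y).norm_image_sub_le_of_norm_hasFDerivWithin_le' (𝕜 := ℝ) (f := f)
    (f' := fderiv ℝ f) (φ := fderiv ℝ f x) (C := K * ‖y - x‖)
    (fun z hz => (hrt (hseg hz)).2.hasFDerivAt.hasFDerivWithinAt)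
    (fun z hz => by
      have h2 := hK.dist_le_mul _ (hrt (hseg hz)).1 _ (hrt hx).1
      rw [dist_eq_norm, dist_eq_norm] at h2
      refine h2.trans (mul_le_mul_of_nonneg_left ?_ K.2)
      have := norm_sub_le_of_mem_segment hz
      simpa using this)
    (left_mem_segment ℝ x y) (right_mem_segment ℝ x y)
  calc _ ≤ K * ‖y - x‖ * ‖y - x‖ := this
    _ = _ := by ring

/-- The directional derivatives of a function at a point are determined by its expansion along
lines up to fourth order errors. -/
theorem fderiv_eq_of_expansion {f : H → ℝ} {p u : H} (hf : ContDiffAt ℝ 4 f p) {a b K : ℝ}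
    (h : ∀ᶠ s in 𝓝 (0 : ℝ), |f (p + s • u) - (a * s ^ 2 + b * s ^ 3)| ≤ K * |s| ^ 4) :
    fderiv ℝ f p u = 0 ∧ fderiv ℝ (fderiv ℝ f) p u u = 2 * a ∧
      fderiv ℝ (fderiv ℝ (fderiv ℝ f)) p u u u = 6 * b := by
  have h1 : ContDiffAt ℝ 3 (fderiv ℝ f) p := hf.fderiv_right (by norm_num)
  have h2 : ContDiffAt ℝ 2 (fderiv ℝ (fderiv ℝ f)) p := h1.fderiv_right (by norm_num)
  have h3 : ContDiffAt ℝ 1 (fderiv ℝ (fderiv ℝ (fderiv ℝ f))) p := h2.fderiv_right (by norm_num)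
  have hline : ∀ s : ℝ, HasDerivAt (fun s : ℝ => p + s • u) u s := fun s => by
    simpa using ((hasDerivAt_id s).smul_const u).const_add p
  have ht : Tendsto (fun s : ℝ => p + s • u) (𝓝 0) (𝓝 p) := by
    simpa using (hline 0).continuousAt.tendsto
  have ev : ∀ {G : Type} [NormedAddCommGroup G] [NormedSpace ℝ G] {g : H → G} {m : ℕ∞ω}
      (_ : ContDiffAt ℝ m g p) (_ : m ≠ ∞) (_ : m ≠ 0),
      ∀ᶠ s in 𝓝 (0 : ℝ), HasDerivAt (fun s : ℝ => g (p + s • u)) (fderiv ℝ g (p + s • u) u) s := by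
    intro G _ _ g m hg hm hm0
    filter_upwards [ht.eventually (hg.eventually hm)] with s hs
    exact (hs.differentiableAt hm0).hasFDerivAt.comp_hasDerivAt s (hline s)
  have := deriv_eq_of_expansion (f₀ := fun s => f (p + s • u))
    (f₁ := fun s => fderiv ℝ f (p + s • u) u)
    (f₂ := fun s => fderiv ℝ (fderiv ℝ f) (p + s • u) u u)
    (f₃ := fun s => fderiv ℝ (fderiv ℝ (fderiv ℝ f)) (p + s • u) u u u)
    (ev hf (by decide) (by norm_num))
    ((ev h1 (by decide) (by norm_num)).mono fun s hs => by
      simpa using hs.clm_apply (hasDerivAt_const s u))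
    ((ev h2 (by decide) (by norm_num)).mono fun s hs => by
      simpa using (hs.clm_apply (hasDerivAt_const s u)).clm_apply (hasDerivAt_const s u))
    (by
      have hc : ContinuousAt (fun s : ℝ => fderiv ℝ (fderiv ℝ (fderiv ℝ f)) (p + s • u)) 0 :=
        ContinuousAt.comp (g := fderiv ℝ (fderiv ℝ (fderiv ℝ f))) (f := fun s : ℝ => p + s • u)
          (by simpa using h3.continuousAt) (hline 0).continuousAt
      exact ((hc.clm_apply continuousAt_const).clm_apply continuousAt_const).clm_apply
        continuousAt_const) h
  simpa using this

/-- A `C¹` family of functions on a compact interval is Lipschitz in the parameter, uniformly on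
the interval. -/
theorem exists_uniform_lipschitz_bound [FiniteDimensional ℝ H] {w : ℝ × H → E} {O : Set H}
    (hO : IsOpen O) (hw : ContDiffOn ℝ 1 w (Icc (0 : ℝ) 1 ×ˢ O)) {z₀ : H} (hz₀ : z₀ ∈ O) :
    ∃ K, 0 ≤ K ∧ ∀ᶠ z in 𝓝 z₀, ∀ t ∈ Icc (0 : ℝ) 1, ‖w (t, z) - w (t, z₀)‖ ≤ K * ‖z - z₀‖ := by
  have : ProperSpace H := FiniteDimensional.proper ℝ H
  obtain ⟨r, hr, hrO⟩ := Metric.nhds_basis_closedBall.mem_iff.1 (hO.mem_nhds hz₀)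
  have hU : UniqueDiffOn ℝ (Icc (0 : ℝ) 1 ×ˢ O) :=
    (uniqueDiffOn_Icc zero_lt_one).prod hO.uniqueDiffOn
  have hc : ContinuousOn (fderivWithin ℝ w (Icc (0 : ℝ) 1 ×ˢ O)) (Icc (0 : ℝ) 1 ×ˢ O) :=
    hw.continuousOn_fderivWithin hU (by simp)
  have hsub : Icc (0 : ℝ) 1 ×ˢ Metric.closedBall z₀ r ⊆ Icc (0 : ℝ) 1 ×ˢ O :=
    prod_mono le_rfl hrO
  obtain ⟨K, hK⟩ := (isCompact_Icc.prod (isCompact_closedBall z₀ r)).exists_bound_of_continuousOn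
    (hc.mono hsub)
  refine ⟨|K|, abs_nonneg K, ?_⟩
  filter_upwards [Metric.closedBall_mem_nhds z₀ hr] with z hz t ht
  have := ((convex_Icc (0 : ℝ) 1).prod (convex_closedBall z₀ r)).norm_image_sub_le_of_norm_hasFDerivWithin_le
    (𝕜 := ℝ) (f := w) (C := |K|)
    (fun p hp => ((hw.differentiableOn (by simp)) p (hsub hp)).hasFDerivWithinAt.mono hsub)
    (fun p hp => (hK p hp).trans (le_abs_self K)) (x := (t, z₀)) (y := (t, z))
    ⟨ht, Metric.mem_closedBall_self hr.le⟩ ⟨ht, hz⟩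
  simpa [Prod.norm_def] using this

/-- Differentiation under the integral sign. The dominating constant is the maximum of the
derivative on the compact product of the time interval with a closed ball; derivatives are taken
within the closed interval, hence are one-sided in time at its ends. -/
theorem hasFDerivAt_intervalIntegral_of_contDiffOn [FiniteDimensional ℝ H] {f : ℝ × H → E}
    {O : Set H} (hO : IsOpen O) (hf : ContDiffOn ℝ 1 f (Icc (0 : ℝ) 1 ×ˢ O)) {z₀ : H}
    (hz₀ : z₀ ∈ O) :
    HasFDerivAt (fun z => ∫ t in (0 : ℝ)..1, f (t, z))
      (∫ t in (0 : ℝ)..1, (fderivWithin ℝ f (Icc (0 : ℝ) 1 ×ˢ O) (t, z₀)).comp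
        (ContinuousLinearMap.inr ℝ ℝ H)) z₀ := by
  have : ProperSpace H := FiniteDimensional.proper ℝ H
  obtain ⟨r, hr, hrO⟩ := Metric.nhds_basis_closedBall.mem_iff.1 (hO.mem_nhds hz₀)
  have hU : UniqueDiffOn ℝ (Icc (0 : ℝ) 1 ×ˢ O) :=
    (uniqueDiffOn_Icc zero_lt_one).prod hO.uniqueDiffOn
  set f' : ℝ × H → (H →L[ℝ] E) := fun p => (fderivWithin ℝ f (Icc (0 : ℝ) 1 ×ˢ O) p).comp
        (ContinuousLinearMap.inr ℝ ℝ H)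
  have hc : ContinuousOn f' (Icc (0 : ℝ) 1 ×ˢ O) :=
    (hf.continuousOn_fderivWithin hU (by simp)).clm_comp continuousOn_const
  have hsub : Icc (0 : ℝ) 1 ×ˢ Metric.closedBall z₀ r ⊆ Icc (0 : ℝ) 1 ×ˢ O :=
    prod_mono le_rfl hrO
  obtain ⟨K, hK⟩ := (isCompact_Icc.prod (isCompact_closedBall z₀ r)).exists_bound_of_continuousOn
    (hc.mono hsub)
  have hslice : ∀ z ∈ O, MapsTo (fun t : ℝ => (t, z)) (Icc 0 1) (Icc (0 : ℝ) 1 ×ˢ O) :=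
    fun z hz t ht => ⟨ht, hz⟩
  have hcs : ∀ z ∈ O, ContinuousOn (fun t => f (t, z)) (Icc (0 : ℝ) 1) := fun z hz =>
    hf.continuousOn.comp (by fun_prop) (hslice z hz)
  have hcs' : ContinuousOn (fun t => f' (t, z₀)) (Icc (0 : ℝ) 1) :=
    hc.comp (by fun_prop) (hslice z₀ hz₀)
  have hIoc : uIoc (0 : ℝ) 1 = Ioc 0 1 := uIoc_of_le zero_le_one
  refine intervalIntegral.hasFDerivAt_integral_of_dominated_of_fderiv_le
    (F := fun z t => f (t, z)) (F' := fun z t => f' (t, z)) (bound := fun _ => K)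
    (Metric.ball_mem_nhds z₀ hr) ?_ ?_ ?_ ?_ ?_ ?_
  · filter_upwards [hO.mem_nhds hz₀] with z hz
    rw [hIoc]
    exact ((hcs z hz).mono Ioc_subset_Icc_self).aestronglyMeasurable measurableSet_Ioc
  · exact (hcs z₀ hz₀).intervalIntegrable_of_Icc zero_le_one
  · rw [hIoc]
    exact (hcs'.mono Ioc_subset_Icc_self).aestronglyMeasurable measurableSet_Ioc
  · refine ae_of_all _ fun t ht z hz => hK (t, z) ⟨?_, Metric.ball_subset_closedBall hz⟩
    rw [hIoc] at ht
    exact Ioc_subset_Icc_self ht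
  · exact intervalIntegrable_const
  · refine ae_of_all _ fun t ht z hz => ?_
    rw [hIoc] at ht
    have hzO := hrO (Metric.ball_subset_closedBall hz)
    have h1 := (hf.differentiableOn (by simp) (t, z) ⟨Ioc_subset_Icc_self ht, hzO⟩).hasFDerivWithinAt
    have h2 : HasFDerivWithinAt (fun z' : H => (t, z')) (ContinuousLinearMap.inr ℝ ℝ H) O z :=
      (hasFDerivAt_prodMk_right t z).hasFDerivWithinAt
    exact (h1.comp z h2 fun z' hz' => ⟨Ioc_subset_Icc_self ht, hz'⟩).hasFDerivAt
      (hO.mem_nhds hzO)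

/-- Integrals over a compact interval depend smoothly on parameters. -/
theorem contDiffOn_intervalIntegral [FiniteDimensional ℝ H] {f : ℝ × H → E} {O : Set H}
    (hO : IsOpen O) (hf : ContDiffOn ℝ ∞ f (Icc (0 : ℝ) 1 ×ˢ O)) :
    ContDiffOn ℝ ∞ (fun z => ∫ t in (0 : ℝ)..1, f (t, z)) O := by
  have hU : UniqueDiffOn ℝ (Icc (0 : ℝ) 1 ×ˢ O) :=
    (uniqueDiffOn_Icc zero_lt_one).prod hO.uniqueDiffOn
  rw [contDiffOn_infty]
  intro n
  -- The target must vary: the derivative of such an integral is again one, with values in `H →L[ℝ]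
  -- E`.
  induction n generalizing E with
  | zero =>
    refine contDiffOn_zero.2 fun z hz => ?_
    exact (hasFDerivAt_intervalIntegral_of_contDiffOn hO (hf.of_le (by exact_mod_cast le_top))
      hz).continuousAt.continuousWithinAt
  | succ n ih =>
    push_cast
    rw [contDiffOn_succ_iff_fderiv_of_isOpen hO]
    have hd := fun z hz => hasFDerivAt_intervalIntegral_of_contDiffOn hO
      (hf.of_le (by exact_mod_cast le_top)) (z₀ := z) hz
    refine ⟨fun z hz => (hd z hz).differentiableAt.differentiableWithinAt, by simp, ?_⟩
    refine ContDiffOn.congr (ih (f := fun p => (fderivWithin ℝ f (Icc (0 : ℝ) 1 ×ˢ O) p).comp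
        (ContinuousLinearMap.inr ℝ ℝ H)) ?_) fun z hz => (hd z hz).fderiv
    exact (hf.fderivWithin hU (by simp)).clm_comp contDiffOn_const

end Calculus

end HamiltonPotential

namespace HamiltonPotential

set_option maxSynthPendingDepth 3

open Filter Topology MeasureTheory Asymptotics

/-! ### The action between nearby points of a coordinate domain -/

section Expansion

variable {E : Type} [NormedAddCommGroup E] [NormedSpace ℝ E]

/-- A function `L = a + b + d` of position and velocity on `Ω`, smooth, where `a`, `b`, `d` are
homogeneous of degree `2`, `3`, `4` in the velocity, and `a` is positive definite. -/
structure IsQuarticLagrangian (L a b d : E → E → ℝ) (Ω : Set E) : Prop where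
  isOpen : IsOpen Ω
  smooth : ContDiffOn ℝ ∞ (fun p : E × E => L p.1 p.2) (Ω ×ˢ univ)
  eq_add : ∀ x v, L x v = a x v + b x v + d x v
  smooth_a : ∀ v, ContDiffOn ℝ ∞ (fun x => a x v) Ω
  smooth_b : ∀ v, ContDiffOn ℝ ∞ (fun x => b x v) Ω
  smooth_d : ∀ v, ContDiffOn ℝ ∞ (fun x => d x v) Ω
  a_smul : ∀ x v, ∀ s : ℝ, a x (s • v) = s ^ 2 * a x v
  b_smul : ∀ x v, ∀ s : ℝ, b x (s • v) = s ^ 3 * b x v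
  d_smul : ∀ x v, ∀ s : ℝ, d x (s • v) = s ^ 4 * d x v
  a_pos : ∀ x ∈ Ω, ∀ v, v ≠ 0 → 0 < a x v

theorem eventually_forall_line {q ξ : E} {P : E → Prop} (h : ∀ᶠ y in 𝓝 q, P y) :
    ∀ᶠ s in 𝓝 (0 : ℝ), ∀ t ∈ Icc (0 : ℝ) 1, P (q + (s * t) • ξ) := by
  obtain ⟨r, hr, hP⟩ := Metric.eventually_nhds_iff_ball.1 h
  have : ∀ᶠ s in 𝓝 (0 : ℝ), |s| * ‖ξ‖ < r := by
    have : Tendsto (fun s : ℝ => |s| * ‖ξ‖) (𝓝 0) (𝓝 (|0| * ‖ξ‖)) :=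
      (by fun_prop : Continuous fun s : ℝ => |s| * ‖ξ‖).tendsto 0
    exact this.eventually_lt_const (by simpa using hr)
  filter_upwards [this] with s hs t ht
  refine hP _ ?_
  rw [mem_ball_iff_norm, add_sub_cancel_left, norm_smul, norm_mul, Real.norm_eq_abs,
    Real.norm_eq_abs, abs_of_nonneg ht.1]
  refine lt_of_le_of_lt ?_ hs
  gcongr
  exact mul_le_of_le_one_right (abs_nonneg s) ht.2

theorem exists_taylor_bound_at {F : Type} [NormedAddCommGroup F] [NormedSpace ℝ F] {f : E → F}
    {q : E} (hf : ContDiffAt ℝ 2 f q) :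
    ∃ K, 0 ≤ K ∧ ∀ᶠ y in 𝓝 q, ‖f y - f q - fderiv ℝ f q (y - q)‖ ≤ K * ‖y - q‖ ^ 2 := by
  obtain ⟨K, hK, h⟩ := exists_taylor_bound hf
  refine ⟨K, hK, ?_⟩
  exact ((Continuous.prodMk_right q).tendsto q).eventually h

/-- Expansion of a quartic Lagrangian along straight lines. -/
theorem IsQuarticLagrangian.expansion {L a b d : E → E → ℝ} {Ω : Set E}
    (hL : IsQuarticLagrangian L a b d Ω) {q : E} (hq : q ∈ Ω) (ξ v : E) :
    ∃ K, ∀ᶠ s in 𝓝 (0 : ℝ), ∀ t ∈ Icc (0 : ℝ) 1,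
      |L (q + (s * t) • ξ) (s • v) -
        (s ^ 2 * a q v + s ^ 3 * (t * fderiv ℝ (fun x => a x v) q ξ + b q v))| ≤ K * |s| ^ 4 := by
  have hΩ := hL.isOpen.mem_nhds hq
  obtain ⟨Ka, hKa, ha⟩ := exists_taylor_bound_at
    (((hL.smooth_a v).contDiffAt hΩ).of_le (ofNat_le_infty 2))
  obtain ⟨Kb, hb⟩ := ((((hL.smooth_b v).contDiffAt hΩ).differentiableAt
    (by simp)).isBigO_sub).bound
  obtain ⟨Kd, hd⟩ := (((hL.smooth_d v).contDiffAt hΩ).continuousAt.isBigO_one ℝ).bound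
  -- One error for each degree: a second order Taylor error of `a` times `s ^ 2`, a first order
  -- increment of `b` times `s ^ 3`, and a bound of `d` times `s ^ 4`.
  refine ⟨Ka * ‖ξ‖ ^ 2 + |Kb| * ‖ξ‖ + |Kd|, ?_⟩
  filter_upwards [eventually_forall_line (ξ := ξ) (ha.and (hb.and hd))] with s hs t ht
  obtain ⟨h1, h2, h3⟩ := hs t ht
  have hn : ‖q + (s * t) • ξ - q‖ ≤ |s| * ‖ξ‖ := by
    rw [add_sub_cancel_left, norm_smul, norm_mul, Real.norm_eq_abs, Real.norm_eq_abs,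
      abs_of_nonneg ht.1]
    gcongr
    exact mul_le_of_le_one_right (abs_nonneg s) ht.2
  rw [hL.eq_add, hL.a_smul, hL.b_smul, hL.d_smul]
  set y := q + (s * t) • ξ
  have hy : fderiv ℝ (fun x => a x v) q (y - q) = s * t * fderiv ℝ (fun x => a x v) q ξ := by
    simp [y]
  rw [hy] at h1
  simp only [Real.norm_eq_abs, norm_one, mul_one] at h1 h2 h3
  have k1 : |a y v - a q v - s * t * fderiv ℝ (fun x => a x v) q ξ| ≤ Ka * (|s| * ‖ξ‖) ^ 2 :=
    h1.trans (by gcongr)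
  have k2 : |b y v - b q v| ≤ |Kb| * (|s| * ‖ξ‖) :=
    h2.trans (by
      have := le_abs_self Kb
      gcongr)
  have k3 : |d y v| ≤ |Kd| := h3.trans (le_abs_self _)
  have e : s ^ 2 * a y v + s ^ 3 * b y v + s ^ 4 * d y v -
        (s ^ 2 * a q v + s ^ 3 * (t * fderiv ℝ (fun x => a x v) q ξ + b q v)) =
      s ^ 2 * (a y v - a q v - s * t * fderiv ℝ (fun x => a x v) q ξ)
        + s ^ 3 * (b y v - b q v) + s ^ 4 * d y v := by ring
  rw [e]
  calc _ ≤ |s| ^ 2 * (Ka * (|s| * ‖ξ‖) ^ 2) + |s| ^ 3 * (|Kb| * (|s| * ‖ξ‖)) + |s| ^ 4 * |Kd| := by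
        refine (abs_add_three _ _ _).trans ?_
        simp only [abs_mul, abs_pow]
        gcongr
    _ = _ := by ring

/-- The derivatives of a quartic Lagrangian at rest. -/
theorem IsQuarticLagrangian.fderiv_rest {L a b d : E → E → ℝ} {Ω : Set E}
    (hL : IsQuarticLagrangian L a b d Ω) {q : E} (hq : q ∈ Ω) :
    fderiv ℝ (fun p : E × E => L p.1 p.2) (q, 0) = 0 ∧
    ∀ u, fderiv ℝ (fderiv ℝ (fun p : E × E => L p.1 p.2)) (q, 0) u u = 2 * a q u.2 := by
  have hsm : ContDiffAt ℝ 4 (fun p : E × E => L p.1 p.2) (q, 0) :=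
    (hL.smooth.contDiffAt ((hL.isOpen.prod isOpen_univ).mem_nhds ⟨hq, mem_univ _⟩)).of_le
      (ofNat_le_infty 4)
  have key : ∀ u : E × E, fderiv ℝ (fun p : E × E => L p.1 p.2) (q, 0) u = 0 ∧
      fderiv ℝ (fderiv ℝ (fun p : E × E => L p.1 p.2)) (q, 0) u u = 2 * a q u.2 := by
    intro u
    -- At `t = 1` the pair of position and velocity runs along the ray from `(q, 0)` in the
    -- direction `u`, so the expansion is a Taylor expansion in both variables together.
    obtain ⟨K, hK⟩ := hL.expansion hq u.1 u.2
    have := fderiv_eq_of_expansion hsm (u := u) (a := a q u.2)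
      (b := fderiv ℝ (fun x => a x u.2) q u.1 + b q u.2) (K := K) (by
        filter_upwards [hK] with s hs
        have := hs 1 (by simp)
        simp only [mul_one, one_mul] at this
        simpa [mul_comm] using this)
    exact ⟨this.1, this.2.1⟩
  exact ⟨ContinuousLinearMap.ext fun u => (key u).1, fun u => (key u).2⟩

theorem IsQuarticLagrangian.apply_zero {L a b d : E → E → ℝ} {Ω : Set E}
    (hL : IsQuarticLagrangian L a b d Ω) (q : E) : L q 0 = 0 := by
  have ha := hL.a_smul q 0 0
  have hb := hL.b_smul q 0 0
  have hd := hL.d_smul q 0 0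
  rw [hL.eq_add]
  simp only [smul_zero] at ha hb hd
  rw [ha, hb, hd]
  simp

/-- The hypothesis reads `2 * B u w + B w w = 0`, and `u = 0` removes the second term. It serves to
show that pure displacements of the position lie in the kernel of the Hessian of `L` at rest. -/
theorem symm_bilin_eq_zero {G : Type} [NormedAddCommGroup G] [NormedSpace ℝ G]
    {B : G →L[ℝ] G →L[ℝ] ℝ} (hB : ∀ u v, B u v = B v u) {w : G}
    (h : ∀ u, B (u + w) (u + w) = B u u) : ∀ u, B u w = 0 := by
  intro u
  have h1 := h u
  have h0 := h 0
  simp only [map_add, add_apply, zero_add, map_zero] at h0 h1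
  have h2 := hB u w
  linarith

/-- The velocity of a smooth family of curves is smooth. -/
theorem contDiffOn_derivWithin_family {H : Type} [NormedAddCommGroup H] [NormedSpace ℝ H]
    {I : Set ℝ} (hI : UniqueDiffOn ℝ I) {V : Set H} (hV : IsOpen V) {c : ℝ × H → E}
    (hc : ContDiffOn ℝ ∞ c (I ×ˢ V)) :
    ContDiffOn ℝ ∞ (fun p : ℝ × H => derivWithin (fun r => c (r, p.2)) I p.1) (I ×ˢ V) := by
  have hU : UniqueDiffOn ℝ (I ×ˢ V) := hI.prod hV.uniqueDiffOn
  refine ((hc.fderivWithin hU (m := ∞) (by simp)).clm_apply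
    (contDiffOn_const (c := ((1 : ℝ), (0 : H))))).congr ?_
  rintro ⟨t, z⟩ ⟨ht, hz⟩
  have h1 := (hc.differentiableOn (by simp) (t, z) ⟨ht, hz⟩).hasFDerivWithinAt
  have h2 : HasDerivWithinAt (fun r : ℝ => (r, z)) ((1 : ℝ), (0 : H)) I t :=
    (hasDerivWithinAt_id t _).prodMk (hasDerivWithinAt_const t _ z)
  have h3 : MapsTo (fun r : ℝ => (r, z)) I (I ×ˢ V) := fun r hr => ⟨hr, hz⟩
  exact (h1.comp_hasDerivWithinAt t h2 h3).derivWithin (hI t ht)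

theorem fderiv_partial {L : E → E → ℝ} {x v : E}
    (h : DifferentiableAt ℝ (fun p : E × E => L p.1 p.2) (x, v)) :
    fderiv ℝ (fun x => L x v) x =
      (fderiv ℝ (fun p : E × E => L p.1 p.2) (x, v)).comp (ContinuousLinearMap.inl ℝ E E) ∧
    fderiv ℝ (fun v => L x v) v =
      (fderiv ℝ (fun p : E × E => L p.1 p.2) (x, v)).comp (ContinuousLinearMap.inr ℝ E E) :=
  ⟨HasFDerivAt.fderiv (HasFDerivAt.comp (f := fun x => (x, v)) x h.hasFDerivAt
    (hasFDerivAt_prodMk_left x v)), HasFDerivAt.fderiv (HasFDerivAt.comp (f := fun v => (x, v)) v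
    h.hasFDerivAt (hasFDerivAt_prodMk_right x v))⟩

variable [FiniteDimensional ℝ E]

/-- A smooth family of solutions of the Euler-Lagrange equations in a domain `Ω` of a vector space,
parametrized by their end points and resting on the diagonal. -/
structure IsMotionFamily (L : E → E → ℝ) (Ω : Set E) (V : Set (E × E)) (c : ℝ × (E × E) → E) :
    Prop where
  isOpen : IsOpen V
  smooth : ContDiffOn ℝ ∞ c (Icc (0 : ℝ) 1 ×ˢ V)
  mem : ∀ z ∈ V, ∀ t ∈ Icc (0 : ℝ) 1, c (t, z) ∈ Ω
  start : ∀ z ∈ V, c (0, z) = z.1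
  finish : ∀ z ∈ V, c (1, z) = z.2
  rest : ∀ q, (q, q) ∈ V → ∀ t ∈ Icc (0 : ℝ) 1, c (t, (q, q)) = q
  motion : ∀ z ∈ V, ∀ t ∈ Icc (0 : ℝ) 1,
    HasDerivWithinAt
      (fun s => fderiv ℝ (fun v => L (c (s, z)) v)
        (derivWithin (fun r => c (r, z)) (Icc (0 : ℝ) 1) s))
      (fderiv ℝ (fun x => L x (derivWithin (fun r => c (r, z)) (Icc (0 : ℝ) 1) t)) (c (t, z)))
      (Icc (0 : ℝ) 1) t

/-- Position and velocity depend on the end points in a Lipschitz way, uniformly in time, and equal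
`(q, 0)` for the motion at rest. So motions between nearby points are slow and stay near `q`. -/
theorem IsMotionFamily.bound {L : E → E → ℝ} {Ω : Set E} {V : Set (E × E)}
    {c : ℝ × (E × E) → E} (hc : IsMotionFamily L Ω V c) {q : E} (hq : (q, q) ∈ V) :
    ∃ K, 0 ≤ K ∧ ∀ᶠ z in 𝓝 (q, q), ∀ t ∈ Icc (0 : ℝ) 1,
      ‖((c (t, z), derivWithin (fun r => c (r, z)) (Icc (0 : ℝ) 1) t) : E × E) - (q, 0)‖ ≤
        K * ‖z - (q, q)‖ := by
  obtain ⟨K, hK, h⟩ := exists_uniform_lipschitz_bound hc.isOpen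
    ((hc.smooth.prodMk (contDiffOn_derivWithin_family (uniqueDiffOn_Icc zero_lt_one) hc.isOpen
      hc.smooth)).of_le
      (by exact_mod_cast (le_top : (1 : ℕ∞) ≤ ⊤))) hq
  refine ⟨K, hK, ?_⟩
  filter_upwards [h] with z hz t ht
  have h1 := hz t ht
  have h2 : derivWithin (fun r => c (r, (q, q))) (Icc (0 : ℝ) 1) t = 0 := by
    rw [derivWithin_congr (f := fun _ => q) (fun s hs => hc.rest q hq s hs) (hc.rest q hq t ht)]
    simp
  simp only [h2, hc.rest q hq t ht] at h1
  exact h1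

/-- The action of a smooth family of motions vanishes to second order at the diagonal. -/
theorem IsMotionFamily.hasFDerivAt_action {L a b d : E → E → ℝ} {Ω : Set E} {V : Set (E × E)}
    {c : ℝ × (E × E) → E} (hL : IsQuarticLagrangian L a b d Ω) (hc : IsMotionFamily L Ω V c)
    {q : E} (hq : (q, q) ∈ V) :
    HasFDerivAt (fun z => ∫ t in (0 : ℝ)..1,
      L (c (t, z)) (derivWithin (fun r => c (r, z)) (Icc (0 : ℝ) 1) t)) (0 : E × E →L[ℝ] ℝ)
      (q, q) := by
  have hqΩ : q ∈ Ω := by simpa [hc.start _ hq] using hc.mem _ hq 0 (by simp)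
  obtain ⟨K, hK, hb⟩ := hc.bound hq
  have hsm : ContDiffAt ℝ 2 (fun p : E × E => L p.1 p.2) (q, 0) :=
    (hL.smooth.contDiffAt ((hL.isOpen.prod isOpen_univ).mem_nhds ⟨hqΩ, mem_univ _⟩)).of_le
      (ofNat_le_infty 2)
  obtain ⟨K₂, hK₂, ht⟩ := exists_taylor_bound_at hsm
  rw [(hL.fderiv_rest hqΩ).1] at ht
  simp only [hL.apply_zero, zero_apply, sub_zero] at ht
  obtain ⟨r, hr, hball⟩ := Metric.eventually_nhds_iff_ball.1 ht
  have hsmall : ∀ᶠ z in 𝓝 (q, q), K * ‖z - (q, q)‖ < r := by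
    have : Tendsto (fun z : E × E => K * ‖z - (q, q)‖) (𝓝 (q, q)) (𝓝 (K * ‖(q, q) - (q, q)‖)) :=
      (by fun_prop : Continuous fun z : E × E => K * ‖z - (q, q)‖).tendsto _
    exact this.eventually_lt_const (by simpa using hr)
  -- The Lagrangian and its first derivative vanish at `(q, 0)`, so the integrand is at most `K₂`
  -- times the square of the distance to `(q, 0)`, itself at most `K * ‖z - (q, q)‖`. A quadratic
  -- bound forces the derivative to be zero.
  refine IsBigO.hasFDerivAt (n := 2) (IsBigO.of_bound (K₂ * K ^ 2) ?_) (by norm_num)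
  filter_upwards [hb, hsmall] with z hz hzr
  have : ∀ t ∈ uIoc (0 : ℝ) 1,
      ‖L (c (t, z)) (derivWithin (fun r => c (r, z)) (Icc (0 : ℝ) 1) t)‖ ≤
        K₂ * (K * ‖z - (q, q)‖) ^ 2 := by
    intro t ht
    rw [uIoc_of_le zero_le_one] at ht
    have h1 := hz t (Ioc_subset_Icc_self ht)
    have h2 := hball (c (t, z), derivWithin (fun r => c (r, z)) (Icc (0 : ℝ) 1) t)
      (by rw [mem_ball_iff_norm]; exact h1.trans_lt hzr)
    refine h2.trans ?_
    gcongr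
  have h3 := intervalIntegral.norm_integral_le_of_norm_le_const this
  refine h3.trans (le_of_eq ?_)
  simp
  ring

/-- The velocity of a motion between nearby points agrees with the velocity of the straight line up
to second order errors. -/
theorem IsMotionFamily.velocity_bound {L a b d : E → E → ℝ} {Ω : Set E} {V : Set (E × E)}
    {c : ℝ × (E × E) → E} (hL : IsQuarticLagrangian L a b d Ω) (hc : IsMotionFamily L Ω V c)
    {q : E} (hq : (q, q) ∈ V) (h : E) :
    ∃ K, 0 ≤ K ∧ ∀ᶠ s in 𝓝 (0 : ℝ), ∀ t ∈ Icc (0 : ℝ) 1,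
      ‖s • h - derivWithin (fun r => c (r, (q, q + s • h))) (Icc (0 : ℝ) 1) t‖ ≤ K * |s| ^ 2 := by
  have hqΩ : q ∈ Ω := by simpa [hc.start _ hq] using hc.mem _ hq 0 (by simp)
  obtain ⟨K, hK, hb⟩ := hc.bound hq
  set Λ : E × E → ℝ := fun p => L p.1 p.2 with hΛ
  have hsm : ContDiffAt ℝ ∞ Λ (q, 0) :=
    hL.smooth.contDiffAt ((hL.isOpen.prod isOpen_univ).mem_nhds ⟨hqΩ, mem_univ _⟩)
  have hsm1 : ContDiffAt ℝ 2 (fderiv ℝ Λ) (q, 0) :=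
    (hsm.of_le (ofNat_le_infty 3)).fderiv_right (by norm_num)
  obtain ⟨K₃, hK₃, ht⟩ := exists_taylor_bound_at hsm1
  obtain ⟨hr1, hr2⟩ := hL.fderiv_rest hqΩ
  have hsymm : ∀ u v, fderiv ℝ (fderiv ℝ Λ) (q, 0) u v = fderiv ℝ (fderiv ℝ Λ) (q, 0) v u :=
    fun u v => (hsm.isSymmSndFDerivAt (by simpa using ofNat_le_infty 2)) u v
  have hzero : ∀ (ξ : E) u, fderiv ℝ (fderiv ℝ Λ) (q, 0) u (ξ, 0) = 0 := by
    intro ξ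
    refine symm_bilin_eq_zero hsymm fun u => ?_
    rw [hr2, hr2]
    simp
  rw [hr1] at ht
  simp only [sub_zero] at ht
  -- The Hessian of `L` in the velocity at rest. Positivity of `a` makes it injective, hence bounded
  -- below, as the dimension is finite.
  set G : E →L[ℝ] (E →L[ℝ] ℝ) :=
    ((ContinuousLinearMap.compL ℝ E (E × E) ℝ).flip (ContinuousLinearMap.inr ℝ E E)).comp
      ((fderiv ℝ (fderiv ℝ Λ) (q, 0)).comp (ContinuousLinearMap.inr ℝ E E)) with hG
  have hGa : ∀ v w, G v w = fderiv ℝ (fderiv ℝ Λ) (q, 0) (0, v) (0, w) := fun v w => rfl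
  obtain ⟨K₄, -, hK₄⟩ := G.toLinearMap.exists_antilipschitzWith (by
    rw [LinearMap.ker_eq_bot']
    intro v hv
    by_contra hne
    have h1 := hL.a_pos q hqΩ v hne
    have h2 := hr2 (0, v)
    rw [← hGa] at h2
    have h3 : G v = 0 := hv
    rw [h3] at h2
    simp only [zero_apply] at h2
    linarith)
  have hanti : ∀ v, ‖v‖ ≤ K₄ * ‖G v‖ := fun v => by
    simpa [dist_eq_norm] using hK₄.le_mul_dist v 0
  have hsplit : ∀ p : E × E, ∀ w : E × E, fderiv ℝ (fderiv ℝ Λ) (q, 0) (p - (q, 0)) w =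
      G p.2 w.2 := by
    intro p w
    have e1 : p - (q, 0) = (p.1 - q, 0) + (0, p.2) := by ext <;> simp
    have e2 : w = (w.1, 0) + (0, w.2) := by ext <;> simp
    rw [hGa, e1]
    conv_lhs => rw [e2]
    rw [map_add (fderiv ℝ (fderiv ℝ Λ) (q, 0)), add_apply, map_add, map_add, hzero, hzero,
      hsymm, hzero]
    simp
  obtain ⟨r, hr, hball⟩ := Metric.eventually_nhds_iff_ball.1 ht
  have htend : Tendsto (fun s : ℝ => (q, q + s • h)) (𝓝 0) (𝓝 (q, q)) := by
    have : Continuous fun s : ℝ => (q, q + s • h) := by fun_prop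
    simpa using this.tendsto 0
  have hsmall : ∀ᶠ s : ℝ in 𝓝 0, K * (|s| * ‖h‖) < r := by
    have : Tendsto (fun s : ℝ => K * (|s| * ‖h‖)) (𝓝 0) (𝓝 (K * (|0| * ‖h‖))) :=
      (by fun_prop : Continuous fun s : ℝ => K * (|s| * ‖h‖)).tendsto 0
    exact this.eventually_lt_const (by simpa using hr)
  -- Along the motion `(c, v)` has distance at most `K * (|s| * ‖h‖)` from `(q, 0)`, so replacing
  -- the derivative of `L` by its linear part `G v` costs at most `κ * |s| ^ 2`.
  set κ : ℝ := K₃ * (K * ‖h‖) ^ 2 with hκ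
  have hκ0 : 0 ≤ κ := by positivity
  -- The variation of `G v` has three errors of size `κ * |s| ^ 2`: the change of momentum and two
  -- linearizations. This is used twice, to compare `v 0` with `v t` and with `s • h`.
  refine ⟨6 * K₄ * κ, by positivity, ?_⟩
  filter_upwards [htend.eventually hb, hsmall, htend.eventually (hc.isOpen.mem_nhds hq)]
    with s hbs hss hsV
  set z : E × E := (q, q + s • h) with hz
  set v : ℝ → E := fun t => derivWithin (fun r => c (r, z)) (Icc (0 : ℝ) 1) t with hv
  have hzn : ‖z - (q, q)‖ = |s| * ‖h‖ := by
    have : 0 ≤ |s| * ‖h‖ := by positivity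
    simpa [hz, Prod.norm_def, norm_smul] using this
  have hy : ∀ t ∈ Icc (0 : ℝ) 1, ∀ w : E × E, |fderiv ℝ Λ (c (t, z), v t) w - G (v t) w.2| ≤
      κ * |s| ^ 2 * ‖w‖ := by
    intro t ht w
    have h1 := hbs t ht
    rw [hzn] at h1
    have h2 := hball (c (t, z), v t) (by rw [mem_ball_iff_norm]; exact h1.trans_lt hss)
    rw [← hsplit (c (t, z), v t) w, ← sub_apply, ← Real.norm_eq_abs]
    refine (ContinuousLinearMap.le_opNorm _ w).trans ?_
    refine mul_le_mul_of_nonneg_right (h2.trans ?_) (norm_nonneg w)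
    calc _ ≤ K₃ * (K * (|s| * ‖h‖)) ^ 2 := by gcongr
      _ = _ := by rw [hκ]; ring
  have hdΛ : ∀ t ∈ Icc (0 : ℝ) 1, DifferentiableAt ℝ Λ (c (t, z), v t) := by
    intro t ht
    exact ((hL.smooth.contDiffAt ((hL.isOpen.prod isOpen_univ).mem_nhds
      ⟨hc.mem z hsV t ht, mem_univ _⟩)).differentiableAt (by simp))
  have hP : ∀ t ∈ Icc (0 : ℝ) 1, fderiv ℝ (fun v => L (c (t, z)) v) (v t) =
      (fderiv ℝ Λ (c (t, z), v t)).comp (ContinuousLinearMap.inr ℝ E E) := fun t ht =>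
    (fderiv_partial (hdΛ t ht)).2
  have hσ : ∀ t ∈ Icc (0 : ℝ) 1, fderiv ℝ (fun x => L x (v t)) (c (t, z)) =
      (fderiv ℝ Λ (c (t, z), v t)).comp (ContinuousLinearMap.inl ℝ E E) := fun t ht =>
    (fderiv_partial (hdΛ t ht)).1
  have h0 : (0 : ℝ) ∈ Icc (0 : ℝ) 1 := by simp
  have h1 : (1 : ℝ) ∈ Icc (0 : ℝ) 1 := by simp
  have hslice : MapsTo (fun t : ℝ => (t, z)) (Icc 0 1) (Icc (0 : ℝ) 1 ×ˢ V) :=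
    fun t ht => ⟨ht, hsV⟩
  -- The linear part `G v` acts on the velocity component only. So the force `∂L/∂x` is `O(s²)`, and
  -- by the equations of motion the momentum changes by no more.
  have hPd : ∀ t ∈ Icc (0 : ℝ) 1,
      ‖fderiv ℝ (fun v => L (c (t, z)) v) (v t) - fderiv ℝ (fun v => L (c (0, z)) v) (v 0)‖ ≤
        κ * |s| ^ 2 := by
    intro t ht
    have := (convex_Icc (0 : ℝ) 1).norm_image_sub_le_of_norm_hasDerivWithin_le
      (C := κ * |s| ^ 2) (hc.motion z hsV) (fun t ht => by
        have e := hσ t ht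
        simp only [hv] at e
        rw [e]
        refine ContinuousLinearMap.opNorm_le_bound _ (by positivity) fun w => ?_
        have := hy t ht (w, 0)
        simpa [Prod.norm_def] using this) h0 ht
    refine this.trans ?_
    rw [sub_zero, Real.norm_eq_abs, abs_of_nonneg ht.1]
    exact mul_le_of_le_one_right (by positivity) ht.2
  have hG1 : ∀ t ∈ Icc (0 : ℝ) 1,
      ‖fderiv ℝ (fun v => L (c (t, z)) v) (v t) - G (v t)‖ ≤ κ * |s| ^ 2 := by
    intro t ht
    refine ContinuousLinearMap.opNorm_le_bound _ (by positivity) fun w => ?_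
    have := hy t ht (0, w)
    rw [hP t ht]
    simpa [Prod.norm_def] using this
  have hvd : ∀ t ∈ Icc (0 : ℝ) 1, ‖v t - v 0‖ ≤ 3 * K₄ * κ * |s| ^ 2 := by
    intro t ht
    have e : G (v t - v 0) = (fderiv ℝ (fun v => L (c (t, z)) v) (v t) -
        fderiv ℝ (fun v => L (c (0, z)) v) (v 0)) -
        (fderiv ℝ (fun v => L (c (t, z)) v) (v t) - G (v t)) +
        (fderiv ℝ (fun v => L (c (0, z)) v) (v 0) - G (v 0)) := by
      rw [map_sub]; abel
    have : ‖G (v t - v 0)‖ ≤ 3 * κ * |s| ^ 2 := by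
      rw [e]
      refine (norm_add_le _ _).trans ?_
      have := norm_sub_le (fderiv ℝ (fun v => L (c (t, z)) v) (v t) -
        fderiv ℝ (fun v => L (c (0, z)) v) (v 0))
        (fderiv ℝ (fun v => L (c (t, z)) v) (v t) - G (v t))
      linarith [hPd t ht, hG1 t ht, hG1 0 h0]
    calc _ ≤ K₄ * ‖G (v t - v 0)‖ := hanti _
      _ ≤ K₄ * (3 * κ * |s| ^ 2) := by gcongr
      _ = _ := by ring
  have hcd : ∀ t ∈ Icc (0 : ℝ) 1, HasDerivWithinAt (fun r => c (r, z)) (v t) (Icc 0 1) t := by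
    intro t ht
    have : DifferentiableWithinAt ℝ (fun r => c (r, z)) (Icc 0 1) t :=
      ((hc.smooth.differentiableOn (by simp) (t, z) ⟨ht, hsV⟩).comp t
        (by fun_prop : DifferentiableWithinAt ℝ (fun r : ℝ => (r, z)) (Icc 0 1) t) hslice)
    exact this.hasDerivWithinAt
  -- The displacement in unit time is `s • h`, the mean of velocities that are all close to `v 0`.
  have hend : ‖s • h - v 0‖ ≤ 3 * K₄ * κ * |s| ^ 2 := by
    have := (convex_Icc (0 : ℝ) 1).norm_image_sub_le_of_norm_hasDerivWithin_le
      (f := fun t => c (t, z) - t • v 0) (f' := fun t => v t - v 0)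
      (C := 3 * K₄ * κ * |s| ^ 2) (fun t ht => by
        simpa [Pi.sub_def] using
          (hcd t ht).sub ((hasDerivWithinAt_id t _).smul_const (v 0))) hvd h0 h1
    simp only [hc.start z hsV, hc.finish z hsV] at this
    simpa [hz, sub_right_comm] using this
  intro t ht
  calc ‖s • h - v t‖ = ‖(s • h - v 0) - (v t - v 0)‖ := by congr 1; abel
    _ ≤ ‖s • h - v 0‖ + ‖v t - v 0‖ := norm_sub_le _ _
    _ ≤ 6 * K₄ * κ * |s| ^ 2 := by linarith [hvd t ht]

/-- The expansion of the action of the motion from `q` to `q + s h` up to fourth order errors. -/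
theorem IsMotionFamily.action_expansion {L a b d : E → E → ℝ} {Ω : Set E} {V : Set (E × E)}
    {c : ℝ × (E × E) → E} (hL : IsQuarticLagrangian L a b d Ω) (hc : IsMotionFamily L Ω V c)
    {q : E} (hq : (q, q) ∈ V) (h : E) :
    ∃ K, ∀ᶠ s in 𝓝 (0 : ℝ),
      |(∫ t in (0 : ℝ)..1, L (c (t, (q, q + s • h)))
        (derivWithin (fun r => c (r, (q, q + s • h))) (Icc (0 : ℝ) 1) t)) -
        (a q h * s ^ 2 + (fderiv ℝ (fun x => a x h) q h / 2 + b q h) * s ^ 3)| ≤ K * |s| ^ 4 := by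
  have hqΩ : q ∈ Ω := by simpa [hc.start _ hq] using hc.mem _ hq 0 (by simp)
  obtain ⟨K, hK, hb⟩ := hc.bound hq
  obtain ⟨Kv, hKv, hvel⟩ := hc.velocity_bound hL hq h
  obtain ⟨K₀, hexp⟩ := hL.expansion hqΩ h h
  set Λ : E × E → ℝ := fun p => L p.1 p.2 with hΛ
  have hsm : ContDiffAt ℝ ∞ Λ (q, 0) :=
    hL.smooth.contDiffAt ((hL.isOpen.prod isOpen_univ).mem_nhds ⟨hqΩ, mem_univ _⟩)
  obtain ⟨K₅, hK₅, ht⟩ := exists_taylor_bound (hsm.of_le (ofNat_le_infty 2))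
  obtain ⟨r, hr, hball⟩ := Metric.eventually_nhds_iff_ball.1 ht
  have htend : Tendsto (fun s : ℝ => (q, q + s • h)) (𝓝 0) (𝓝 (q, q)) := by
    have : Continuous fun s : ℝ => (q, q + s • h) := by fun_prop
    simpa using this.tendsto 0
  have hsmall : ∀ᶠ s : ℝ in 𝓝 0, K * (|s| * ‖h‖) + |s| * ‖h‖ < r := by
    have : Tendsto (fun s : ℝ => K * (|s| * ‖h‖) + |s| * ‖h‖) (𝓝 0)
        (𝓝 (K * (|0| * ‖h‖) + |0| * ‖h‖)) :=
      (by fun_prop : Continuous fun s : ℝ => K * (|s| * ‖h‖) + |s| * ‖h‖).tendsto 0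
    exact this.eventually_lt_const (by simpa using hr)
  -- The first term bounds the second order difference of the actions of line and motion, the second
  -- the error in the expansion along the line.
  refine ⟨K₅ * Kv ^ 2 + K₀, ?_⟩
  filter_upwards [htend.eventually hb, hvel, hexp, hsmall,
    htend.eventually (hc.isOpen.mem_nhds hq)] with s hbs hvs hes hss hsV
  set z : E × E := (q, q + s • h) with hz
  set v : ℝ → E := fun t => derivWithin (fun r => c (r, z)) (Icc (0 : ℝ) 1) t with hv
  have hzn : ‖z - (q, q)‖ = |s| * ‖h‖ := by
    have : 0 ≤ |s| * ‖h‖ := by positivity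
    simpa [hz, Prod.norm_def, norm_smul] using this
  have h0 : (0 : ℝ) ∈ Icc (0 : ℝ) 1 := by simp
  have h1 : (1 : ℝ) ∈ Icc (0 : ℝ) 1 := by simp
  set η : ℝ → E := fun t => q + (s * t) • h - c (t, z) with hη
  have hslice : MapsTo (fun t : ℝ => (t, z)) (Icc 0 1) (Icc (0 : ℝ) 1 ×ˢ V) :=
    fun t ht => ⟨ht, hsV⟩
  have hcd : ∀ t ∈ Icc (0 : ℝ) 1, HasDerivWithinAt (fun r => c (r, z)) (v t) (Icc 0 1) t := by
    intro t ht
    have : DifferentiableWithinAt ℝ (fun r => c (r, z)) (Icc 0 1) t :=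
      ((hc.smooth.differentiableOn (by simp) (t, z) ⟨ht, hsV⟩).comp t
        (by fun_prop : DifferentiableWithinAt ℝ (fun r : ℝ => (r, z)) (Icc 0 1) t) hslice)
    exact this.hasDerivWithinAt
  have hηd : ∀ t ∈ Icc (0 : ℝ) 1, HasDerivWithinAt η (s • h - v t) (Icc 0 1) t := by
    intro t ht
    have h2 : HasDerivWithinAt (fun t : ℝ => q + (s * t) • h) (s • h) (Icc 0 1) t := by
      simpa using (((hasDerivWithinAt_id t (Icc (0 : ℝ) 1)).const_mul s).smul_const h).const_add q
    exact h2.sub (hcd t ht)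
  have hη0 : η 0 = 0 := by
    simp only [hη, hc.start z hsV]; simp [hz]
  have hη1 : η 1 = 0 := by
    simp only [hη, hc.finish z hsV]; simp [hz]
  have hηn : ∀ t ∈ Icc (0 : ℝ) 1, ‖η t‖ ≤ Kv * |s| ^ 2 := by
    intro t ht
    have := (convex_Icc (0 : ℝ) 1).norm_image_sub_le_of_norm_hasDerivWithin_le hηd hvs h0 ht
    rw [hη0, sub_zero, sub_zero, Real.norm_eq_abs, abs_of_nonneg ht.1] at this
    exact this.trans (mul_le_of_le_one_right (by positivity) ht.2)
  have hmem : ∀ t ∈ Icc (0 : ℝ) 1, (c (t, z), v t) ∈ Ω ×ˢ (univ : Set E) :=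
    fun t ht => ⟨hc.mem z hsV t ht, mem_univ _⟩
  have hopen := hL.isOpen.prod (isOpen_univ (X := E))
  have hdΛ : ∀ t ∈ Icc (0 : ℝ) 1, DifferentiableAt ℝ Λ (c (t, z), v t) := by
    intro t ht
    exact ((hL.smooth.contDiffAt (hopen.mem_nhds (hmem t ht))).differentiableAt
      (by simp))
  have hP : ∀ t ∈ Icc (0 : ℝ) 1, fderiv ℝ (fun v => L (c (t, z)) v) (v t) =
      (fderiv ℝ Λ (c (t, z), v t)).comp (ContinuousLinearMap.inr ℝ E E) := fun t ht =>
    (fderiv_partial (hdΛ t ht)).2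
  have hσ : ∀ t ∈ Icc (0 : ℝ) 1, fderiv ℝ (fun x => L x (v t)) (c (t, z)) =
      (fderiv ℝ Λ (c (t, z), v t)).comp (ContinuousLinearMap.inl ℝ E E) := fun t ht =>
    (fderiv_partial (hdΛ t ht)).1
  set P : ℝ → E →L[ℝ] ℝ := fun t => fderiv ℝ (fun v => L (c (t, z)) v) (v t) with hPdef
  -- The integrand of the first variation of the action at the motion in the direction `η`. By the
  -- equations of motion it is the time derivative of the momentum applied to `η`, and `η` vanishes
  -- at both ends.
  set D : ℝ → ℝ := fun t => fderiv ℝ Λ (c (t, z), v t) (η t, s • h - v t) with hD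
  have hPη : ∀ t ∈ Icc (0 : ℝ) 1, HasDerivWithinAt (fun t => P t (η t)) (D t) (Icc 0 1) t := by
    intro t ht
    have h2 := (hc.motion z hsV t ht).clm_apply (hηd t ht)
    refine h2.congr_deriv ?_
    have e1 := hσ t ht
    have e2 := hP t ht
    simp only [hv] at e1 e2
    rw [e1, e2]
    simp only [hD, hv]
    rw [ContinuousLinearMap.comp_apply, ContinuousLinearMap.comp_apply, ← map_add]
    simp
  have hvc : ContinuousOn v (Icc 0 1) :=
    (contDiffOn_derivWithin_family (uniqueDiffOn_Icc zero_lt_one) hc.isOpen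
      hc.smooth).continuousOn.comp (by fun_prop) hslice
  have hcc : ContinuousOn (fun t => c (t, z)) (Icc 0 1) := fun t ht => (hcd t ht).continuousWithinAt
  have hηc : ContinuousOn η (Icc 0 1) := fun t ht => (hηd t ht).continuousWithinAt
  have hDc : ContinuousOn D (Icc 0 1) := by
    have hf : ContinuousOn (fderiv ℝ Λ) (Ω ×ˢ univ) :=
      hL.smooth.continuousOn_fderiv_of_isOpen hopen (by simp)
    exact (hf.comp (hcc.prodMk hvc) hmem).clm_apply (hηc.prodMk (continuousOn_const.sub hvc))
  have hDint : ∫ t in (0 : ℝ)..1, D t = 0 := by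
    rw [intervalIntegral.integral_eq_sub_of_hasDerivAt_of_le zero_le_one
      (fun t ht => (hPη t ht).continuousWithinAt)
      (fun t ht => (hPη t (Ioo_subset_Icc_self ht)).hasDerivAt (Icc_mem_nhds ht.1 ht.2))
      (hDc.intervalIntegrable_of_Icc zero_le_one)]
    simp [hη0, hη1]
  set ψ : ℝ → ℝ := fun t => s ^ 2 * a q h + s ^ 3 * (t * fderiv ℝ (fun x => a x h) q h + b q h)
    with hψ
  have hψint : ∫ t in (0 : ℝ)..1, ψ t =
      a q h * s ^ 2 + (fderiv ℝ (fun x => a x h) q h / 2 + b q h) * s ^ 3 := by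
    have e : ψ = fun t => (s ^ 2 * a q h + s ^ 3 * b q h) +
        (s ^ 3 * fderiv ℝ (fun x => a x h) q h) * t := by
      funext t; simp only [hψ]; ring
    rw [e, intervalIntegral.integral_add intervalIntegrable_const
      (intervalIntegral.intervalIntegrable_id.const_mul _),
      intervalIntegral.integral_const_mul]
    simp
    ring
  have hLc : ContinuousOn (fun t => L (c (t, z)) (v t)) (Icc 0 1) :=
    hL.smooth.continuousOn.comp (hcc.prodMk hvc) hmem
  -- The Taylor expansion is based at the motion, not at `(q, 0)`, so that its linear term is `D`.
  -- The remainder is quadratic in a quantity of order `s ^ 2`.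
  have hbound : ∀ t ∈ uIoc (0 : ℝ) 1,
      ‖L (c (t, z)) (v t) + D t - ψ t‖ ≤ (K₅ * Kv ^ 2 + K₀) * |s| ^ 4 := by
    intro t ht'
    rw [uIoc_of_le zero_le_one] at ht'
    have ht := Ioc_subset_Icc_self ht'
    have hy := hbs t ht
    rw [hzn] at hy
    have hstr : ‖((q + (s * t) • h, s • h) : E × E) - (q, 0)‖ ≤ |s| * ‖h‖ := by
      simp only [Prod.norm_def, Prod.mk_sub_mk, add_sub_cancel_left, sub_zero, norm_smul, norm_mul,
        Real.norm_eq_abs, abs_of_nonneg ht.1]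
      refine max_le ?_ le_rfl
      gcongr
      exact mul_le_of_le_one_right (abs_nonneg s) ht.2
    have hpos : 0 ≤ K * (|s| * ‖h‖) := by positivity
    have hpos' : 0 ≤ |s| * ‖h‖ := by positivity
    have hT := hball ((c (t, z), v t), (q + (s * t) • h, s • h)) (by
      rw [mem_ball_iff_norm, Prod.norm_def]
      refine max_lt (lt_of_le_of_lt hy (by linarith)) (lt_of_le_of_lt hstr (by linarith)))
    have e1 : ((q + (s * t) • h, s • h) : E × E) - (c (t, z), v t) = (η t, s • h - v t) := rfl
    simp only [e1] at hT
    have hn : ‖((η t, s • h - v t) : E × E)‖ ≤ Kv * |s| ^ 2 := by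
      rw [Prod.norm_def]
      exact max_le (hηn t ht) (hvs t ht)
    have hT' : |L (q + (s * t) • h) (s • h) - L (c (t, z)) (v t) - D t| ≤
        K₅ * Kv ^ 2 * |s| ^ 4 := by
      refine hT.trans ?_
      calc _ ≤ K₅ * (Kv * |s| ^ 2) ^ 2 := by gcongr
        _ = _ := by ring
    have hE := hes t ht
    rw [Real.norm_eq_abs]
    rw [abs_le] at hT' hE ⊢
    constructor <;> simp only [hψ] <;> linarith [hT'.1, hT'.2, hE.1, hE.2]
  have hfin := intervalIntegral.norm_integral_le_of_norm_le_const hbound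
  have hI1 : IntervalIntegrable (fun t => L (c (t, z)) (v t)) volume 0 1 :=
    hLc.intervalIntegrable_of_Icc zero_le_one
  have hI2 : IntervalIntegrable D volume 0 1 := hDc.intervalIntegrable_of_Icc zero_le_one
  have hI3 : IntervalIntegrable ψ volume 0 1 :=
    (by fun_prop : Continuous ψ).intervalIntegrable _ _
  rw [intervalIntegral.integral_sub (hI1.add hI2) hI3, intervalIntegral.integral_add hI1 hI2,
    hDint, hψint] at hfin
  simpa using hfin

end Expansion

end HamiltonPotential

namespace HamiltonPotential

set_option maxSynthPendingDepth 3

open Filter Topology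

/-! ### Polarization of symmetric forms -/

section Polarization

variable {E : Type} [AddCommGroup E]

/-- A symmetric biadditive form is determined by its quadratic form. -/
theorem biadditive_eq_zero {f : E → E → ℝ} (hadd : ∀ h h' k, f (h + h') k = f h k + f h' k)
    (hsymm : ∀ h k, f h k = f k h) (hf : ∀ h, f h h = 0) (h k : E) : f h k = 0 := by
  have hadd₂ : ∀ h k k', f h (k + k') = f h k + f h k' := fun h k k' => by
    rw [hsymm, hadd, hsymm k, hsymm k']
  have := hf (h + k)
  simp only [hadd, hadd₂, hf, hsymm k h] at this
  linarith

/-- A symmetric triadditive form is determined by its cubic form. -/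
theorem triadditive_eq_zero {f : E → E → E → ℝ}
    (hadd : ∀ h h' k l, f (h + h') k l = f h k l + f h' k l)
    (hs₁ : ∀ h k l, f h k l = f k h l) (hs₂ : ∀ h k l, f h k l = f h l k)
    (hf : ∀ h, f h h h = 0) (h k l : E) : f h k l = 0 := by
  have hadd₂ : ∀ h k k' l, f h (k + k') l = f h k l + f h k' l := fun h k k' l => by
    rw [hs₁, hadd, hs₁ k, hs₁ k']
  have hadd₃ : ∀ h k l l', f h k (l + l') = f h k l + f h k l' := fun h k l l' => by
    rw [hs₂, hadd₂, hs₂ h l, hs₂ h l']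
  -- Subtracting the three expansions for pairs from the one for `h + k + l` leaves the six values
  -- at permutations of `h`, `k`, `l`, which are equal by symmetry.
  have e0 := hf (h + k + l)
  have e1 := hf (h + k)
  have e2 := hf (h + l)
  have e3 := hf (k + l)
  simp only [hadd, hadd₂, hadd₃, hf] at e0 e1 e2 e3
  have s1 := hs₁ k h l
  have s2 := hs₂ h k l
  have s3 := hs₁ l h k
  have s4 := hs₁ k l h
  have s5 := hs₂ k h l
  have s6 := hs₂ l h k
  linarith

end Polarization

/-! ### Jets of functions critical on the diagonal -/

section Jets

variable {E : Type} [NormedAddCommGroup E] [NormedSpace ℝ E]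

/-- Expansion of a symmetric trilinear form on `E × E` that vanishes if two of its arguments lie on
the diagonal. -/
theorem trilinear_expand {B : E × E →L[ℝ] E × E →L[ℝ] E × E →L[ℝ] ℝ}
    (hs₁ : ∀ u v w, B u v w = B v u w) (hs₂ : ∀ u v w, B u v w = B u w v)
    (hd : ∀ m k w, B (m, m) (k, k) w = 0) (u v w : E × E) :
    B u v w = B (u.1, u.1) (0, v.2 - v.1) (0, w.2 - w.1)
      + B (v.1, v.1) (0, u.2 - u.1) (0, w.2 - w.1)
      + B (w.1, w.1) (0, u.2 - u.1) (0, v.2 - v.1)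
      + B (0, u.2 - u.1) (0, v.2 - v.1) (0, w.2 - w.1) := by
  have hsplit : ∀ u : E × E, u = (u.1, u.1) + (0, u.2 - u.1) := fun u => by ext <;> simp
  -- Of the eight resulting terms, the four with at least two diagonal arguments vanish after
  -- reordering.
  conv_lhs => rw [hsplit u, hsplit v, hsplit w]
  simp only [map_add B, map_add (B _), map_add (B _ _), add_apply]
  rw [hd, hd, hs₂ (u.1, u.1) (0, v.2 - v.1) (w.1, w.1), hd,
    hs₁ (0, u.2 - u.1) (v.1, v.1) (w.1, w.1), hs₂ (v.1, v.1) (0, u.2 - u.1) (w.1, w.1), hd,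
    hs₁ (0, u.2 - u.1) (v.1, v.1) (0, w.2 - w.1),
    hs₂ (0, u.2 - u.1) (0, v.2 - v.1) (w.1, w.1), hs₁ (0, u.2 - u.1) (w.1, w.1) _]
  ring

/-- The part of such a form transversal to the diagonal, if its cubic form is known. -/
theorem trilinear_transversal {B : E × E →L[ℝ] E × E →L[ℝ] E × E →L[ℝ] ℝ}
    (hs₁ : ∀ u v w, B u v w = B v u w) (hs₂ : ∀ u v w, B u v w = B u w v) {t : E → E → E → ℝ}
    (tadd : ∀ h h' k l, t (h + h') k l = t h k l + t h' k l)
    (ts₁ : ∀ h k l, t h k l = t k h l) (ts₂ : ∀ h k l, t h k l = t h l k)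
    (hB : ∀ h, B (0, h) (0, h) (0, h) = 3 / 2 * B (h, h) (0, h) (0, h) + t h h h) (h k l : E) :
    B (0, h) (0, k) (0, l) = (B (h, h) (0, k) (0, l) + B (k, k) (0, h) (0, l)
      + B (l, l) (0, h) (0, k)) / 2 + t h k l := by
  -- The sum of the three mixed terms over `2` is the symmetric trilinear form whose cubic form is
  -- `3 / 2 * B (h, h) (0, h) (0, h)`; the difference has zero cubic form.
  have key := triadditive_eq_zero (f := fun h k l => B (0, h) (0, k) (0, l) -
    ((B (h, h) (0, k) (0, l) + B (k, k) (0, h) (0, l) + B (l, l) (0, h) (0, k)) / 2 + t h k l))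
    (fun h h' k l => by
      have e1 : ((0, h + h') : E × E) = (0, h) + (0, h') := by simp
      have e2 : ((h + h', h + h') : E × E) = (h, h) + (h', h') := by simp
      simp only [e1, e2, map_add, add_apply, tadd]
      ring)
    (fun h k l => by
      rw [hs₁ (0, h), ts₁ h k l, hs₂ (l, l) (0, h)]; ring)
    (fun h k l => by
      rw [hs₂ (0, h), ts₂ h k l, hs₂ (h, h) (0, k)]; ring)
    (fun h => by rw [hB]; ring) h k l
  linarith

/-- A function differentiated along the diagonal. -/
theorem fderiv_diagonal {G : Type} [NormedAddCommGroup G] [NormedSpace ℝ G] {f : E × E → G} {x : E}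
    (hf : DifferentiableAt ℝ f (x, x)) (k : E) :
    fderiv ℝ f (x, x) (k, k) = fderiv ℝ (fun y => f (y, y)) x k := by
  have h : HasFDerivAt (fun y : E => (y, y))
      ((ContinuousLinearMap.id ℝ E).prod (ContinuousLinearMap.id ℝ E)) x :=
    (hasFDerivAt_id x).prodMk (hasFDerivAt_id x)
  have e : HasFDerivAt (fun y => f (y, y)) _ x :=
    HasFDerivAt.comp (f := fun y : E => (y, y)) x hf.hasFDerivAt h
  rw [e.fderiv]
  rfl

theorem fderiv_diagonal_eq_zero {G : Type} [NormedAddCommGroup G] [NormedSpace ℝ G]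
    {f : E × E → G} {Ω : Set E} (hΩ : IsOpen Ω) {x : E} (hx : x ∈ Ω)
    (hf : DifferentiableAt ℝ f (x, x)) (h0 : ∀ y ∈ Ω, f (y, y) = 0) (k : E) :
    fderiv ℝ f (x, x) (k, k) = 0 := by
  rw [fderiv_diagonal hf]
  have : (fun y => f (y, y)) =ᶠ[𝓝 x] fun _ => 0 :=
    Filter.eventually_of_mem (hΩ.mem_nhds hx) h0
  rw [this.fderiv_eq]
  simp

variable {F : E × E → ℝ} {V : Set (E × E)} {Ω : Set E}

theorem contDiffOn_fderiv {H G : Type} [NormedAddCommGroup H] [NormedSpace ℝ H]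
    [NormedAddCommGroup G] [NormedSpace ℝ G] {f : H → G} {V : Set H} (hV : IsOpen V)
    (hf : ContDiffOn ℝ ∞ f V) : ContDiffOn ℝ ∞ (fderiv ℝ f) V :=
  hf.fderiv_of_isOpen hV (by simp)

theorem fderiv_fderiv_symm {H G : Type} [NormedAddCommGroup H] [NormedSpace ℝ H]
    [NormedAddCommGroup G] [NormedSpace ℝ G] {f : H → G} {V : Set H} (hV : IsOpen V)
    (hf : ContDiffOn ℝ ∞ f V) {z : H} (hz : z ∈ V) (u v : H) :
    fderiv ℝ (fderiv ℝ f) z u v = fderiv ℝ (fderiv ℝ f) z v u :=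
  (hf.contDiffAt (hV.mem_nhds hz)).isSymmSndFDerivAt (by simpa using ofNat_le_infty 2) u v

/-- The symmetry of the second derivative holds on all of the open set and can therefore be
differentiated. -/
theorem fderiv₃_symm {H : Type} [NormedAddCommGroup H] [NormedSpace ℝ H]
    {f : H → ℝ} {V : Set H} (hV : IsOpen V)
    (hf : ContDiffOn ℝ ∞ f V) {z : H} (hz : z ∈ V) (u v w : H) :
    fderiv ℝ (fderiv ℝ (fderiv ℝ f)) z u v w = fderiv ℝ (fderiv ℝ (fderiv ℝ f)) z u w v := by
  have hd : DifferentiableAt ℝ (fderiv ℝ (fderiv ℝ f)) z :=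
    ((contDiffOn_fderiv hV (contDiffOn_fderiv hV hf)).contDiffAt (hV.mem_nhds hz)).differentiableAt
      (by simp)
  have key : ∀ v w, HasFDerivAt (fun z' => fderiv ℝ (fderiv ℝ f) z' v w)
      (((fderiv ℝ (fderiv ℝ (fderiv ℝ f)) z).flip v).flip w) z := fun v w => by
    have := (hd.hasFDerivAt.clm_apply (hasFDerivAt_const v z)).clm_apply (hasFDerivAt_const w z)
    refine this.congr_fderiv ?_
    ext u
    simp
  have e : (fun z' => fderiv ℝ (fderiv ℝ f) z' v w) =ᶠ[𝓝 z]
      fun z' => fderiv ℝ (fderiv ℝ f) z' w v :=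
    Filter.eventually_of_mem (hV.mem_nhds hz) fun z' hz' => fderiv_fderiv_symm hV hf hz' v w
  have := (key v w).unique ((key w v).congr_of_eventuallyEq e)
  exact DFunLike.congr_fun this u

/-- A smooth function of two points near the diagonal, with derivative zero on the diagonal. -/
structure IsCriticalOnDiagonal (F : E × E → ℝ) (V : Set (E × E)) (Ω : Set E) : Prop where
  isOpen : IsOpen V
  isOpen_base : IsOpen Ω
  diag_mem : ∀ x ∈ Ω, (x, x) ∈ V
  smooth : ContDiffOn ℝ ∞ F V
  fderiv_eq_zero : ∀ x ∈ Ω, fderiv ℝ F (x, x) = 0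

/-- The first derivative is zero all along the diagonal, and `(k, k)` is tangent to it. -/
theorem IsCriticalOnDiagonal.fderiv₂_diag (hF : IsCriticalOnDiagonal F V Ω) {x : E} (hx : x ∈ Ω)
    (k : E) : fderiv ℝ (fderiv ℝ F) (x, x) (k, k) = 0 :=
  fderiv_diagonal_eq_zero hF.isOpen_base hx
    (((contDiffOn_fderiv hF.isOpen hF.smooth).contDiffAt
      (hF.isOpen.mem_nhds (hF.diag_mem x hx))).differentiableAt (by simp)) hF.fderiv_eq_zero k

/-- The Hessian at the diagonal. -/
theorem IsCriticalOnDiagonal.fderiv₂_eq (hF : IsCriticalOnDiagonal F V Ω) {x : E} (hx : x ∈ Ω)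
    (u v : E × E) : fderiv ℝ (fderiv ℝ F) (x, x) u v =
      fderiv ℝ (fderiv ℝ F) (x, x) (0, u.2 - u.1) (0, v.2 - v.1) := by
  have hsplit : ∀ u : E × E, u = (u.1, u.1) + (0, u.2 - u.1) := fun u => by ext <;> simp
  have hs := fderiv_fderiv_symm hF.isOpen hF.smooth (hF.diag_mem x hx)
  conv_lhs => rw [hsplit u, hsplit v]
  simp only [map_add (fderiv ℝ (fderiv ℝ F) (x, x)),
    map_add (fderiv ℝ (fderiv ℝ F) (x, x) _), add_apply]
  rw [hF.fderiv₂_diag hx, hs _ (v.1, v.1), hF.fderiv₂_diag hx]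
  simp

theorem IsCriticalOnDiagonal.differentiableAt_fderiv₂ (hF : IsCriticalOnDiagonal F V Ω) {x : E}
    (hx : x ∈ Ω) : DifferentiableAt ℝ (fderiv ℝ (fderiv ℝ F)) (x, x) :=
  ((contDiffOn_fderiv hF.isOpen (contDiffOn_fderiv hF.isOpen hF.smooth)).contDiffAt
    (hF.isOpen.mem_nhds (hF.diag_mem x hx))).differentiableAt (by simp)

/-- The derivatives of the coefficients of the Hessian along the diagonal. -/
theorem IsCriticalOnDiagonal.fderiv₃_diag (hF : IsCriticalOnDiagonal F V Ω) {x : E} (hx : x ∈ Ω)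
    (m : E) (u v : E × E) :
    fderiv ℝ (fderiv ℝ (fderiv ℝ F)) (x, x) (m, m) u v =
      fderiv ℝ (fun y => fderiv ℝ (fderiv ℝ F) (y, y) u v) x m := by
  have hd := hF.differentiableAt_fderiv₂ hx
  have h2 : HasFDerivAt (fun z => fderiv ℝ (fderiv ℝ F) z u v)
      (((fderiv ℝ (fderiv ℝ (fderiv ℝ F)) (x, x)).flip u).flip v) (x, x) := by
    refine ((hd.hasFDerivAt.clm_apply (hasFDerivAt_const u _)).clm_apply
      (hasFDerivAt_const v _)).congr_fderiv ?_
    ext w <;> simp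
  rw [← fderiv_diagonal h2.differentiableAt, h2.fderiv]
  rfl

/-- The Hessian annihilates `(k, k)` at every point of the diagonal, so this relation can be
differentiated along it. -/
theorem IsCriticalOnDiagonal.fderiv₃_diag_diag (hF : IsCriticalOnDiagonal F V Ω) {x : E}
    (hx : x ∈ Ω) (m k : E) (v : E × E) :
    fderiv ℝ (fderiv ℝ (fderiv ℝ F)) (x, x) (m, m) (k, k) v = 0 := by
  rw [hF.fderiv₃_diag hx]
  have : (fun y => fderiv ℝ (fderiv ℝ F) (y, y) (k, k) v) =ᶠ[𝓝 x] fun _ => 0 :=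
    Filter.eventually_of_mem (hF.isOpen_base.mem_nhds hx) fun y hy => by
      simp [hF.fderiv₂_diag hy]
  rw [this.fderiv_eq]
  simp

theorem IsCriticalOnDiagonal.fderiv₃_symm₁ (hF : IsCriticalOnDiagonal F V Ω) {x : E} (hx : x ∈ Ω)
    (u v w : E × E) : fderiv ℝ (fderiv ℝ (fderiv ℝ F)) (x, x) u v w =
      fderiv ℝ (fderiv ℝ (fderiv ℝ F)) (x, x) v u w := by
  rw [fderiv_fderiv_symm hF.isOpen (contDiffOn_fderiv hF.isOpen hF.smooth) (hF.diag_mem x hx)]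

theorem IsCriticalOnDiagonal.fderiv₃_symm₂ (hF : IsCriticalOnDiagonal F V Ω) {x : E} (hx : x ∈ Ω)
    (u v w : E × E) : fderiv ℝ (fderiv ℝ (fderiv ℝ F)) (x, x) u v w =
      fderiv ℝ (fderiv ℝ (fderiv ℝ F)) (x, x) u w v :=
  fderiv₃_symm hF.isOpen hF.smooth (hF.diag_mem x hx) u v w

theorem IsCriticalOnDiagonal.fderiv₃_expand (hF : IsCriticalOnDiagonal F V Ω) {x : E} (hx : x ∈ Ω)
    (u v w : E × E) :
    fderiv ℝ (fderiv ℝ (fderiv ℝ F)) (x, x) u v w =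
      fderiv ℝ (fderiv ℝ (fderiv ℝ F)) (x, x) (u.1, u.1) (0, v.2 - v.1) (0, w.2 - w.1)
      + fderiv ℝ (fderiv ℝ (fderiv ℝ F)) (x, x) (v.1, v.1) (0, u.2 - u.1) (0, w.2 - w.1)
      + fderiv ℝ (fderiv ℝ (fderiv ℝ F)) (x, x) (w.1, w.1) (0, u.2 - u.1) (0, v.2 - v.1)
      + fderiv ℝ (fderiv ℝ (fderiv ℝ F)) (x, x) (0, u.2 - u.1) (0, v.2 - v.1) (0, w.2 - w.1) :=
  trilinear_expand (hF.fderiv₃_symm₁ hx) (hF.fderiv₃_symm₂ hx) (hF.fderiv₃_diag_diag hx) u v w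

end Jets

/-! ### Derivatives along vector fields, and functions flat on the diagonal -/

section Words

variable {E : Type} [NormedAddCommGroup E] [NormedSpace ℝ E]

/-- The derivative of a function along a vector field on a vector space. -/
noncomputable def dirD {H : Type} [NormedAddCommGroup H] [NormedSpace ℝ H] (X : H → H)
    (F : H → ℝ) : H → ℝ :=
  fun z => fderiv ℝ F z (X z)

variable {H : Type} [NormedAddCommGroup H] [NormedSpace ℝ H]

theorem contDiffOn_dirD {V : Set H} (hV : IsOpen V) {X : H → H} {F : H → ℝ}
    (hX : ContDiffOn ℝ ∞ X V) (hF : ContDiffOn ℝ ∞ F V) : ContDiffOn ℝ ∞ (dirD X F) V :=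
  (contDiffOn_fderiv hV hF).clm_apply hX

theorem dirD_congr {V : Set H} (hV : IsOpen V) {X X' : H → H} {F F' : H → ℝ}
    (hX : EqOn X X' V) (hF : EqOn F F' V) : EqOn (dirD X F) (dirD X' F') V := fun z hz => by
  simp only [dirD, hX hz, (hF.eventuallyEq_of_mem (hV.mem_nhds hz)).fderiv_eq]

theorem hasFDerivAt_dirD {V : Set H} (hV : IsOpen V) {X : H → H} {F : H → ℝ}
    (hX : ContDiffOn ℝ ∞ X V) (hF : ContDiffOn ℝ ∞ F V) {z : H} (hz : z ∈ V) :
    HasFDerivAt (dirD X F) ((fderiv ℝ F z).comp (fderiv ℝ X z) +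
      (fderiv ℝ (fderiv ℝ F) z).flip (X z)) z :=
  (((contDiffOn_fderiv hV hF).contDiffAt (hV.mem_nhds hz)).differentiableAt
    (by simp)).hasFDerivAt.clm_apply
    ((hX.contDiffAt (hV.mem_nhds hz)).differentiableAt (by simp)).hasFDerivAt

/-- At a critical point, second derivatives along vector fields are values of the Hessian. -/
theorem dirD_dirD_eq {V : Set H} (hV : IsOpen V) {X Y : H → H} {F : H → ℝ}
    (hY : ContDiffOn ℝ ∞ Y V) (hF : ContDiffOn ℝ ∞ F V) {z : H} (hz : z ∈ V)
    (h0 : fderiv ℝ F z = 0) :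
    dirD X (dirD Y F) z = fderiv ℝ (fderiv ℝ F) z (X z) (Y z) := by
  rw [dirD, (hasFDerivAt_dirD hV hY hF hz).fderiv, h0]
  simp

/-- Where the first two derivatives vanish, the Hessian of a derivative along a vector field is
given by the third derivatives. -/
theorem fderiv_dirD_of_flat {V : Set H} (hV : IsOpen V) {X : H → H} {F : H → ℝ}
    (hX : ContDiffOn ℝ ∞ X V) (hF : ContDiffOn ℝ ∞ F V) {z : H} (hz : z ∈ V)
    (h1 : fderiv ℝ F z = 0) (h2 : fderiv ℝ (fderiv ℝ F) z = 0) :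
    fderiv ℝ (dirD X F) z = 0 ∧ ∀ u v, fderiv ℝ (fderiv ℝ (dirD X F)) z u v =
      fderiv ℝ (fderiv ℝ (fderiv ℝ F)) z u v (X z) := by
  constructor
  · rw [(hasFDerivAt_dirD hV hX hF hz).fderiv, h1, h2]
    ext
    simp
  · intro u v
    have hd : ∀ {G : Type} [NormedAddCommGroup G] [NormedSpace ℝ G] {f : H → G},
        ContDiffOn ℝ ∞ f V → HasFDerivAt f (fderiv ℝ f z) z := fun hf =>
      ((hf.contDiffAt (hV.mem_nhds hz)).differentiableAt (by simp)).hasFDerivAt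
    have e : (fun z' => fderiv ℝ (dirD X F) z' v) =ᶠ[𝓝 z] fun z' =>
        fderiv ℝ F z' (fderiv ℝ X z' v) + fderiv ℝ (fderiv ℝ F) z' v (X z') :=
      Filter.eventually_of_mem (hV.mem_nhds hz) fun z' hz' => by
        simp only [(hasFDerivAt_dirD hV hX hF hz').fderiv]
        simp
    have hF1 := contDiffOn_fderiv hV hF
    have hF2 := contDiffOn_fderiv hV hF1
    have hX1 := contDiffOn_fderiv hV hX
    -- The product rule gives four terms; all but the one with the third derivative of `F` contain
    -- its first or second derivative at `z`.
    have r := ((hd hF1).clm_apply ((hd hX1).clm_apply (hasFDerivAt_const v z))).add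
      (((hd hF2).clm_apply (hasFDerivAt_const v z)).clm_apply (hd hX))
    have l := (hd (contDiffOn_fderiv hV (contDiffOn_dirD hV hX hF))).clm_apply
      (hasFDerivAt_const v z)
    have := DFunLike.congr_fun (l.unique (r.congr_of_eventuallyEq e)) u
    simpa [h1, h2] using this

/-- A smooth function of two points whose first two derivatives vanish on the diagonal. -/
structure IsFlatOnDiagonal (K : E × E → ℝ) (V : Set (E × E)) (Ω : Set E) : Prop extends
    IsCriticalOnDiagonal K V Ω where
  fderiv₂_eq_zero : ∀ x ∈ Ω, fderiv ℝ (fderiv ℝ K) (x, x) = 0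

variable {K : E × E → ℝ} {V : Set (E × E)} {Ω : Set E}

/-- The Hessian is zero along the diagonal, hence so is its derivative in a diagonal direction;
symmetry moves that direction to the last slot. -/
theorem IsFlatOnDiagonal.fderiv₃_diag_right (hK : IsFlatOnDiagonal K V Ω) {x : E} (hx : x ∈ Ω)
    (u v : E × E) (m : E) : fderiv ℝ (fderiv ℝ (fderiv ℝ K)) (x, x) u v (m, m) = 0 := by
  rw [hK.fderiv₃_symm₂ hx, hK.fderiv₃_symm₁ hx,
    fderiv_diagonal_eq_zero hK.isOpen_base hx (hK.differentiableAt_fderiv₂ hx) hK.fderiv₂_eq_zero]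
  simp

/-- A field tangent to the diagonal does not lower the order of vanishing: the new Hessian is the
third derivative with one diagonal argument. This is the mechanism behind the vanishing of `Q1` and
`Q2`. -/
theorem IsFlatOnDiagonal.dirD (hK : IsFlatOnDiagonal K V Ω) {W : E × E → E × E} {w : E → E}
    (hW : ContDiffOn ℝ ∞ W V) (hw : ∀ x ∈ Ω, W (x, x) = (w x, w x)) :
    IsFlatOnDiagonal (dirD W K) V Ω where
  isOpen := hK.isOpen
  isOpen_base := hK.isOpen_base
  diag_mem := hK.diag_mem
  smooth := contDiffOn_dirD hK.isOpen hW hK.smooth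
  fderiv_eq_zero x hx := (fderiv_dirD_of_flat hK.isOpen hW hK.smooth (hK.diag_mem x hx)
    (hK.fderiv_eq_zero x hx) (hK.fderiv₂_eq_zero x hx)).1
  fderiv₂_eq_zero x hx := by
    refine ContinuousLinearMap.ext fun u => ContinuousLinearMap.ext fun v => ?_
    rw [(fderiv_dirD_of_flat hK.isOpen hW hK.smooth (hK.diag_mem x hx)
      (hK.fderiv_eq_zero x hx) (hK.fderiv₂_eq_zero x hx)).2, hw x hx, hK.fderiv₃_diag_right hx]
    simp

theorem IsFlatOnDiagonal.dirD_dirD_eq_zero (hK : IsFlatOnDiagonal K V Ω) {X Y : E × E → E × E}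
    (hY : ContDiffOn ℝ ∞ Y V) {x : E} (hx : x ∈ Ω) :
    HamiltonPotential.dirD X (HamiltonPotential.dirD Y K) (x, x) = 0 := by
  rw [dirD_dirD_eq hK.isOpen hY hK.smooth (hK.diag_mem x hx) (hK.fderiv_eq_zero x hx),
    hK.fderiv₂_eq_zero x hx]
  simp

theorem IsFlatOnDiagonal.dirD₃_eq (hK : IsFlatOnDiagonal K V Ω) {X Y Z : E × E → E × E}
    (hY : ContDiffOn ℝ ∞ Y V) (hZ : ContDiffOn ℝ ∞ Z V) {x : E} (hx : x ∈ Ω) :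
    HamiltonPotential.dirD X (HamiltonPotential.dirD Y (HamiltonPotential.dirD Z K)) (x, x) =
      fderiv ℝ (fderiv ℝ (fderiv ℝ K)) (x, x) (X (x, x)) (Y (x, x)) (Z (x, x)) := by
  have h := fderiv_dirD_of_flat hK.isOpen hZ hK.smooth (hK.diag_mem x hx)
    (hK.fderiv_eq_zero x hx) (hK.fderiv₂_eq_zero x hx)
  rw [dirD_dirD_eq hK.isOpen hY (contDiffOn_dirD hK.isOpen hZ hK.smooth) (hK.diag_mem x hx) h.1,
    h.2]

end Words

end HamiltonPotential

namespace HamiltonPotential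

set_option maxSynthPendingDepth 3

open Filter Topology

/-! ### Iterated derivatives: additivity and change of variables -/

section Iterated

variable {H : Type} [NormedAddCommGroup H] [NormedSpace ℝ H]

/-- Iterated derivatives along vector fields. -/
noncomputable def dirDs (l : List (H → H)) (F : H → ℝ) : H → ℝ := l.foldr dirD F

theorem contDiffOn_dirDs {V : Set H} (hV : IsOpen V) {F : H → ℝ} (hF : ContDiffOn ℝ ∞ F V) :
    ∀ {l : List (H → H)}, (∀ X ∈ l, ContDiffOn ℝ ∞ X V) → ContDiffOn ℝ ∞ (dirDs l F) V
  | [], _ => hF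
  | _ :: _, hl => contDiffOn_dirD hV (hl _ (by simp))
      (contDiffOn_dirDs hV hF fun Y hY => hl Y (by simp [hY]))

theorem dirDs_sub {V : Set H} (hV : IsOpen V) {F F' : H → ℝ} (hF : ContDiffOn ℝ ∞ F V)
    (hF' : ContDiffOn ℝ ∞ F' V) : ∀ {l : List (H → H)}, (∀ X ∈ l, ContDiffOn ℝ ∞ X V) →
      EqOn (dirDs l (F - F')) (dirDs l F - dirDs l F') V
  | [], _ => fun _ _ => rfl
  | X :: l, hl => by
    have hl' : ∀ Y ∈ l, ContDiffOn ℝ ∞ Y V := fun Y hY => hl Y (by simp [hY])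
    refine (dirD_congr hV (eqOn_refl X V) (dirDs_sub hV hF hF' hl')).trans fun z hz => ?_
    have d : ∀ {f : H → ℝ}, ContDiffOn ℝ ∞ f V → DifferentiableAt ℝ f z := fun hf =>
      (hf.contDiffAt (hV.mem_nhds hz)).differentiableAt (by simp)
    change fderiv ℝ (dirDs l F - dirDs l F') z (X z) = _
    rw [fderiv_sub (d (contDiffOn_dirDs hV hF hl')) (d (contDiffOn_dirDs hV hF' hl'))]
    rfl

theorem dirDs_add {V : Set H} (hV : IsOpen V) {F F' : H → ℝ} (hF : ContDiffOn ℝ ∞ F V)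
    (hF' : ContDiffOn ℝ ∞ F' V) {l : List (H → H)} (hl : ∀ X ∈ l, ContDiffOn ℝ ∞ X V) :
    EqOn (dirDs l (F + F')) (dirDs l F + dirDs l F') V := fun z hz => by
  have := dirDs_sub hV (hF.add hF') hF' hl hz
  change dirDs l (F + F' - F') z = _ at this
  rw [add_sub_cancel_right] at this
  rw [Pi.add_apply, this, Pi.sub_apply]
  exact (sub_add_cancel _ _).symm

/-- The chain rule: derivatives commute with a linear change of variables if the field is pushed
forward. It is applied to the exchange of the two points. -/
theorem dirD_comp_equiv (A : H ≃L[ℝ] H) (X : H → H) (F : H → ℝ) :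
    dirD X (F ∘ A) = dirD (fun z => A (X (A.symm z))) F ∘ A := by
  funext z
  simp only [dirD, Function.comp_apply, ContinuousLinearEquiv.symm_apply_apply]
  rw [A.comp_right_fderiv]
  rfl

theorem dirDs_comp_equiv (A : H ≃L[ℝ] H) (F : H → ℝ) : ∀ l : List (H → H),
    dirDs l (F ∘ A) = dirDs (l.map fun X z => A (X (A.symm z))) F ∘ A
  | [] => rfl
  | X :: l => by
    have ih := dirDs_comp_equiv A F l
    simp only [dirDs, List.map_cons, List.foldr_cons] at ih ⊢
    rw [ih, dirD_comp_equiv]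

/-- Iterated derivatives along constant fields are values of the iterated derivative. -/
theorem dirD_const₂ {V : Set H} (hV : IsOpen V) {F : H → ℝ} (hF : ContDiffOn ℝ ∞ F V) {z : H}
    (hz : z ∈ V) (u v : H) :
    dirD (fun _ => u) (dirD (fun _ => v) F) z = fderiv ℝ (fderiv ℝ F) z u v := by
  rw [dirD, (hasFDerivAt_dirD hV contDiffOn_const hF hz).fderiv]
  simp

theorem dirD_const₃ {V : Set H} (hV : IsOpen V) {F : H → ℝ} (hF : ContDiffOn ℝ ∞ F V) {z : H}
    (hz : z ∈ V) (u v w : H) :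
    dirD (fun _ => u) (dirD (fun _ => v) (dirD (fun _ => w) F)) z =
      fderiv ℝ (fderiv ℝ (fderiv ℝ F)) z u v w := by
  have h2 : HasFDerivAt (fun z => fderiv ℝ (fderiv ℝ F) z v w)
      (((fderiv ℝ (fderiv ℝ (fderiv ℝ F)) z).flip v).flip w) z := by
    have hd : DifferentiableAt ℝ (fderiv ℝ (fderiv ℝ F)) z :=
      ((contDiffOn_fderiv hV (contDiffOn_fderiv hV hF)).contDiffAt
        (hV.mem_nhds hz)).differentiableAt (by simp)
    refine ((hd.hasFDerivAt.clm_apply (hasFDerivAt_const v _)).clm_apply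
      (hasFDerivAt_const w _)).congr_fderiv ?_
    ext u
    simp
  have e : dirD (fun _ => v) (dirD (fun _ => w) F) =ᶠ[𝓝 z]
      fun z => fderiv ℝ (fderiv ℝ F) z v w :=
    Filter.eventually_of_mem (hV.mem_nhds hz) fun z' hz' => dirD_const₂ hV hF hz' v w
  rw [dirD, e.fderiv_eq, h2.fderiv]
  rfl

end Iterated

/-! ### The jet of a potential function and its words in L and R -/

section TwoPoint

variable {E : Type} [NormedAddCommGroup E] [NormedSpace ℝ E]

/-- The other factor of `M × M`. -/
def Side.flip : Side → Side
  | Side.L => Side.R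
  | Side.R => Side.L

/-- The sign of the contribution of a factor to the displacement `y - x`. -/
def Side.sign : Side → ℝ
  | Side.L => -1
  | Side.R => 1

/-- The left and right lifts of a vector field on a vector space. -/
def coordLift (s : Side) (X : E → E) : E × E → E × E :=
  fun z => match s with
    | Side.L => (X z.1, 0)
    | Side.R => (0, X z.2)

theorem contDiffOn_coordLift {V : Set (E × E)} {Ω : Set E} (hV : V ⊆ Ω ×ˢ Ω) {X : E → E}
    (hX : ContDiffOn ℝ ∞ X Ω) (s : Side) : ContDiffOn ℝ ∞ (coordLift s X) V := by
  cases s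
  · exact (hX.comp contDiffOn_fst fun z hz => (hV hz).1).prodMk contDiffOn_const
  · exact contDiffOn_const.prodMk (hX.comp contDiffOn_snd fun z hz => (hV hz).2)

theorem coordLift_diff (s : Side) (X : E → E) (x : E) :
    (coordLift s X (x, x)).2 - (coordLift s X (x, x)).1 = s.sign • X x := by
  cases s <;> simp [coordLift, Side.sign]

/-- The exchange of the two points. -/
noncomputable def swapE (E : Type) [NormedAddCommGroup E] [NormedSpace ℝ E] :
    (E × E) ≃L[ℝ] (E × E) := ContinuousLinearEquiv.prodComm ℝ E E

theorem swapE_apply (z : E × E) : swapE E z = (z.2, z.1) := rfl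

theorem swapE_conj_coordLift (s : Side) (X : E → E) :
    (fun z => swapE E (coordLift s X ((swapE E).symm z))) = coordLift s.flip X := by
  cases s <;> rfl

/-- The jet of order three at the diagonal of a two-point function which generates a metric `G`
and a cubic tensor `t`. -/
structure HasPotentialJet (F : E × E → ℝ) (V : Set (E × E)) (Ω : Set E) (G : E → E → E → ℝ)
    (t : E → E → E → E → ℝ) : Prop extends IsCriticalOnDiagonal F V Ω where
  subset : V ⊆ Ω ×ˢ Ω
  G_add : ∀ x ∈ Ω, ∀ h h' k, G x (h + h') k = G x h k + G x h' k
  G_smul : ∀ x ∈ Ω, ∀ (s : ℝ) h k, G x (s • h) k = s * G x h k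
  G_symm : ∀ x ∈ Ω, ∀ h k, G x h k = G x k h
  t_add : ∀ x ∈ Ω, ∀ h h' k l, t x (h + h') k l = t x h k l + t x h' k l
  t_smul : ∀ x ∈ Ω, ∀ (s : ℝ) h k l, t x (s • h) k l = s * t x h k l
  t_symm₁ : ∀ x ∈ Ω, ∀ h k l, t x h k l = t x k h l
  t_symm₂ : ∀ x ∈ Ω, ∀ h k l, t x h k l = t x h l k
  quadratic : ∀ x ∈ Ω, ∀ h, fderiv ℝ (fderiv ℝ F) (x, x) (0, h) (0, h) = G x h h
  cubic : ∀ x ∈ Ω, ∀ h, fderiv ℝ (fderiv ℝ (fderiv ℝ F)) (x, x) (0, h) (0, h) (0, h) =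
    3 / 2 * fderiv ℝ (fun y => G y h h) x h + t x h h h

variable {F : E × E → ℝ} {V : Set (E × E)} {Ω : Set E} {G : E → E → E → ℝ}
  {t : E → E → E → E → ℝ}

namespace HasPotentialJet

/-- Diagonal components do not contribute, and on transversal vectors the quadratic form is
polarized. -/
theorem hessian (hF : HasPotentialJet F V Ω G t) {x : E} (hx : x ∈ Ω) (u v : E × E) :
    fderiv ℝ (fderiv ℝ F) (x, x) u v = G x (u.2 - u.1) (v.2 - v.1) := by
  have hs := fderiv_fderiv_symm hF.isOpen hF.smooth (hF.diag_mem x hx)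
  have := biadditive_eq_zero
    (f := fun h k => fderiv ℝ (fderiv ℝ F) (x, x) (0, h) (0, k) - G x h k)
    (fun h h' k => by
      have e1 : ((0, h + h') : E × E) = (0, h) + (0, h') := by simp
      rw [e1, map_add, add_apply, hF.G_add x hx]
      ring)
    (fun h k => by rw [hs, hF.G_symm x hx])
    (fun h => by rw [hF.quadratic x hx]; ring) (u.2 - u.1) (v.2 - v.1)
  rw [hF.fderiv₂_eq hx]
  linarith

theorem fderiv_metric (hF : HasPotentialJet F V Ω G t) {x : E} (hx : x ∈ Ω) (k l m : E) :
    fderiv ℝ (fun y => G y k l) x m =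
      fderiv ℝ (fderiv ℝ (fderiv ℝ F)) (x, x) (m, m) (0, k) (0, l) := by
  rw [hF.fderiv₃_diag hx]
  have : (fun y => fderiv ℝ (fderiv ℝ F) (y, y) (0, k) (0, l)) =ᶠ[𝓝 x] fun y => G y k l :=
    Filter.eventually_of_mem (hF.isOpen_base.mem_nhds hx) fun y hy => by
      simp [hF.hessian hy]
  rw [this.fderiv_eq]

/-- The field `cubic` gives the cubic form only; the full transversal part follows by polarization,
the mixed terms being derivatives of the metric. -/
theorem third (hF : HasPotentialJet F V Ω G t) {x : E} (hx : x ∈ Ω) (h k l : E) :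
    fderiv ℝ (fderiv ℝ (fderiv ℝ F)) (x, x) (0, h) (0, k) (0, l) =
      (fderiv ℝ (fun y => G y k l) x h + fderiv ℝ (fun y => G y h l) x k +
        fderiv ℝ (fun y => G y h k) x l) / 2 + t x h k l := by
  simp only [hF.fderiv_metric hx]
  exact trilinear_transversal (hF.fderiv₃_symm₁ hx) (hF.fderiv₃_symm₂ hx) (hF.t_add x hx)
    (hF.t_symm₁ x hx) (hF.t_symm₂ x hx)
    (fun h => by rw [hF.cubic x hx, hF.fderiv_metric hx]) h k l

/-- The displacements are `-l`, `-k`, `j`. The mixed terms give `-∂_l G(k,j) - ∂_k G(l,j)`, the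
transversal term half the sum of all three derivatives plus `t`; together these make the Christoffel
symbol. -/
theorem third_xxy (hF : HasPotentialJet F V Ω G t) {x : E} (hx : x ∈ Ω) (j k l : E) :
    fderiv ℝ (fderiv ℝ (fderiv ℝ F)) (x, x) (l, 0) (k, 0) (0, j) =
      -((fderiv ℝ (fun y => G y j l) x k + fderiv ℝ (fun y => G y j k) x l
        - fderiv ℝ (fun y => G y k l) x j) / 2) + t x j k l := by
  rw [hF.fderiv₃_expand hx]
  have e : ∀ h : E, ((0, -h) : E × E) = -(0, h) := fun h => by simp
  have e0 : fderiv ℝ (fderiv ℝ (fderiv ℝ F)) (x, x) (0, 0) = 0 := by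
    rw [← Prod.zero_eq_mk, map_zero]
  simp only [zero_sub, sub_zero, e0, zero_apply, e, map_neg, neg_apply, hF.third hx]
  simp only [← hF.fderiv_metric hx]
  rw [hF.t_symm₁ x hx j k l, hF.t_symm₂ x hx k j l, hF.t_symm₁ x hx k l j]
  have s : ∀ k l, (fun y => G y k l) =ᶠ[𝓝 x] fun y => G y l k := fun k l =>
    Filter.eventually_of_mem (hF.isOpen_base.mem_nhds hx) fun y hy => hF.G_symm y hy k l
  rw [(s k j).fderiv_eq, (s l j).fderiv_eq, (s l k).fderiv_eq]
  simp
  ring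

/-- Here only the mixed term `∂_j G(l,k)` occurs, and the transversal term has the opposite sign, as
`-j` is the only reversed displacement. -/
theorem third_yyx (hF : HasPotentialJet F V Ω G t) {x : E} (hx : x ∈ Ω) (j k l : E) :
    fderiv ℝ (fderiv ℝ (fderiv ℝ F)) (x, x) (0, l) (0, k) (j, 0) =
      -((fderiv ℝ (fun y => G y j l) x k + fderiv ℝ (fun y => G y j k) x l
        - fderiv ℝ (fun y => G y k l) x j) / 2) - t x j k l := by
  rw [hF.fderiv₃_expand hx]
  have e : ∀ h : E, ((0, -h) : E × E) = -(0, h) := fun h => by simp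
  have e0 : fderiv ℝ (fderiv ℝ (fderiv ℝ F)) (x, x) (0, 0) = 0 := by
    rw [← Prod.zero_eq_mk, map_zero]
  simp only [zero_sub, sub_zero, e0, zero_apply, e, map_neg, hF.third hx]
  simp only [← hF.fderiv_metric hx]
  rw [hF.t_symm₁ x hx j k l, hF.t_symm₂ x hx k j l, hF.t_symm₁ x hx k l j]
  have s : ∀ k l, (fun y => G y k l) =ᶠ[𝓝 x] fun y => G y l k := fun k l =>
    Filter.eventually_of_mem (hF.isOpen_base.mem_nhds hx) fun y hy => hF.G_symm y hy k l
  rw [(s k j).fderiv_eq, (s l j).fderiv_eq, (s l k).fderiv_eq]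
  simp
  ring

/-- The set on which a two-point function can be compared with its reflection. -/
theorem isOpen_symm (hF : HasPotentialJet F V Ω G t) : IsOpen (V ∩ swapE E ⁻¹' V) :=
  hF.isOpen.inter (hF.isOpen.preimage (swapE E).continuous)

theorem smooth_swap (hF : HasPotentialJet F V Ω G t) :
    ContDiffOn ℝ ∞ (F ∘ swapE E) (V ∩ swapE E ⁻¹' V) :=
  hF.smooth.comp (swapE E).contDiff.contDiffOn fun _ hz => hz.2

theorem antisymm_smooth (hF : HasPotentialJet F V Ω G t) :
    ContDiffOn ℝ ∞ (F - F ∘ swapE E) (V ∩ swapE E ⁻¹' V) :=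
  (hF.smooth.mono inter_subset_left).sub hF.smooth_swap

/-- A word applied to the reflected function is the word in the reflected fields applied to `F`. For
lifts this exchanges the letters, so differences of opposite words become words on the antisymmetric
part. -/
theorem dirDs_antisymm (hF : HasPotentialJet F V Ω G t) {l : List (E × E → E × E)}
    (hl : ∀ X ∈ l, ContDiffOn ℝ ∞ X V) {x : E} (hx : x ∈ Ω) :
    dirDs l (F - F ∘ swapE E) (x, x) = dirDs l F (x, x) -
      dirDs (l.map fun X z => swapE E (X ((swapE E).symm z))) F (x, x) := by
  rw [dirDs_sub hF.isOpen_symm (hF.smooth.mono inter_subset_left) hF.smooth_swap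
    (fun X hX => (hl X hX).mono inter_subset_left) ⟨hF.diag_mem x hx, hF.diag_mem x hx⟩,
    Pi.sub_apply, dirDs_comp_equiv]
  rfl

/-- The antisymmetric part vanishes to third order. -/
theorem antisymm_flat (hF : HasPotentialJet F V Ω G t) :
    IsFlatOnDiagonal (F - F ∘ swapE E) (V ∩ swapE E ⁻¹' V) Ω where
  isOpen := hF.isOpen_symm
  isOpen_base := hF.isOpen_base
  diag_mem x hx := ⟨hF.diag_mem x hx, hF.diag_mem x hx⟩
  smooth := hF.antisymm_smooth
  fderiv_eq_zero x hx := by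
    refine ContinuousLinearMap.ext fun u => ?_
    have := hF.dirDs_antisymm (l := [fun _ => u]) (fun X hX => by
      rw [List.mem_singleton.1 hX]; exact contDiffOn_const) hx
    simp only [dirDs, List.map_cons, List.map_nil, List.foldr_cons, List.foldr_nil, dirD] at this
    rw [this, hF.fderiv_eq_zero x hx]
    simp
  fderiv₂_eq_zero x hx := by
    refine ContinuousLinearMap.ext fun u => ContinuousLinearMap.ext fun v => ?_
    have hV : ((x, x) : E × E) ∈ V ∩ swapE E ⁻¹' V := ⟨hF.diag_mem x hx, hF.diag_mem x hx⟩
    have := hF.dirDs_antisymm (l := [fun _ => u, fun _ => v]) (fun X hX => by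
      rcases List.mem_pair.1 hX with rfl | rfl <;> exact contDiffOn_const) hx
    simp only [dirDs, List.map_cons, List.map_nil, List.foldr_cons, List.foldr_nil] at this
    rw [dirD_const₂ hF.isOpen_symm hF.antisymm_smooth hV,
      dirD_const₂ hF.isOpen hF.smooth hV.1, dirD_const₂ hF.isOpen hF.smooth hV.1, hF.hessian hx,
      hF.hessian hx, swapE_apply, swapE_apply] at this
    rw [this]
    -- The exchange reverses both displacements, and the two signs cancel in the Hessian.
    have e : ∀ a b : E, a - b = (-1 : ℝ) • (b - a) := fun a b => by simp
    simp only
    rw [e u.1, e v.1, hF.G_smul x hx, hF.G_symm x hx _ ((-1 : ℝ) • (v.2 - v.1)), hF.G_smul x hx,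
      hF.G_symm x hx (v.2 - v.1)]
    simp

/-- The metric terms combine to derivatives of `G` in the directions `(u.1 + u.2) / 2` and likewise
for `v`, `w`, which are unchanged by the exchange. The term with `t` is odd in the displacements and
doubles. -/
theorem antisymm_third (hF : HasPotentialJet F V Ω G t) {x : E} (hx : x ∈ Ω) (u v w : E × E) :
    fderiv ℝ (fderiv ℝ (fderiv ℝ (F - F ∘ swapE E))) (x, x) u v w =
      2 * t x (u.2 - u.1) (v.2 - v.1) (w.2 - w.1) := by
  have hV : ((x, x) : E × E) ∈ V ∩ swapE E ⁻¹' V := ⟨hF.diag_mem x hx, hF.diag_mem x hx⟩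
  have := hF.dirDs_antisymm (l := [fun _ => u, fun _ => v, fun _ => w]) (fun X hX => by
    simp only [List.mem_cons, List.not_mem_nil, or_false] at hX
    rcases hX with rfl | rfl | rfl <;> exact contDiffOn_const) hx
  simp only [dirDs, List.map_cons, List.map_nil, List.foldr_cons, List.foldr_nil] at this
  rw [dirD_const₃ hF.isOpen_symm hF.antisymm_smooth hV,
    dirD_const₃ hF.isOpen hF.smooth hV.1, dirD_const₃ hF.isOpen hF.smooth hV.1,
    hF.fderiv₃_expand hx u, hF.fderiv₃_expand hx (swapE E u), swapE_apply, swapE_apply,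
    swapE_apply] at this
  rw [this]
  have e : ∀ a b : E, ((0, a - b) : E × E) = -(0, b - a) := fun a b => by simp
  have e' : ∀ u : E × E, ((u.1, u.1) : E × E) =
    (u.2, u.2) - ((u.2 - u.1, u.2 - u.1) : E × E) := fun u => by simp
  simp only [e u.1 u.2, e v.1 v.2, e w.1 w.2, e' u, e' v, e' w, map_neg, map_sub, neg_apply,
    sub_apply, ← hF.fderiv_metric hx, hF.third hx]
  ring

theorem lift₂ (hF : HasPotentialJet F V Ω G t) {X Y : E → E} (hY : ContDiffOn ℝ ∞ Y Ω)
    (a b : Side) {x : E} (hx : x ∈ Ω) :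
    dirDs [coordLift a X, coordLift b Y] F (x, x) = a.sign * b.sign * G x (X x) (Y x) := by
  simp only [dirDs, List.foldr_cons, List.foldr_nil]
  rw [dirD_dirD_eq hF.isOpen (contDiffOn_coordLift hF.subset hY b) hF.smooth (hF.diag_mem x hx)
    (hF.fderiv_eq_zero x hx), hF.hessian hx, coordLift_diff, coordLift_diff, hF.G_smul x hx,
    hF.G_symm x hx, hF.G_smul x hx, hF.G_symm x hx]
  ring

/-- On a function with vanishing 2-jet, three derivatives along fields depend only on the values of
the fields, so no derivatives of `X`, `Y`, `Z` appear. -/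
theorem lift₃ (hF : HasPotentialJet F V Ω G t) {X Y Z : E → E} (hX : ContDiffOn ℝ ∞ X Ω)
    (hY : ContDiffOn ℝ ∞ Y Ω) (hZ : ContDiffOn ℝ ∞ Z Ω) (a b c : Side) {x : E} (hx : x ∈ Ω) :
    dirDs [coordLift a X, coordLift b Y, coordLift c Z] F (x, x) -
      dirDs [coordLift a.flip X, coordLift b.flip Y, coordLift c.flip Z] F (x, x) =
      2 * (a.sign * b.sign * c.sign * t x (X x) (Y x) (Z x)) := by
  have := hF.dirDs_antisymm (l := [coordLift a X, coordLift b Y, coordLift c Z]) (fun U hU => by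
    simp only [List.mem_cons, List.not_mem_nil, or_false] at hU
    rcases hU with rfl | rfl | rfl
    exacts [contDiffOn_coordLift hF.subset hX _, contDiffOn_coordLift hF.subset hY _,
      contDiffOn_coordLift hF.subset hZ _]) hx
  simp only [List.map_cons, List.map_nil, swapE_conj_coordLift] at this
  rw [← this]
  simp only [dirDs, List.foldr_cons, List.foldr_nil]
  rw [hF.antisymm_flat.dirD₃_eq ((contDiffOn_coordLift hF.subset hY _).mono inter_subset_left)
    ((contDiffOn_coordLift hF.subset hZ _).mono inter_subset_left) hx, hF.antisymm_third hx,
    coordLift_diff, coordLift_diff, coordLift_diff, hF.t_smul x hx, hF.t_symm₁ x hx,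
    hF.t_smul x hx, hF.t_symm₂ x hx, hF.t_symm₁ x hx, hF.t_smul x hx,
    hF.t_symm₂ x hx (Z x), hF.t_symm₁ x hx (Z x), hF.t_symm₂ x hx (X x)]
  ring

/-- The sum of the four fourth order words that begin with given lifts is symmetric under the
exchange of the two points. -/
theorem lift₄ (hF : HasPotentialJet F V Ω G t) {X Y Z W : E → E} (hX : ContDiffOn ℝ ∞ X Ω)
    (hY : ContDiffOn ℝ ∞ Y Ω) (hZ : ContDiffOn ℝ ∞ Z Ω) (hW : ContDiffOn ℝ ∞ W Ω) (a b : Side)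
    {x : E} (hx : x ∈ Ω) {q : Side → Side → ℝ}
    (hq : ∀ c d, q c d =
      dirDs [coordLift a X, coordLift b Y, coordLift c Z, coordLift d W] F (x, x) -
      dirDs [coordLift a.flip X, coordLift b.flip Y, coordLift c.flip Z, coordLift d.flip W] F
        (x, x)) :
    q Side.L Side.L + q Side.L Side.R + q Side.R Side.L + q Side.R Side.R = 0 := by
  set K := F - F ∘ swapE E with hK
  set V' := V ∩ swapE E ⁻¹' V with hV'
  have hflat := hF.antisymm_flat
  have hs : ∀ {U : E → E}, ContDiffOn ℝ ∞ U Ω → ∀ s, ContDiffOn ℝ ∞ (coordLift s U) V' :=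
    fun hU s => (contDiffOn_coordLift hF.subset hU s).mono inter_subset_left
  have hxV : ((x, x) : E × E) ∈ V' := hflat.diag_mem x hx
  have hq' : ∀ c d, q c d =
      dirDs [coordLift a X, coordLift b Y, coordLift c Z, coordLift d W] K (x, x) := by
    intro c d
    have := hF.dirDs_antisymm (l := [coordLift a X, coordLift b Y, coordLift c Z, coordLift d W])
      (fun U hU => by
        simp only [List.mem_cons, List.not_mem_nil, or_false] at hU
        rcases hU with rfl | rfl | rfl | rfl
        exacts [contDiffOn_coordLift hF.subset hX _, contDiffOn_coordLift hF.subset hY _,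
          contDiffOn_coordLift hF.subset hZ _, contDiffOn_coordLift hF.subset hW _]) hx
    simp only [List.map_cons, List.map_nil, swapE_conj_coordLift] at this
    rw [hq, ← this]
  -- The sum of the two lifts is tangent to the diagonal. Adding over the sides of `W`, then of `Z`,
  -- replaces both letters by such sums.
  set D : (E → E) → E × E → E × E := fun U => coordLift Side.L U + coordLift Side.R U with hD
  have hDs : ∀ {U : E → E}, ContDiffOn ℝ ∞ U Ω → ContDiffOn ℝ ∞ (D U) V' :=
    fun hU => (hs hU _).add (hs hU _)
  have hDdiag : ∀ (U : E → E), ∀ y ∈ Ω, D U (y, y) = (U y, U y) := fun U y _ => by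
    simp [hD, coordLift]
  have hsum : ∀ (U : E → E) (f : E × E → ℝ),
      dirD (coordLift Side.L U) f + dirD (coordLift Side.R U) f = dirD (D U) f := by
    intro U f
    funext z
    simp [dirD, hD]
  have hK2 := hflat.dirD (hDs hW) (hDdiag W)
  have hK3 := hK2.dirD (hDs hZ) (hDdiag Z)
  have e1 : ∀ c, q c Side.L + q c Side.R =
      dirDs [coordLift a X, coordLift b Y, coordLift c Z] (dirD (D W) K) (x, x) := by
    intro c
    rw [hq', hq', ← hsum, dirDs_add hflat.isOpen (contDiffOn_dirD hflat.isOpen (hs hW _)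
      hflat.smooth) (contDiffOn_dirD hflat.isOpen (hs hW _) hflat.smooth) (fun U hU => by
        simp only [List.mem_cons, List.not_mem_nil, or_false] at hU
        rcases hU with rfl | rfl | rfl
        exacts [hs hX _, hs hY _, hs hZ _]) hxV]
    rfl
  have e2 : dirDs [coordLift a X, coordLift b Y, coordLift Side.L Z] (dirD (D W) K) (x, x) +
      dirDs [coordLift a X, coordLift b Y, coordLift Side.R Z] (dirD (D W) K) (x, x) =
      dirDs [coordLift a X, coordLift b Y] (dirD (D Z) (dirD (D W) K)) (x, x) := by
    rw [← hsum Z, dirDs_add hflat.isOpen (contDiffOn_dirD hflat.isOpen (hs hZ _)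
      hK2.smooth) (contDiffOn_dirD hflat.isOpen (hs hZ _) hK2.smooth) (fun U hU => by
        simp only [List.mem_cons, List.not_mem_nil, or_false] at hU
        rcases hU with rfl | rfl
        exacts [hs hX _, hs hY _]) hxV]
    rfl
  -- After two tangential derivatives the 2-jet still vanishes, and only two derivatives are left.
  have e3 : dirDs [coordLift a X, coordLift b Y] (dirD (D Z) (dirD (D W) K)) (x, x) = 0 :=
    hK3.dirD_dirD_eq_zero (hs hY _) hx
  linarith [e1 Side.L, e1 Side.R]

end HasPotentialJet

end TwoPoint

end HamiltonPotential

namespace HamiltonPotential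

set_option maxSynthPendingDepth 3

open Filter Topology

/-! ### Tangent vectors, tensors and Lie derivatives in a chart -/

section Charts

variable {n : ℕ} {M : Type*} [TopologicalSpace M] [ChartedSpace (Euc n) M]
  {φ : OpenPartialHomeomorph M (Euc n)}

theorem mdifferentiable_of_mem_maximalAtlas
    (hφ : φ ∈ IsManifold.maximalAtlas 𝓘(ℝ, Euc n) ∞ M) :
    φ.MDifferentiable 𝓘(ℝ, Euc n) 𝓘(ℝ, Euc n) :=
  ⟨(contMDiffOn_of_mem_maximalAtlas hφ).mdifferentiableOn (by simp),
    (contMDiffOn_symm_of_mem_maximalAtlas hφ).mdifferentiableOn (by simp)⟩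

/-- The coordinate expression of a tangent vector. -/
noncomputable def vecCoord (φ : OpenPartialHomeomorph M (Euc n)) (p : M)
    (v : TangentSpace 𝓘(ℝ, Euc n) p) : Euc n :=
  mfderiv 𝓘(ℝ, Euc n) 𝓘(ℝ, Euc n) φ p v

/-- A vector field in coordinates. -/
noncomputable def fieldCoord (φ : OpenPartialHomeomorph M (Euc n))
    (X : ∀ p : M, TangentSpace 𝓘(ℝ, Euc n) p) : Euc n → Euc n :=
  fun x => vecCoord φ (φ.symm x) (X (φ.symm x))

theorem chartVec_add (φ : OpenPartialHomeomorph M (Euc n)) (x v w : Euc n) :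
    chartVec φ x (v + w) = chartVec φ x v + chartVec φ x w :=
  map_add (mfderiv 𝓘(ℝ, Euc n) 𝓘(ℝ, Euc n) φ.symm x) v w

theorem chartVec_smul (φ : OpenPartialHomeomorph M (Euc n)) (x : Euc n) (s : ℝ) (v : Euc n) :
    chartVec φ x (s • v) = s • chartVec φ x v :=
  map_smul (mfderiv 𝓘(ℝ, Euc n) 𝓘(ℝ, Euc n) φ.symm x) s v

theorem euc_eq_sum (v : Euc n) : v = ∑ i, v i • basisVec i := by
  ext j
  simp [basisVec, Finset.sum_apply, Pi.single_apply]

theorem chartVec_sum (φ : OpenPartialHomeomorph M (Euc n)) (x v : Euc n) :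
    chartVec φ x v = ∑ i, v i • chartVec φ x (basisVec i) := by
  let A : Euc n →L[ℝ] TangentSpace 𝓘(ℝ, Euc n) (φ.symm x) :=
    mfderiv 𝓘(ℝ, Euc n) 𝓘(ℝ, Euc n) φ.symm x
  calc chartVec φ x v = A (∑ i, v i • basisVec i) := by rw [← euc_eq_sum]; rfl
    _ = ∑ i, v i • A (basisVec i) := by rw [map_sum]; simp only [map_smul]
    _ = _ := rfl

theorem vecCoord_chartVec (hφ : φ ∈ IsManifold.maximalAtlas 𝓘(ℝ, Euc n) ∞ M) {x : Euc n}
    (hx : x ∈ φ.target) (v : Euc n) : vecCoord φ (φ.symm x) (chartVec φ x v) = v :=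
  DFunLike.congr_fun ((mdifferentiable_of_mem_maximalAtlas hφ).comp_symm_deriv hx) v

/-- Both maps are endomorphisms of the model space, where in finite dimension a one-sided inverse is
two-sided. -/
theorem chartVec_vecCoord (hφ : φ ∈ IsManifold.maximalAtlas 𝓘(ℝ, Euc n) ∞ M) {x : Euc n}
    (hx : x ∈ φ.target) (v : TangentSpace 𝓘(ℝ, Euc n) (φ.symm x)) :
    chartVec φ x (vecCoord φ (φ.symm x) v) = v := by
  have key : ∀ A B : Euc n →L[ℝ] Euc n, (∀ w, A (B w) = w) → ∀ w, B (A w) = w := by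
    intro A B h w
    have h1 : A.toLinearMap * B.toLinearMap = 1 := LinearMap.ext h
    exact LinearMap.congr_fun (mul_eq_one_comm.1 h1) w
  exact key _ _ (vecCoord_chartVec hφ hx) v

theorem tensor_sum {k : ℕ} (T : CovTensorField k n M) (φ : OpenPartialHomeomorph M (Euc n))
    (x v : Euc n) : T.toFun (φ.symm x) (fun _ => chartVec φ x v) =
      ∑ idx : Fin k → Fin n, (∏ a, v (idx a)) * tensorCoord T φ idx x := by
  rw [chartVec_sum, MultilinearMap.map_sum]
  refine Finset.sum_congr rfl fun idx _ => ?_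
  rw [MultilinearMap.map_smul_univ]
  rfl

/-- The Lagrangian along a curve in coordinates. -/
theorem lagrangian_velocity (L : Lagrangian n M)
    (hφ : φ ∈ IsManifold.maximalAtlas 𝓘(ℝ, Euc n) ∞ M) {γ : ℝ → M} {t : ℝ}
    (ht : t ∈ Icc (0 : ℝ) 1)
    (hγ : MDifferentiableWithinAt 𝓘(ℝ, ℝ) 𝓘(ℝ, Euc n) γ (Icc 0 1) t) (hs : γ t ∈ φ.source) :
    L (γ t) (velocity γ t) =
      lagrangianCoord L φ (φ (γ t)) (derivWithin (fun r => φ (γ r)) (Icc (0 : ℝ) 1) t) := by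
  -- The points `γ t` and `φ.symm (φ (γ t))` are equal only propositionally, so the vectors are
  -- compared in the model space that underlies every tangent space.
  have cast : ∀ (p p' : M) (_ : p = p') (v : TangentSpace 𝓘(ℝ, Euc n) p)
      (v' : TangentSpace 𝓘(ℝ, Euc n) p') (_ : (v : Euc n) = (v' : Euc n)), L p v = L p' v' := by
    intro p p' h v v' hv
    subst h
    exact congrArg (L p) hv
  have hd := mdifferentiable_of_mem_maximalAtlas hφ
  let A : Euc n →L[ℝ] Euc n := mfderiv 𝓘(ℝ, Euc n) 𝓘(ℝ, Euc n) φ (γ t)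
  let D : ℝ →L[ℝ] Euc n := mfderivWithin 𝓘(ℝ, ℝ) 𝓘(ℝ, Euc n) γ (Icc 0 1) t
  have h1 : HasMFDerivWithinAt 𝓘(ℝ, ℝ) 𝓘(ℝ, Euc n) (fun r => φ (γ r)) (Icc 0 1) t (A.comp D) :=
    (hd.mdifferentiableAt hs).hasMFDerivAt.comp_hasMFDerivWithinAt t hγ.hasMFDerivWithinAt
  have h2 : derivWithin (fun r => φ (γ r)) (Icc (0 : ℝ) 1) t = vecCoord φ (γ t) (velocity γ t) :=
    (show HasFDerivWithinAt (fun r => φ (γ r)) (A.comp D) (Icc 0 1) t from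
      h1.hasFDerivWithinAt).hasDerivWithinAt.derivWithin (uniqueDiffOn_Icc zero_lt_one t ht)
  refine cast _ _ (φ.left_inv hs).symm _ _ ?_
  rw [h2]
  exact (DFunLike.congr_fun (hd.symm_comp_deriv hs) (velocity γ t)).symm

/-- Lie derivatives of two-point functions in coordinates. -/
theorem lieD_eq_fderiv (hφ : φ ∈ IsManifold.maximalAtlas 𝓘(ℝ, Euc n) ∞ M) {F : M × M → ℝ}
    {z : Euc n × Euc n} (hz : z ∈ φ.target ×ˢ φ.target)
    (hF : DifferentiableAt ℝ (twoPointCoord F φ) z)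
    (V : ∀ z : M × M, TangentSpace (𝓘(ℝ, Euc n).prod 𝓘(ℝ, Euc n)) z) :
    lieD V F (φ.symm z.1, φ.symm z.2) = fderiv ℝ (twoPointCoord F φ) z
      (vecCoord φ (φ.symm z.1) (V (φ.symm z.1, φ.symm z.2)).1,
        vecCoord φ (φ.symm z.2) (V (φ.symm z.1, φ.symm z.2)).2) := by
  have hd := mdifferentiable_of_mem_maximalAtlas hφ
  set p : M × M := (φ.symm z.1, φ.symm z.2) with hp
  have hp1 : p.1 ∈ φ.source := φ.map_target hz.1
  have hp2 : p.2 ∈ φ.source := φ.map_target hz.2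
  have hpz : (φ p.1, φ p.2) = z := by
    ext1
    · exact φ.right_inv hz.1
    · exact φ.right_inv hz.2
  let A : Euc n →L[ℝ] Euc n := mfderiv 𝓘(ℝ, Euc n) 𝓘(ℝ, Euc n) φ p.1
  let B : Euc n →L[ℝ] Euc n := mfderiv 𝓘(ℝ, Euc n) 𝓘(ℝ, Euc n) φ p.2
  have h1 : HasMFDerivAt (𝓘(ℝ, Euc n).prod 𝓘(ℝ, Euc n)) 𝓘(ℝ, Euc n × Euc n)
      (fun q : M × M => (φ q.1, φ q.2)) p
      ((A.comp (ContinuousLinearMap.fst ℝ (Euc n) (Euc n))).prod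
        (B.comp (ContinuousLinearMap.snd ℝ (Euc n) (Euc n)))) := by
    -- Identifies the manifold structure of the product space as a vector space with the product
    -- structure.
    rw [modelWithCornersSelf_prod, ← chartedSpaceSelf_prod]
    exact ((hd.mdifferentiableAt hp1).hasMFDerivAt.comp p (hasMFDerivAt_fst p)).prodMk
      ((hd.mdifferentiableAt hp2).hasMFDerivAt.comp p (hasMFDerivAt_snd p))
  have h2 : HasMFDerivAt 𝓘(ℝ, Euc n × Euc n) 𝓘(ℝ, ℝ) (twoPointCoord F φ) (φ p.1, φ p.2)
      (fderiv ℝ (twoPointCoord F φ) z) := by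
    rw [hpz]
    exact hF.hasFDerivAt.hasMFDerivAt
  have e : F =ᶠ[𝓝 p] (twoPointCoord F φ) ∘ fun q : M × M => (φ q.1, φ q.2) := by
    filter_upwards [(φ.open_source.prod φ.open_source).mem_nhds ⟨hp1, hp2⟩] with q hq
    simp only [Function.comp_apply, twoPointCoord]
    rw [φ.left_inv hq.1, φ.left_inv hq.2]
  have h3 := (HasMFDerivAt.comp p h2 h1).congr_of_eventuallyEq e
  rw [lieD, h3.mfderiv]
  rfl

theorem contDiff_coord (i : Fin n) : ContDiff ℝ ∞ (fun v : Euc n => v i) :=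
  (EuclideanSpace.proj (𝕜 := ℝ) i).contDiff

theorem contDiffOn_tensor {k : ℕ} (T : CovTensorField k n M)
    (hφ : φ ∈ IsManifold.maximalAtlas 𝓘(ℝ, Euc n) ∞ M) :
    ContDiffOn ℝ ∞ (fun p : Euc n × Euc n => T.toFun (φ.symm p.1) (fun _ => chartVec φ p.1 p.2))
      (φ.target ×ˢ univ) := by
  simp only [tensor_sum]
  refine ContDiffOn.sum fun idx _ => ContDiffOn.mul ?_ ?_
  · exact (contDiff_prod fun a _ => (contDiff_coord (idx a)).comp contDiff_snd).contDiffOn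
  · exact (T.smooth φ hφ idx).comp contDiffOn_fst fun p hp => hp.1

variable [IsManifold 𝓘(ℝ, Euc n) ∞ M]

/-- The field is the image of a constant field under the tangent map of the inverse chart. -/
theorem contMDiffOn_chartVec (hφ : φ ∈ IsManifold.maximalAtlas 𝓘(ℝ, Euc n) ∞ M) (e : Euc n) :
    ContMDiffOn 𝓘(ℝ, Euc n) 𝓘(ℝ, Euc n).tangent ∞
      (fun x => (⟨φ.symm x, chartVec φ x e⟩ : TangentBundle 𝓘(ℝ, Euc n) M)) φ.target := by
  have h1 := (contMDiffOn_symm_of_mem_maximalAtlas hφ).contMDiffOn_tangentMapWithin (m := ∞)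
    (by simp) φ.open_target.uniqueMDiffOn
  have h2 : ContMDiffOn 𝓘(ℝ, Euc n) 𝓘(ℝ, Euc n).tangent ∞
      (fun x => (⟨x, e⟩ : TangentBundle 𝓘(ℝ, Euc n) (Euc n))) φ.target :=
    contMDiffOn_vectorSpace_iff_contDiffOn.2 (contDiffOn_const (c := e))
  refine (h1.comp h2 fun x hx => hx).congr fun x hx => ?_
  simp only [Function.comp_apply, tangentMapWithin, chartVec]
  rw [mfderivWithin_of_isOpen φ.open_target hx]

theorem contDiffOn_metricCoord (g : RiemMetric n M)
    (hφ : φ ∈ IsManifold.maximalAtlas 𝓘(ℝ, Euc n) ∞ M) (i j : Fin n) :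
    ContDiffOn ℝ ∞ (metricCoord g φ i j) φ.target := by
  rw [← contMDiffOn_iff_contDiffOn]
  have : ContMDiffOn 𝓘(ℝ, Euc n) (𝓘(ℝ, Euc n).prod 𝓘(ℝ, ℝ)) ∞
      (fun x => Bundle.TotalSpace.mk' ℝ (E := Bundle.Trivial M ℝ) (φ.symm x)
        (g.inner (φ.symm x) (chartVec φ x (basisVec i)) (chartVec φ x (basisVec j))))
      φ.target := by
    apply ContMDiffOn.clm_bundle_apply₂ (F₁ := Euc n) (F₂ := Euc n)
    · exact g.contMDiff.comp_contMDiffOn (contMDiffOn_symm_of_mem_maximalAtlas hφ)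
    · exact contMDiffOn_chartVec hφ _
    · exact contMDiffOn_chartVec hφ _
  intro x hx
  have h := this x hx
  simp only [Bundle.contMDiffWithinAt_totalSpace] at h
  exact h.2

/-- The coordinate expression of a smooth vector field is smooth. -/
theorem contDiffOn_fieldCoord (hφ : φ ∈ IsManifold.maximalAtlas 𝓘(ℝ, Euc n) ∞ M)
    {X : ∀ p : M, TangentSpace 𝓘(ℝ, Euc n) p} (hX : IsSmoothField X) :
    ContDiffOn ℝ ∞ (fieldCoord φ X) φ.target := by
  have h1 := (contMDiffOn_of_mem_maximalAtlas hφ).contMDiffOn_tangentMapWithin (m := ∞)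
    (by simp) φ.open_source.uniqueMDiffOn
  have h2 := (hX.comp_contMDiffOn (contMDiffOn_symm_of_mem_maximalAtlas hφ))
  have h3 : ContMDiffOn 𝓘(ℝ, Euc n) 𝓘(ℝ, Euc n).tangent ∞
      (fun x => (⟨x, vecCoord φ (φ.symm x) (X (φ.symm x))⟩ :
        TangentBundle 𝓘(ℝ, Euc n) (Euc n))) φ.target := by
    refine (h1.comp h2 fun x hx => φ.map_target hx).congr fun x hx => ?_
    simp only [Function.comp_apply, tangentMapWithin, vecCoord]
    rw [mfderivWithin_of_isOpen φ.open_source (φ.map_target hx), φ.right_inv hx]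
    rfl
  exact contMDiffOn_vectorSpace_iff_contDiffOn.1 h3

theorem metric_sum (g : RiemMetric n M) (φ : OpenPartialHomeomorph M (Euc n)) (x v : Euc n) :
    g.inner (φ.symm x) (chartVec φ x v) (chartVec φ x v) =
      ∑ i, ∑ j, v i * (v j * metricCoord g φ i j x) := by
  rw [chartVec_sum]
  simp only [map_sum, map_smul, sum_apply, smul_apply,
    smul_eq_mul, Finset.mul_sum]
  rw [Finset.sum_comm]
  refine Finset.sum_congr rfl fun i _ => Finset.sum_congr rfl fun j _ => ?_
  simp only [metricCoord]
  ring

theorem contDiffOn_metric (g : RiemMetric n M)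
    (hφ : φ ∈ IsManifold.maximalAtlas 𝓘(ℝ, Euc n) ∞ M) :
    ContDiffOn ℝ ∞ (fun p : Euc n × Euc n =>
      g.inner (φ.symm p.1) (chartVec φ p.1 p.2) (chartVec φ p.1 p.2)) (φ.target ×ˢ univ) := by
  simp only [metric_sum]
  refine ContDiffOn.sum fun i _ => ContDiffOn.sum fun j _ => ?_
  refine ((contDiff_coord i).comp contDiff_snd).contDiffOn.mul
    (((contDiff_coord j).comp contDiff_snd).contDiffOn.mul ?_)
  exact (contDiffOn_metricCoord g hφ i j).comp contDiffOn_fst fun p hp => hp.1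

/-- The coordinate expression of the Lagrangian of the theory. -/
theorem isQuarticLagrangian_coord (g : RiemMetric n M) (α : ℝ) (T : CovTensorField 3 n M)
    (C : CovTensorField 4 n M) (hφ : φ ∈ IsManifold.maximalAtlas 𝓘(ℝ, Euc n) ∞ M) :
    IsQuarticLagrangian (lagrangianCoord (lagrangian g α T C) φ)
      (fun x v => 1 / 2 * g.inner (φ.symm x) (chartVec φ x v) (chartVec φ x v))
      (fun x v => α / 6 * T.toFun (φ.symm x) (fun _ => chartVec φ x v))
      (fun x v => 1 / 24 * C.toFun (φ.symm x) (fun _ => chartVec φ x v)) φ.target where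
  isOpen := φ.open_target
  smooth := ((contDiffOn_const.mul (contDiffOn_metric g hφ)).add
    (contDiffOn_const.mul (contDiffOn_tensor T hφ))).add
    (contDiffOn_const.mul (contDiffOn_tensor C hφ))
  eq_add x v := rfl
  smooth_a v := contDiffOn_const.mul ((contDiffOn_metric g hφ).comp
    (contDiff_prodMk_left v).contDiffOn fun x hx => ⟨hx, mem_univ _⟩)
  smooth_b v := contDiffOn_const.mul ((contDiffOn_tensor T hφ).comp
    (contDiff_prodMk_left v).contDiffOn fun x hx => ⟨hx, mem_univ _⟩)
  smooth_d v := contDiffOn_const.mul ((contDiffOn_tensor C hφ).comp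
    (contDiff_prodMk_left v).contDiffOn fun x hx => ⟨hx, mem_univ _⟩)
  a_smul x v s := by
    rw [chartVec_smul]
    simp only [map_smul, smul_apply, smul_eq_mul]
    ring
  b_smul x v s := by
    rw [chartVec_smul, MultilinearMap.map_smul_univ (T.toFun (φ.symm x)) (fun _ => s)]
    simp
    ring
  d_smul x v s := by
    rw [chartVec_smul, MultilinearMap.map_smul_univ (C.toFun (φ.symm x)) (fun _ => s)]
    simp
    ring
  a_pos x hx v hv := by
    have : chartVec φ x v ≠ 0 := fun h => hv (by
      rw [← vecCoord_chartVec hφ hx v, h]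
      exact map_zero (mfderiv 𝓘(ℝ, Euc n) 𝓘(ℝ, Euc n) φ (φ.symm x)))
    have := g.pos (φ.symm x) _ this
    positivity

end Charts

end HamiltonPotential

namespace HamiltonPotential

set_option maxSynthPendingDepth 3

open Filter Topology

/-! ### From motions on the manifold to motions in charts -/

section Transport

variable {n : ℕ} {M : Type*} [TopologicalSpace M] [ChartedSpace (Euc n) M]

/-- A family of functionals on a finite-dimensional space is differentiable if its components
are. -/
theorem hasDerivWithinAt_clm_of_components {P : ℝ → Euc n →L[ℝ] ℝ} {P' : Euc n →L[ℝ] ℝ} {s : Set ℝ}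
    {t : ℝ} (h : ∀ i, HasDerivWithinAt (fun r => P r (basisVec i)) (P' (basisVec i)) s t) :
    HasDerivWithinAt P P' s t := by
  have e : ∀ A : Euc n →L[ℝ] ℝ, A =
      ∑ i, A (basisVec i) • (EuclideanSpace.proj i : Euc n →L[ℝ] ℝ) := by
    intro A
    ext v
    conv_lhs => rw [euc_eq_sum v]
    simp [sum_apply, mul_comm]
  have h1 := HasDerivWithinAt.fun_sum (u := Finset.univ) fun i _ =>
    (h i).smul_const (EuclideanSpace.proj i : Euc n →L[ℝ] ℝ)
  rw [← e P'] at h1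
  rw [show P = fun r => _ from funext fun r => e (P r)]
  exact h1

/-- The coordinate domain, in two charts, of a set of pairs of points. -/
def pairDomain (φ₁ φ₂ : OpenPartialHomeomorph M (Euc n)) (U : Set (M × M)) :
    Set (Euc n × Euc n) :=
  (φ₁.target ×ˢ φ₂.target) ∩ (fun z : Euc n × Euc n => (φ₁.symm z.1, φ₂.symm z.2)) ⁻¹' U

theorem isOpen_pairDomain {M : Type*} [TopologicalSpace M]
    (φ₁ φ₂ : OpenPartialHomeomorph M (Euc n)) {U : Set (M × M)}
    (hU : IsOpen U) : IsOpen (pairDomain φ₁ φ₂ U) := by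
  refine ContinuousOn.isOpen_inter_preimage ?_ (φ₁.open_target.prod φ₂.open_target) hU
  exact (φ₁.continuousOn_symm.comp continuousOn_fst fun z hz => hz.1).prodMk
    (φ₂.continuousOn_symm.comp continuousOn_snd fun z hz => hz.2)

variable {φ φ₁ φ₂ : OpenPartialHomeomorph M (Euc n)} {L : Lagrangian n M} {U : Set (M × M)}
  {Γ : ℝ × (M × M) → M}

theorem SolvesNearDiagonal.contMDiffOn_coord (hΓ : SolvesNearDiagonal L U Γ)
    (hφ₁ : φ₁ ∈ IsManifold.maximalAtlas 𝓘(ℝ, Euc n) ∞ M)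
    (hφ₂ : φ₂ ∈ IsManifold.maximalAtlas 𝓘(ℝ, Euc n) ∞ M) :
    ContMDiffOn 𝓘(ℝ, ℝ × (Euc n × Euc n)) 𝓘(ℝ, Euc n) ∞
      (fun p : ℝ × (Euc n × Euc n) => Γ (p.1, (φ₁.symm p.2.1, φ₂.symm p.2.2)))
      (Icc (0 : ℝ) 1 ×ˢ pairDomain φ₁ φ₂ U) := by
  refine hΓ.smooth.comp (g := Γ) (f := fun p : ℝ × (Euc n × Euc n) =>
    (p.1, (φ₁.symm p.2.1, φ₂.symm p.2.2))) ?_ fun p hp => ⟨hp.1, hp.2.2⟩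
  refine ContMDiffOn.prodMk contDiff_fst.contMDiff.contMDiffOn (ContMDiffOn.prodMk ?_ ?_)
  · exact (contMDiffOn_symm_of_mem_maximalAtlas hφ₁).comp
      (contDiff_fst.comp contDiff_snd).contMDiff.contMDiffOn fun p hp => hp.2.1.1
  · exact (contMDiffOn_symm_of_mem_maximalAtlas hφ₂).comp
      (contDiff_snd.comp contDiff_snd).contMDiff.contMDiffOn fun p hp => hp.2.1.2

theorem SolvesNearDiagonal.mdifferentiableWithinAt (hΓ : SolvesNearDiagonal L U Γ) {z : M × M}
    (hz : z ∈ U) {t : ℝ} (ht : t ∈ Icc (0 : ℝ) 1) :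
    MDifferentiableWithinAt 𝓘(ℝ, ℝ) 𝓘(ℝ, Euc n) (fun r => Γ (r, z)) (Icc 0 1) t := by
  have h1 : MDifferentiableWithinAt (𝓘(ℝ, ℝ).prod (𝓘(ℝ, Euc n).prod 𝓘(ℝ, Euc n))) 𝓘(ℝ, Euc n) Γ
      (Icc (0 : ℝ) 1 ×ˢ U) (t, z) := (hΓ.smooth (t, z) ⟨ht, hz⟩).mdifferentiableWithinAt (by simp)
  have h2 : MDifferentiableWithinAt 𝓘(ℝ, ℝ) (𝓘(ℝ, ℝ).prod (𝓘(ℝ, Euc n).prod 𝓘(ℝ, Euc n)))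
      (fun r : ℝ => (r, z)) (Icc (0 : ℝ) 1) t :=
    mdifferentiableWithinAt_id.prodMk mdifferentiableWithinAt_const
  have h3 : MapsTo (fun r : ℝ => (r, z)) (Icc (0 : ℝ) 1) (Icc (0 : ℝ) 1 ×ˢ U) :=
    fun r hr => ⟨hr, hz⟩
  exact h1.comp t h2 h3

/-- Hamilton's principal function is smooth in every pair of charts. -/
theorem SolvesNearDiagonal.contDiffOn_principalFunction [IsManifold 𝓘(ℝ, Euc n) ∞ M]
    (hΓ : SolvesNearDiagonal L U Γ)
    (hL : ∀ φ ∈ IsManifold.maximalAtlas 𝓘(ℝ, Euc n) ∞ M,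
      ContDiffOn ℝ ∞ (fun p : Euc n × Euc n => lagrangianCoord L φ p.1 p.2) (φ.target ×ˢ univ))
    (hφ₁ : φ₁ ∈ IsManifold.maximalAtlas 𝓘(ℝ, Euc n) ∞ M)
    (hφ₂ : φ₂ ∈ IsManifold.maximalAtlas 𝓘(ℝ, Euc n) ∞ M) :
    ContDiffOn ℝ ∞ (fun z : Euc n × Euc n => principalFunction L Γ (φ₁.symm z.1, φ₂.symm z.2))
      (pairDomain φ₁ φ₂ U) := by
  have hV := isOpen_pairDomain φ₁ φ₂ hΓ.isOpen
  have hc := hΓ.contMDiffOn_coord hφ₁ hφ₂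
  set V := pairDomain φ₁ φ₂ U with hVdef
  set c : ℝ × (Euc n × Euc n) → M := fun p => Γ (p.1, (φ₁.symm p.2.1, φ₂.symm p.2.2)) with hcdef
  refine contDiffOn_intervalIntegral (f := fun p : ℝ × (Euc n × Euc n) =>
    L (c p) (velocity (fun t => c (t, p.2)) p.1)) hV ?_
  -- A motion may leave the charts around its end points, so smoothness of the integrand is checked
  -- near each `(t₀, z₀)`, in a chart around the point reached at time `t₀`.
  rintro ⟨t₀, z₀⟩ ⟨ht₀, hz₀⟩
  set φ := chartAt (Euc n) (c (t₀, z₀)) with hφdef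
  have hφ : φ ∈ IsManifold.maximalAtlas 𝓘(ℝ, Euc n) ∞ M := IsManifold.chart_mem_maximalAtlas _
  have hnear : c ⁻¹' φ.source ∈ 𝓝[Icc (0 : ℝ) 1 ×ˢ V] (t₀, z₀) :=
    (hc.continuousOn (t₀, z₀) ⟨ht₀, hz₀⟩).preimage_mem_nhdsWithin
      (φ.open_source.mem_nhds (mem_chart_source _ _))
  obtain ⟨W, hW, hWsub⟩ := mem_nhdsWithin_iff_exists_mem_nhds_inter.1 hnear
  obtain ⟨J, hJ, V₁, hV₁, hJV⟩ := mem_nhds_prod_iff.1 hW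
  obtain ⟨J', hJ'J, hJ'o, htJ'⟩ := mem_nhds_iff.1 hJ
  obtain ⟨V₂, hV₂V, hV₂o, hzV₂⟩ := mem_nhds_iff.1 hV₁
  set I := Icc (0 : ℝ) 1 ∩ J' with hI
  set V' := V ∩ V₂ with hV'
  have hIu : UniqueDiffOn ℝ I := (uniqueDiffOn_Icc zero_lt_one).inter hJ'o
  have hV'o : IsOpen V' := hV.inter hV₂o
  have hsub : I ×ˢ V' ⊆ Icc (0 : ℝ) 1 ×ˢ V := prod_mono inter_subset_left inter_subset_left
  have hsrc : ∀ p ∈ I ×ˢ V', c p ∈ φ.source := fun p hp =>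
    hWsub ⟨hJV ⟨hJ'J hp.1.2, hV₂V hp.2.2⟩, hsub hp⟩
  have hcφ : ContDiffOn ℝ ∞ (fun p => φ (c p)) (I ×ˢ V') := by
    rw [← contMDiffOn_iff_contDiffOn]
    exact (contMDiffOn_of_mem_maximalAtlas hφ).comp (hc.mono hsub) hsrc
  have hvel := contDiffOn_derivWithin_family hIu hV'o hcφ
  have hcomp : ContDiffOn ℝ ∞ (fun p : ℝ × (Euc n × Euc n) => lagrangianCoord L φ (φ (c p))
      (derivWithin (fun r => φ (c (r, p.2))) I p.1)) (I ×ˢ V') :=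
    (hL φ hφ).comp (hcφ.prodMk hvel) fun p hp => ⟨φ.map_source (hsrc p hp), mem_univ _⟩
  have heq : ∀ p ∈ I ×ˢ V', L (c p) (velocity (fun t => c (t, p.2)) p.1) =
      lagrangianCoord L φ (φ (c p)) (derivWithin (fun r => φ (c (r, p.2))) I p.1) := by
    intro p hp
    have h1 := lagrangian_velocity L hφ (γ := fun t => c (t, p.2)) hp.1.1
      (hΓ.mdifferentiableWithinAt hp.2.1.2 hp.1.1) (hsrc p hp)
    -- The velocity within the shorter interval `I` is the velocity within `[0, 1]`, as `J'` is
    -- open; at the ends of `[0, 1]` both are one-sided.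
    rw [hI, derivWithin_inter (hJ'o.mem_nhds hp.1.2)]
    exact h1
  have hfin := (hcomp.congr heq) (t₀, z₀) ⟨⟨ht₀, htJ'⟩, ⟨hz₀, hzV₂⟩⟩
  refine hfin.mono_of_mem_nhdsWithin ?_
  have : J' ×ˢ V₂ ∈ 𝓝 (t₀, z₀) := (hJ'o.prod hV₂o).mem_nhds ⟨htJ', hzV₂⟩
  filter_upwards [self_mem_nhdsWithin, nhdsWithin_le_nhds this] with p hp hp'
  exact ⟨⟨hp.1, hp'.1⟩, ⟨hp.2, hp'.2⟩⟩

theorem SolvesNearDiagonal.contMDiffOn_principalFunction [IsManifold 𝓘(ℝ, Euc n) ∞ M]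
    (hΓ : SolvesNearDiagonal L U Γ)
    (hL : ∀ φ ∈ IsManifold.maximalAtlas 𝓘(ℝ, Euc n) ∞ M,
      ContDiffOn ℝ ∞ (fun p : Euc n × Euc n => lagrangianCoord L φ p.1 p.2) (φ.target ×ˢ univ)) :
    ContMDiffOn (𝓘(ℝ, Euc n).prod 𝓘(ℝ, Euc n)) 𝓘(ℝ, ℝ) ∞ (principalFunction L Γ) U := by
  intro p hp
  set φ₁ := chartAt (Euc n) p.1
  set φ₂ := chartAt (Euc n) p.2
  have hφ₁ : φ₁ ∈ IsManifold.maximalAtlas 𝓘(ℝ, Euc n) ∞ M := IsManifold.chart_mem_maximalAtlas _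
  have hφ₂ : φ₂ ∈ IsManifold.maximalAtlas 𝓘(ℝ, Euc n) ∞ M := IsManifold.chart_mem_maximalAtlas _
  have hp₁ : p.1 ∈ φ₁.source := mem_chart_source _ _
  have hp₂ : p.2 ∈ φ₂.source := mem_chart_source _ _
  have h1 : ContMDiffOn (𝓘(ℝ, Euc n).prod 𝓘(ℝ, Euc n)) 𝓘(ℝ, Euc n × Euc n) ∞
      (fun q : M × M => (φ₁ q.1, φ₂ q.2)) ((φ₁.source ×ˢ φ₂.source) ∩ U) :=
    ContMDiffOn.prodMk_space
      ((contMDiffOn_of_mem_maximalAtlas hφ₁).comp contMDiffOn_fst fun q hq => hq.1.1)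
      ((contMDiffOn_of_mem_maximalAtlas hφ₂).comp contMDiffOn_snd fun q hq => hq.1.2)
  have hinv : ∀ q ∈ (φ₁.source ×ˢ φ₂.source) ∩ U,
      (φ₁.symm (φ₁ q.1), φ₂.symm (φ₂ q.2)) = q := fun q hq => by
    rw [φ₁.left_inv hq.1.1, φ₂.left_inv hq.1.2]
  have h2 := (contMDiffOn_iff_contDiffOn.2 (hΓ.contDiffOn_principalFunction hL hφ₁ hφ₂)).comp h1
    fun q hq => ⟨⟨φ₁.map_source hq.1.1, φ₂.map_source hq.1.2⟩, by
      simp only [mem_preimage, hinv q hq]; exact hq.2⟩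
  have h3 := h2.congr (f₁ := principalFunction L Γ) fun q hq => by
    simp only [Function.comp_apply, hinv q hq]
  refine (h3 p ⟨⟨hp₁, hp₂⟩, hp⟩).mono_of_mem_nhdsWithin ?_
  exact inter_mem (nhdsWithin_le_nhds ((φ₁.open_source.prod φ₂.open_source).mem_nhds ⟨hp₁, hp₂⟩))
    self_mem_nhdsWithin

/-- The pairs of points in a chart whose connecting motion stays in the chart. -/
def motionDomain (φ : OpenPartialHomeomorph M (Euc n)) (U : Set (M × M)) (Γ : ℝ × (M × M) → M) :
    Set (Euc n × Euc n) :=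
  {z ∈ pairDomain φ φ U | ∀ t ∈ Icc (0 : ℝ) 1, Γ (t, (φ.symm z.1, φ.symm z.2)) ∈ φ.source}

theorem SolvesNearDiagonal.diag_mem_pairDomain (hΓ : SolvesNearDiagonal L U Γ) {x : Euc n}
    (hx : x ∈ φ.target) : (x, x) ∈ pairDomain φ φ U :=
  ⟨⟨hx, hx⟩, hΓ.diagonal_mem _⟩

theorem SolvesNearDiagonal.diag_mem_motionDomain (hΓ : SolvesNearDiagonal L U Γ) {x : Euc n}
    (hx : x ∈ φ.target) : (x, x) ∈ motionDomain φ U Γ :=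
  ⟨hΓ.diag_mem_pairDomain hx, fun t ht => by
    rw [hΓ.rest _ t ht]
    exact φ.map_target hx⟩

/-- The motions in a chart. -/
theorem SolvesNearDiagonal.isMotionFamily (hΓ : SolvesNearDiagonal L U Γ)
    (hφ : φ ∈ IsManifold.maximalAtlas 𝓘(ℝ, Euc n) ∞ M) :
    IsMotionFamily (lagrangianCoord L φ) φ.target (motionDomain φ U Γ)
      (fun p => φ (Γ (p.1, (φ.symm p.2.1, φ.symm p.2.2)))) where
  isOpen := by
    have hc := (hΓ.contMDiffOn_coord hφ hφ).continuousOn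
    have hV := isOpen_pairDomain φ φ hΓ.isOpen
    rw [isOpen_iff_mem_nhds]
    rintro z ⟨hz, hzs⟩
    -- A tube argument over the compact time interval. The condition on `t` is repeated inside
    -- because the local neighbourhoods also contain times outside `[0, 1]`, where nothing is known.
    have h3 : ∀ᶠ z' in 𝓝 z, ∀ t ∈ Icc (0 : ℝ) 1,
        t ∈ Icc (0 : ℝ) 1 → Γ (t, (φ.symm z'.1, φ.symm z'.2)) ∈ φ.source := by
      refine isCompact_Icc.eventually_forall_of_forall_eventually fun t ht => ?_
      have h2 := (hc (t, z) ⟨ht, hz⟩).preimage_mem_nhdsWithin (φ.open_source.mem_nhds (hzs t ht))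
      rw [mem_nhdsWithin_iff_eventually] at h2
      have hsw : Tendsto (fun p : (Euc n × Euc n) × ℝ => (p.2, p.1)) (𝓝 (z, t)) (𝓝 (t, z)) :=
        continuous_swap.continuousAt
      filter_upwards [hsw.eventually h2,
        (continuous_fst.tendsto (z, t)).eventually (hV.mem_nhds hz)] with p hp hpV hpt
      exact hp ⟨hpt, hpV⟩
    filter_upwards [hV.mem_nhds hz, h3] with z' hz' hz's
    exact ⟨hz', fun t ht => hz's t ht ht⟩
  smooth := by
    rw [← contMDiffOn_iff_contDiffOn]
    exact (contMDiffOn_of_mem_maximalAtlas hφ).comp ((hΓ.contMDiffOn_coord hφ hφ).mono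
      (prod_mono le_rfl (sep_subset _ _))) fun p hp => hp.2.2 p.1 hp.1
  mem z hz t ht := φ.map_source (hz.2 t ht)
  start z hz := by
    simp only [hΓ.start _ hz.1.2]
    exact φ.right_inv hz.1.1.1
  finish z hz := by
    simp only [hΓ.finish _ hz.1.2]
    exact φ.right_inv hz.1.1.2
  rest q hq t ht := by
    simp only [hΓ.rest _ t ht]
    exact φ.right_inv hq.1.1.1
  motion z hz t ht := hasDerivWithinAt_clm_of_components fun i =>
    hΓ.motion _ hz.1.2 φ hφ t ht (hz.2 t ht) i

theorem SolvesNearDiagonal.principalFunction_eq (hΓ : SolvesNearDiagonal L U Γ)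
    (hφ : φ ∈ IsManifold.maximalAtlas 𝓘(ℝ, Euc n) ∞ M) {z : Euc n × Euc n}
    (hz : z ∈ motionDomain φ U Γ) :
    twoPointCoord (principalFunction L Γ) φ z = ∫ t in (0 : ℝ)..1,
      lagrangianCoord L φ (φ (Γ (t, (φ.symm z.1, φ.symm z.2))))
        (derivWithin (fun r => φ (Γ (r, (φ.symm z.1, φ.symm z.2)))) (Icc (0 : ℝ) 1) t) := by
  refine intervalIntegral.integral_congr fun t ht => ?_
  rw [uIcc_of_le zero_le_one] at ht
  exact lagrangian_velocity L hφ ht (hΓ.mdifferentiableWithinAt hz.1.2 ht) (hz.2 t ht)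

end Transport

end HamiltonPotential

namespace HamiltonPotential

set_option maxSynthPendingDepth 3

open Filter Topology

/-! ### Hamilton's principal function has the potential jet -/

section Potential

variable {n : ℕ} {M : Type*} [TopologicalSpace M] [ChartedSpace (Euc n) M]
  {φ : OpenPartialHomeomorph M (Euc n)}

/-- A tensor of order three in coordinates. -/
noncomputable def cubicCoord (T : CovTensorField 3 n M) (φ : OpenPartialHomeomorph M (Euc n))
    (x h k l : Euc n) : ℝ :=
  T.toFun (φ.symm x) ![chartVec φ x h, chartVec φ x k, chartVec φ x l]

theorem cubicCoord_add (T : CovTensorField 3 n M) (φ : OpenPartialHomeomorph M (Euc n))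
    (x h h' k l : Euc n) :
    cubicCoord T φ x (h + h') k l = cubicCoord T φ x h k l + cubicCoord T φ x h' k l := by
  rw [cubicCoord, chartVec_add]
  exact (T.toFun (φ.symm x)).cons_add ![chartVec φ x k, chartVec φ x l] _ _

theorem cubicCoord_smul (T : CovTensorField 3 n M) (φ : OpenPartialHomeomorph M (Euc n))
    (x : Euc n) (s : ℝ) (h k l : Euc n) :
    cubicCoord T φ x (s • h) k l = s * cubicCoord T φ x h k l := by
  rw [cubicCoord, chartVec_smul]
  exact (T.toFun (φ.symm x)).cons_smul ![chartVec φ x k, chartVec φ x l] _ _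

theorem cubicCoord_symm₁ {T : CovTensorField 3 n M} (hT : T.IsSymmetric)
    (φ : OpenPartialHomeomorph M (Euc n)) (x h k l : Euc n) :
    cubicCoord T φ x h k l = cubicCoord T φ x k h l := by
  rw [cubicCoord, cubicCoord, ← hT _ (Equiv.swap 0 1)]
  congr 1
  ext a
  fin_cases a <;> rfl

theorem cubicCoord_symm₂ {T : CovTensorField 3 n M} (hT : T.IsSymmetric)
    (φ : OpenPartialHomeomorph M (Euc n)) (x h k l : Euc n) :
    cubicCoord T φ x h k l = cubicCoord T φ x h l k := by
  rw [cubicCoord, cubicCoord, ← hT _ (Equiv.swap 1 2)]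
  congr 1
  ext a
  fin_cases a <;> rfl

theorem cubicCoord_diag (T : CovTensorField 3 n M) (φ : OpenPartialHomeomorph M (Euc n))
    (x h : Euc n) : cubicCoord T φ x h h h = T.toFun (φ.symm x) (fun _ => chartVec φ x h) := by
  rw [cubicCoord]
  congr 1
  ext a
  fin_cases a <;> rfl

theorem cubicCoord_basis (T : CovTensorField 3 n M) (φ : OpenPartialHomeomorph M (Euc n))
    (x : Euc n) (j k l : Fin n) :
    cubicCoord T φ x (basisVec j) (basisVec k) (basisVec l) = tensorCoord T φ ![j, k, l] x := by
  rw [cubicCoord, tensorCoord]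
  congr 1
  ext a
  fin_cases a <;> rfl

theorem cubicCoord_field (T : CovTensorField 3 n M)
    (hφ : φ ∈ IsManifold.maximalAtlas 𝓘(ℝ, Euc n) ∞ M) {x : Euc n} (hx : x ∈ φ.target)
    (X Y Z : ∀ p : M, TangentSpace 𝓘(ℝ, Euc n) p) :
    cubicCoord T φ x (fieldCoord φ X x) (fieldCoord φ Y x) (fieldCoord φ Z x) =
      T.toFun (φ.symm x) ![X (φ.symm x), Y (φ.symm x), Z (φ.symm x)] := by
  simp only [cubicCoord, fieldCoord, chartVec_vecCoord hφ hx]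

/-- Lie derivatives along lifts in coordinates. -/
theorem eqOn_lieD_lift (hφ : φ ∈ IsManifold.maximalAtlas 𝓘(ℝ, Euc n) ∞ M)
    {V : Set (Euc n × Euc n)} (hV : IsOpen V) (hVφ : V ⊆ φ.target ×ˢ φ.target) {F : M × M → ℝ}
    {F' : Euc n × Euc n → ℝ} (hF : EqOn (twoPointCoord F φ) F' V) (hF' : ContDiffOn ℝ ∞ F' V)
    (a : Side) (X : ∀ p : M, TangentSpace 𝓘(ℝ, Euc n) p) :
    EqOn (twoPointCoord (lieD (lift a X) F) φ) (dirD (coordLift a (fieldCoord φ X)) F') V := by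
  intro z hz
  have e := hF.eventuallyEq_of_mem (hV.mem_nhds hz)
  have hd : DifferentiableAt ℝ (twoPointCoord F φ) z :=
    (((hF'.contDiffAt (hV.mem_nhds hz)).congr_of_eventuallyEq e)).differentiableAt (by simp)
  refine (lieD_eq_fderiv hφ (hVφ hz) hd (lift a X)).trans ?_
  rw [dirD, e.fderiv_eq]
  congr 1
  have h0 : ∀ p, vecCoord φ p (0 : TangentSpace 𝓘(ℝ, Euc n) p) = 0 := fun p =>
    map_zero (mfderiv 𝓘(ℝ, Euc n) 𝓘(ℝ, Euc n) φ p)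
  cases a
  · exact Prod.ext rfl (h0 _)
  · exact Prod.ext (h0 _) rfl

section Words

variable (hφ : φ ∈ IsManifold.maximalAtlas 𝓘(ℝ, Euc n) ∞ M)
  {V : Set (Euc n × Euc n)} (hV : IsOpen V) (hVφ : V ⊆ φ.target ×ˢ φ.target) {S : M × M → ℝ}
  (hS : ContDiffOn ℝ ∞ (twoPointCoord S φ) V)
  [IsManifold 𝓘(ℝ, Euc n) ∞ M]
  {X Y Z W : ∀ p : M, TangentSpace 𝓘(ℝ, Euc n) p} {x : Euc n} (hx : (x, x) ∈ V)
include hφ hV hVφ hS hx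

theorem diag2_eq_dirDs (hY : IsSmoothField Y) (a b : Side) :
    diag2 S a b X Y (φ.symm x) =
      dirDs [coordLift a (fieldCoord φ X), coordLift b (fieldCoord φ Y)]
        (twoPointCoord S φ) (x, x) :=
  eqOn_lieD_lift hφ hV hVφ (eqOn_lieD_lift hφ hV hVφ (fun _ _ => rfl) hS b Y)
    (contDiffOn_dirD hV (contDiffOn_coordLift hVφ (contDiffOn_fieldCoord hφ hY) b) hS) a X hx

theorem diag3_eq_dirDs (hY : IsSmoothField Y) (hZ : IsSmoothField Z) (a b c : Side) :
    diag3 S a b c X Y Z (φ.symm x) =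
      dirDs [coordLift a (fieldCoord φ X), coordLift b (fieldCoord φ Y),
        coordLift c (fieldCoord φ Z)] (twoPointCoord S φ) (x, x) := by
  have hl : ∀ {U : ∀ p : M, TangentSpace 𝓘(ℝ, Euc n) p}, IsSmoothField U → ∀ s,
      ContDiffOn ℝ ∞ (coordLift s (fieldCoord φ U)) V := fun hU s =>
    contDiffOn_coordLift hVφ (contDiffOn_fieldCoord hφ hU) s
  have h1 := contDiffOn_dirD hV (hl hZ c) hS
  exact eqOn_lieD_lift hφ hV hVφ (eqOn_lieD_lift hφ hV hVφ
    (eqOn_lieD_lift hφ hV hVφ (fun _ _ => rfl) hS c Z) h1 b Y)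
    (contDiffOn_dirD hV (hl hY b) h1) a X hx

theorem diag4_eq_dirDs (hY : IsSmoothField Y) (hZ : IsSmoothField Z) (hW : IsSmoothField W)
    (a b c d : Side) :
    diag4 S a b c d X Y Z W (φ.symm x) =
      dirDs [coordLift a (fieldCoord φ X), coordLift b (fieldCoord φ Y),
        coordLift c (fieldCoord φ Z), coordLift d (fieldCoord φ W)]
        (twoPointCoord S φ) (x, x) := by
  have hl : ∀ {U : ∀ p : M, TangentSpace 𝓘(ℝ, Euc n) p}, IsSmoothField U → ∀ s,
      ContDiffOn ℝ ∞ (coordLift s (fieldCoord φ U)) V := fun hU s =>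
    contDiffOn_coordLift hVφ (contDiffOn_fieldCoord hφ hU) s
  have h1 := contDiffOn_dirD hV (hl hW d) hS
  have h2 := contDiffOn_dirD hV (hl hZ c) h1
  exact eqOn_lieD_lift hφ hV hVφ (eqOn_lieD_lift hφ hV hVφ (eqOn_lieD_lift hφ hV hVφ
    (eqOn_lieD_lift hφ hV hVφ (fun _ _ => rfl) hS d W) h1 c Z) h2 b Y)
    (contDiffOn_dirD hV (hl hY b) h2) a X hx

end Words

variable [IsManifold 𝓘(ℝ, Euc n) ∞ M] {g : RiemMetric n M} {α : ℝ} {T : CovTensorField 3 n M}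
  {C : CovTensorField 4 n M} {U : Set (M × M)} {Γ : ℝ × (M × M) → M}

theorem exists_chart (p : M) : ∃ φ ∈ IsManifold.maximalAtlas 𝓘(ℝ, Euc n) ∞ M,
    ∃ x ∈ φ.target, φ.symm x = p :=
  ⟨chartAt (Euc n) p, IsManifold.chart_mem_maximalAtlas p, chartAt (Euc n) p p,
    mem_chart_target (Euc n) p, (chartAt (Euc n) p).left_inv (mem_chart_source (Euc n) p)⟩

/-- The metric in coordinates. -/
noncomputable def bilinCoord (g : RiemMetric n M) (φ : OpenPartialHomeomorph M (Euc n))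
    (x h k : Euc n) : ℝ :=
  g.inner (φ.symm x) (chartVec φ x h) (chartVec φ x k)

/-- The analytic and the formal part meet here. With `a = g / 2` and `b = α / 6 * T` in the action
expansion, the second derivative is `2 a = g`, and the third is `6 (∂_h a / 2 + b) = 3 / 2 ∂_h g + α
T`. -/
theorem hasPotentialJet_principalFunction (hT : T.IsSymmetric)
    (hΓ : SolvesNearDiagonal (lagrangian g α T C) U Γ)
    (hφ : φ ∈ IsManifold.maximalAtlas 𝓘(ℝ, Euc n) ∞ M) :
    HasPotentialJet (twoPointCoord (principalFunction (lagrangian g α T C) Γ) φ)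
      (pairDomain φ φ U) φ.target (bilinCoord g φ)
      (fun x h k l => α * cubicCoord T φ x h k l) := by
  have hL := isQuarticLagrangian_coord g α T C hφ
  have hc := hΓ.isMotionFamily hφ
  set F := twoPointCoord (principalFunction (lagrangian g α T C) Γ) φ with hF
  have hV := isOpen_pairDomain φ φ hΓ.isOpen
  have hsm : ContDiffOn ℝ ∞ F (pairDomain φ φ U) := hΓ.contDiffOn_principalFunction
    (fun ψ hψ => (isQuarticLagrangian_coord g α T C hψ).smooth) hφ hφ
  have hjet : ∀ x ∈ φ.target, ∀ h : Euc n,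
      fderiv ℝ (fderiv ℝ F) (x, x) (0, h) (0, h) = bilinCoord g φ x h h ∧
      fderiv ℝ (fderiv ℝ (fderiv ℝ F)) (x, x) (0, h) (0, h) (0, h) =
        3 / 2 * fderiv ℝ (fun y => bilinCoord g φ y h h) x h + α * cubicCoord T φ x h h h := by
    intro x hx h
    obtain ⟨K, hK⟩ := hc.action_expansion hL (hΓ.diag_mem_motionDomain hx) h
    have hF4 : ContDiffAt ℝ 4 F (x, x) :=
      (hsm.contDiffAt (hV.mem_nhds (hΓ.diag_mem_pairDomain hx))).of_le (ofNat_le_infty 4)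
    have hcont : Tendsto (fun s : ℝ => ((x, x + s • h) : Euc n × Euc n)) (𝓝 0) (𝓝 (x, x)) := by
      have : Continuous fun s : ℝ => ((x, x + s • h) : Euc n × Euc n) := by fun_prop
      simpa using this.tendsto 0
    have hmem := hcont.eventually (hc.isOpen.mem_nhds (hΓ.diag_mem_motionDomain hx))
    have hexp := fderiv_eq_of_expansion (u := ((0, h) : Euc n × Euc n)) hF4
      (K := K) (by
        filter_upwards [hK, hmem] with s hs hs'
        rw [show ((x, x) : Euc n × Euc n) + s • (0, h) = (x, x + s • h) by simp, hF,
          hΓ.principalFunction_eq hφ hs']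
        exact hs)
    have hD : fderiv ℝ (fun y => 1 / 2 * g.inner (φ.symm y) (chartVec φ y h) (chartVec φ y h)) x =
        (1 / 2 : ℝ) • fderiv ℝ (fun y => bilinCoord g φ y h h) x := by
      have hd : DifferentiableAt ℝ (fun y => bilinCoord g φ y h h) x :=
        ((((contDiffOn_metric g hφ).comp (contDiff_prodMk_left h).contDiffOn
          fun y hy => ⟨hy, mem_univ _⟩).contDiffAt (φ.open_target.mem_nhds hx))).differentiableAt
          (by simp)
      exact fderiv_const_mul hd _
    refine ⟨?_, ?_⟩
    · rw [hexp.2.1, bilinCoord]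
      ring
    · rw [hexp.2.2, hD, cubicCoord_diag, smul_apply, smul_eq_mul]
      ring
  exact {
    isOpen := hV
    isOpen_base := φ.open_target
    diag_mem := fun x hx => hΓ.diag_mem_pairDomain hx
    smooth := hsm
    fderiv_eq_zero := fun x hx => by
      -- Smoothness holds on all of `pairDomain`, the integral formula in one chart only on
      -- `motionDomain`; the latter is still a neighbourhood of each diagonal point.
      have e : F =ᶠ[𝓝 (x, x)] _ := eventually_of_mem
        (hc.isOpen.mem_nhds (hΓ.diag_mem_motionDomain hx)) fun z hz =>
          hΓ.principalFunction_eq hφ hz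
      rw [e.fderiv_eq]
      exact (IsMotionFamily.hasFDerivAt_action hL hc (hΓ.diag_mem_motionDomain hx)).fderiv
    subset := inter_subset_left
    G_add := fun x _ h h' k => by simp [bilinCoord, chartVec_add]
    G_smul := fun x _ s h k => by simp [bilinCoord, chartVec_smul]
    G_symm := fun x _ h k => g.symm _ _ _
    t_add := fun x _ h h' k l => by rw [cubicCoord_add, mul_add]
    t_smul := fun x _ s h k l => by rw [cubicCoord_smul, mul_left_comm]
    t_symm₁ := fun x _ h k l => by rw [cubicCoord_symm₁ hT]
    t_symm₂ := fun x _ h k l => by rw [cubicCoord_symm₂ hT]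
    quadratic := fun x hx h => (hjet x hx h).1
    cubic := fun x hx h => (hjet x hx h).2 }

end Potential

end HamiltonPotential

/-! ### The main theorem -/

open HamiltonPotential
theorem mainTheorem2 {n : ℕ} {M : Type*} [TopologicalSpace M] [ChartedSpace (Euc n) M]
    [IsManifold 𝓘(ℝ, Euc n) ∞ M] (g : RiemMetric n M) (T : CovTensorField 3 n M)
    (hT : T.IsSymmetric) (C : CovTensorField 4 n M) (α : ℝ)
    (U : Set (M × M)) (Γ : ℝ × (M × M) → M)
    (hΓ : SolvesNearDiagonal (lagrangian g α T C) U Γ)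
    (S : M × M → ℝ) (hS : S = principalFunction (lagrangian g α T C) Γ) :
    -- `S` is smooth near the diagonal and a potential function
    ContMDiffOn (𝓘(ℝ, Euc n).prod 𝓘(ℝ, Euc n)) 𝓘(ℝ, ℝ) ∞ S U ∧
    IsPotentialFunction (n := n) S ∧
    -- `S` generates `g`
    (∀ X Y : ∀ p : M, TangentSpace 𝓘(ℝ, Euc n) p, IsSmoothField X → IsSmoothField Y → ∀ p : M,
      diag2 S Side.L Side.L X Y p = g.inner p (X p) (Y p) ∧
      diag2 S Side.R Side.R X Y p = g.inner p (X p) (Y p) ∧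
      diag2 S Side.R Side.L X Y p = -g.inner p (X p) (Y p) ∧
      diag2 S Side.L Side.R X Y p = -g.inner p (X p) (Y p)) ∧
    -- the second and third derivatives of `S` on the diagonal, in coordinates
    (∀ φ ∈ IsManifold.maximalAtlas 𝓘(ℝ, Euc n) ∞ M, ∀ q ∈ φ.target, ∀ i j k l : Fin n,
      partialY i (partialX j (twoPointCoord S φ)) (q, q) = -metricCoord g φ i j q ∧
      partialX i (partialY j (twoPointCoord S φ)) (q, q) = -metricCoord g φ i j q ∧
      partialX i (partialX j (twoPointCoord S φ)) (q, q) = metricCoord g φ i j q ∧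
      partialY i (partialY j (twoPointCoord S φ)) (q, q) = metricCoord g φ i j q ∧
      partialX l (partialX k (partialY j (twoPointCoord S φ))) (q, q) =
        -christoffel g φ j k l q + α * tensorCoord T φ ![j, k, l] q ∧
      partialY l (partialY k (partialX j (twoPointCoord S φ))) (q, q) =
        -christoffel g φ j k l q - α * tensorCoord T φ ![j, k, l] q) ∧
    -- for `α = 1/2`, `S` generates `T` (up to sign for the other combinations of lifts)
    (α = 1 / 2 →
      ∀ X Y Z : ∀ p : M, TangentSpace 𝓘(ℝ, Euc n) p,
        IsSmoothField X → IsSmoothField Y → IsSmoothField Z → ∀ p : M,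
        diag3 S Side.L Side.L Side.R X Y Z p - diag3 S Side.R Side.R Side.L X Y Z p =
          T.toFun p ![X p, Y p, Z p] ∧
        diag3 S Side.L Side.R Side.R X Y Z p - diag3 S Side.R Side.L Side.L X Y Z p =
          -T.toFun p ![X p, Y p, Z p] ∧
        diag3 S Side.L Side.R Side.L X Y Z p - diag3 S Side.R Side.L Side.R X Y Z p =
          T.toFun p ![X p, Y p, Z p] ∧
        diag3 S Side.L Side.L Side.L X Y Z p - diag3 S Side.R Side.R Side.R X Y Z p =
          -T.toFun p ![X p, Y p, Z p]) ∧
    -- the fourth order combinations vanish identically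
    (∀ X Y Z W : ∀ p : M, TangentSpace 𝓘(ℝ, Euc n) p,
      IsSmoothField X → IsSmoothField Y → IsSmoothField Z → IsSmoothField W → ∀ p : M,
      Q1 S X Y Z W p = 0 ∧ Q2 S X Y Z W p = 0) := by
  subst hS
  have hj := fun φ (hφ : φ ∈ IsManifold.maximalAtlas 𝓘(ℝ, Euc n) ∞ M) =>
    hasPotentialJet_principalFunction hT hΓ hφ
  have hfield : ∀ φ ∈ IsManifold.maximalAtlas 𝓘(ℝ, Euc n) ∞ M, ∀ x ∈ φ.target,
      ∀ X Y : ∀ p : M, TangentSpace 𝓘(ℝ, Euc n) p,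
      bilinCoord g φ x (fieldCoord φ X x) (fieldCoord φ Y x) =
        g.inner (φ.symm x) (X (φ.symm x)) (Y (φ.symm x)) := fun φ hφ x hx X Y => by
    simp only [bilinCoord, fieldCoord, chartVec_vecCoord hφ hx]
  set S := principalFunction (lagrangian g α T C) Γ with hS
  refine ⟨hΓ.contMDiffOn_principalFunction fun ψ hψ =>
    (isQuarticLagrangian_coord g α T C hψ).smooth, ?_, ?_, ?_, ?_, ?_⟩
  · intro V _ p
    obtain ⟨φ, hφ, x, hx, rfl⟩ := exists_chart (n := n) p
    have h := hj φ hφ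
    rw [lieD_eq_fderiv (z := (x, x)) hφ ⟨hx, hx⟩ ((h.smooth.contDiffAt
      (h.isOpen.mem_nhds (h.diag_mem x hx))).differentiableAt (by simp)),
      h.fderiv_eq_zero x hx]
    rfl
  · intro X Y _ hY p
    obtain ⟨φ, hφ, x, hx, rfl⟩ := exists_chart (n := n) p
    have h := hj φ hφ
    -- All four words follow at once: each is `g` times the product of the signs of its two letters.
    have h2 := fun a b =>
      ((diag2_eq_dirDs (X := X) hφ h.isOpen h.subset h.smooth (h.diag_mem x hx) hY a b).trans
        (h.lift₂ (contDiffOn_fieldCoord hφ hY) a b hx)).trans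
        (congrArg (a.sign * b.sign * ·) (hfield φ hφ x hx X Y))
    refine ⟨(h2 _ _).trans ?_, (h2 _ _).trans ?_, (h2 _ _).trans ?_, (h2 _ _).trans ?_⟩ <;>
      simp [Side.sign]
  · intro φ hφ q hq i j k l
    have h := hj φ hφ
    have hqV := h.diag_mem q hq
    have h2 := fun u v => (dirD_const₂ h.isOpen h.smooth hqV u v).trans (h.hessian hq u v)
    have hneg : ∀ e e', bilinCoord g φ q (-e) e' = -bilinCoord g φ q e e' := fun e e' => by
      rw [← neg_one_smul ℝ e, h.G_smul q hq, neg_one_mul]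
    have hneg' : ∀ e e', bilinCoord g φ q e (-e') = -bilinCoord g φ q e e' := fun e e' => by
      rw [h.G_symm q hq, hneg, h.G_symm q hq]
    refine ⟨(h2 _ _).trans ?_, (h2 _ _).trans ?_, (h2 _ _).trans ?_, (h2 _ _).trans ?_, ?_, ?_⟩
    · simp [hneg']; rfl
    · simp [hneg]; rfl
    · simp [hneg, hneg']; rfl
    · simp; rfl
    · refine ((dirD_const₃ h.isOpen h.smooth hqV _ _ _).trans
        (h.third_xxy hq (basisVec j) (basisVec k) (basisVec l))).trans ?_
      rw [cubicCoord_basis]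
      rfl
    · refine ((dirD_const₃ h.isOpen h.smooth hqV _ _ _).trans
        (h.third_yyx hq (basisVec j) (basisVec k) (basisVec l))).trans ?_
      rw [cubicCoord_basis]
      rfl
  · intro hα X Y Z hX hY hZ p
    obtain ⟨φ, hφ, x, hx, rfl⟩ := exists_chart (n := n) p
    have h := hj φ hφ
    simp only [diag3_eq_dirDs hφ h.isOpen h.subset h.smooth (h.diag_mem x hx) hY hZ]
    have h3 := fun a b c => h.lift₃ (contDiffOn_fieldCoord hφ hX) (contDiffOn_fieldCoord hφ hY)
      (contDiffOn_fieldCoord hφ hZ) a b c hx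
    have ht := cubicCoord_field T hφ hx X Y Z
    refine ⟨(h3 Side.L Side.L Side.R).trans ?_, (h3 Side.L Side.R Side.R).trans ?_,
      (h3 Side.L Side.R Side.L).trans ?_, (h3 Side.L Side.L Side.L).trans ?_⟩ <;>
    · rw [← ht, hα]
      simp only [Side.sign]
      ring
  · intro X Y Z W hX hY hZ hW p
    obtain ⟨φ, hφ, x, hx, rfl⟩ := exists_chart (n := n) p
    have h := hj φ hφ
    have hw := diag4_eq_dirDs (X := X) hφ h.isOpen h.subset h.smooth (h.diag_mem x hx) hY hZ hW
    -- The initial letters `LR` give the four brackets of `Q1`, and `LL` those of `Q2`.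
    have h4 := fun a b => h.lift₄ (contDiffOn_fieldCoord hφ hX) (contDiffOn_fieldCoord hφ hY)
      (contDiffOn_fieldCoord hφ hZ) (contDiffOn_fieldCoord hφ hW) a b hx
      (q := fun c d => diag4 S a b c d X Y Z W (φ.symm x) -
        diag4 S a.flip b.flip c.flip d.flip X Y Z W (φ.symm x))
      (fun c d => by rw [hw, hw])
    have h1 := h4 Side.L Side.R
    have h2 := h4 Side.L Side.L
    simp only [Side.flip] at h1 h2
    exact ⟨by rw [Q1]; linarith, by rw [Q2]; linarith⟩
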